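/- \textbf{Setting.} All Hilbert spaces are finite-dimensional. A \emph{three-message $r$-prover quantum interactive proof system} has, for each input $x\in\{0,1\}^*$ and with $r=r(|x|)\ge 1$, a verifier given by sizes $q_V\ge 1$, $q_M\ge 0$, $L\ge 1$ and two circuits $V^1=U_L\cdots U_1$ and $V^2=U_T\cdots U_{L+2}$, $T=2L+1$, of $L$ gates each, generated from $x$ in polynomial time. They act on a private register $\mathsf V$ of $q_V$ qubits and message registers $\mathsf M_1,\dots,\mathsf M_r$ of $q_M$ qubits each; every gate is a Toffoli gate on three different qubits or a pair of Hadamard gates on two different qubits of one and the same register ($\mathsf V$ or some $\mathsf M_i$). Provers choose spaces $\mathcal P_i$, a unit vector $|\Psi\rangle\in\bigotimes_i(\mathcal M_i\otimes\mathcal P_i)$ and unitaries $W^i$ on $\mathcal M_i\otimes\mathcal P_i$; they are accepted with probability $\bigl\|\,|1\rangle\langle1|_{\mathsf V,1}\,V^2\,(\bigotimes_i W^i)\,V^1\,|0^{q_V}\rangle_{\mathsf V}|\Psi\rangle\bigr\|^2$, and $\mathrm{MAP}$ is the supremum of this probability over all provers. The system recognizes a language $A$ with completeness $1$ and soundness $s$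 if $\mathrm{MAP}= 1$ for $x\in A$ and $\mathrm{MAP}\le s(|x|)$ for $x\notin A$. A function $f$ is in $\mathrm{poly}$ if it is bounded by a polynomial, and $s\in 1-\mathrm{poly}^{-1}$ means that $s<1$ and $1/(1-s)\in\mathrm{poly}$. \textbf{The game.} The referee holds a clock register $\mathsf C$ of $T$ qubits and $\mathsf V$; player $i\in[r]$ holds a qubit $\mathsf B_i$, the register $\mathsf M_i$ and a private system $\mathsf P_i$. A strategy consists of spaces $\mathcal P_i$, a density operator $\rho$ on all registers and, for each $i$, a reflection $R_i$ (Hermitian, $R_i^2=1$) on $\mathcal B_i\otimes\mathcal M_i\otimes\mathcal P_i$. Measuring a reflection $R$ gives outcome $a\in\{0,1\}$ with projection $(1+(-1)^aR)/2$. Asked for Pauli operators on $\mathsf B_i,\mathsf M_i$, player $i$ honestly measures them and returns the outcomes; asked the special question, he measures $R_i$ and returns the outcome. A Pauli operator on qubits of $\mathsf C,\mathsf V$ is measured by the referee, and one on qubits of $\mathsf B_i,\mathsf M_i$ by player $i$ at the referee's request. The referee performs one of the following five checks with probability $1/5$ each (all sampling is uniform). \begin{enumerate} \item \emph{Clock check.}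 With probability $1/2$ each: (a) sample $t\in[T-1]$, measure $Z_{\mathsf C,t},Z_{\mathsf C,t+1}$, and reject iff the outcomes are $0,1$; (b) sample $i\in[r]$, ask player $i$ for $Z_{\mathsf B_i}$, measure $Z_{\mathsf C,L+1}$, and reject iff the outcomes differ. \item \emph{Verifier propagation check.} Sample $t\in[T]\setminus\{L+1\}$; measure $Z_{\mathsf C,t-1},Z_{\mathsf C,t+1}$ (the first outcome is taken to be $1$ if $t=1$, the second to be $0$ if $t=T$) and accept unless the outcomes are $1,0$; otherwise measure $X_{\mathsf C,t}$ with outcome $x$ and sample $j\in\{0,1\}$. If $U_t$ is a pair of Hadamard gates on $u_1,u_2$, measure $X_{u_1}X_{u_2},Z_{u_1}Z_{u_2}$ (for $j=0$) or $X_{u_1}Z_{u_2},Z_{u_1}X_{u_2}$ (for $j=1$) with outcomes $a_1,a_2$, and reject iff $x\oplus a_1=x\oplus a_2=1$. If $U_t$ is a Toffoli gate with controls $u_1,u_2$ and target $u_3$, accept if $j=1$; if $j=0$ measure $Z_{u_1},Z_{u_2},X_{u_3}$ with outcomes $a_1,a_2,a_3$, and reject iff ($a_1=a_2=1$ and $x\oplus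 a_3=1$) or ($a_1a_2=0$ and $x=1$). \item \emph{Prover propagation check.} Measure $Z_{\mathsf C,L},Z_{\mathsf C,L+2}$ and accept unless the outcomes are $1,0$; otherwise ask every player $i$ the special question, with answer $a^{(i)}$, measure $X_{\mathsf C,L+1}$, and accept iff the outcome equals $\bigoplus_i a^{(i)}$. \item \emph{Initialization check.} Measure $Z_{\mathsf C,1}$ and accept if the outcome is $1$; otherwise sample a qubit $j$ of $\mathsf V$, measure $Z_{\mathsf V,j}$, and accept iff the outcome is $0$. \item \emph{Output check.} Measure $Z_{\mathsf C,T}$ and accept if the outcome is $0$; otherwise measure $Z_{\mathsf V,1}$ and accept iff the outcome is $1$. \end{enumerate} \textbf{Theorem.} Let $r,p\in\mathrm{poly}$ with $r\ge 1$, and let $s\in 1-\mathrm{poly}^{-1}$. There is $s'\in 1-\mathrm{poly}^{-1}$ such that for every language $A$, every three-message $r$-prover quantum interactive proof system with $q_V,q_M,L\le p(|x|)$ that recognizes $A$ with completeness $1$ and soundness $s$, and every input $x$, the game of the verifier on input $x$ has the following properties: \begin{enumerate} \item if $x\in A$, the supremum of the referee's acceptance probability over all strategies is $1$; moreover, if some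 provers are accepted in the proof system with probability exactly $1$, then some strategy is accepted in the game with probability exactly $1$; \item if $x\notin A$, every strategy is accepted with probability at most $s'(|x|)$. \end{enumerate} -/

import Mathlib

open scoped ComplexOrder

noncomputable section

namespace HonestGame

/-! ### Polynomially bounded quantities -/

/-- `f ∈ poly`. -/
def PolyBounded (f : ℕ → ℝ) : Prop :=
  ∃ p : Polynomial ℕ, ∀ n, f n ≤ ((p.eval n : ℕ) : ℝ)

/-- `s ∈ 1 - poly⁻¹`. -/
def OneMinusInvPoly (s : ℕ → ℝ) : Prop :=
  (∀ n, s n < 1) ∧ PolyBounded fun n => (1 - s n)⁻¹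

/-! ### Operators on a collection of qubits together with private systems

The computational basis of `(ℂ²)^{⊗ Q} ⊗ ⨂ᵢ ℂ^{d i}` is the type `Basis Q d`: a bit for each qubit
label in `Q` and a basis label for each of the private systems of dimensions `d i`. -/

abbrev Basis {r : ℕ} (Q : Type) (d : Fin r → ℕ) : Type := (Q → Bool) × ((i : Fin r) → Fin (d i))

abbrev Op {r : ℕ} (Q : Type) (d : Fin r → ℕ) : Type := Matrix (Basis Q d) (Basis Q d) ℂ

def pauliX : Matrix Bool Bool ℂ := fun a b => if a = b then 0 else 1

def pauliZ : Matrix Bool Bool ℂ := fun a b => if a = b then (if a then -1 else 1) else 0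

def hadamard : Matrix Bool Bool ℂ :=
  fun a b => (if a && b then -1 else 1) / ((Real.sqrt 2 : ℝ) : ℂ)

section Ops

variable {r : ℕ} {Q : Type} [Fintype Q] [DecidableEq Q] {d : Fin r → ℕ}

/-- The operator `A` acting on qubit `u`, tensored with the identity on everything else. -/
def qubitOp (A : Matrix Bool Bool ℂ) (u : Q) : Op Q d := fun s s' =>
  if (∀ w, w ≠ u → s.1 w = s'.1 w) ∧ s.2 = s'.2 then A (s.1 u) (s'.1 u) else 0

/-- The Toffoli gate with control qubits `u₁, u₂` and target qubit `u₃`. -/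
def toffoliOp (u₁ u₂ u₃ : Q) : Op Q d := fun s s' =>
  if s.1 = Function.update s'.1 u₃ (xor (s'.1 u₃) (s'.1 u₁ && s'.1 u₂)) ∧ s.2 = s'.2
  then 1 else 0

end Ops

/-! ### Three-message quantum interactive proofs with `r` provers -/

/-- The qubits the verifier's circuits act on: those of `𝖵` and of the message registers `𝖬ᵢ`. -/
inductive Wire (r qV qM : ℕ) : Type
  | V (j : Fin qV)
  | M (i : Fin r) (j : Fin qM)
  deriving DecidableEq, Fintype

/-- Elementary gates: Toffoli gates on three different qubits, and pairs of Hadamard gates on two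
different qubits of one and the same register (`𝖵` or some `𝖬ᵢ`). -/
inductive Gate (r qV qM : ℕ) : Type
  | toffoli (u₁ u₂ u₃ : Wire r qV qM) (h₁₂ : u₁ ≠ u₂) (h₁₃ : u₁ ≠ u₃) (h₂₃ : u₂ ≠ u₃)
  | hadamardV (j₁ j₂ : Fin qV) (h : j₁ ≠ j₂)
  | hadamardM (i : Fin r) (j₁ j₂ : Fin qM) (h : j₁ ≠ j₂)

def Gate.op {r qV qM : ℕ} {d : Fin r → ℕ} : Gate r qV qM → Op (Wire r qV qM) d
  | .toffoli u₁ u₂ u₃ _ _ _ => toffoliOp u₁ u₂ u₃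
  | .hadamardV j₁ j₂ _ => qubitOp hadamard (Wire.V j₁) * qubitOp hadamard (Wire.V j₂)
  | .hadamardM i j₁ j₂ _ => qubitOp hadamard (Wire.M i j₁) * qubitOp hadamard (Wire.M i j₂)

/-- The unitary `U_L ⋯ U₂ U₁` of a circuit `U₁, U₂, …, U_L` (the first gate is applied first). -/
def circuitOp {r qV qM L : ℕ} {d : Fin r → ℕ} (g : Fin L → Gate r qV qM) :
    Op (Wire r qV qM) d :=
  (List.ofFn fun k => (g k).op).reverse.prod

/-- A verifier of a three-message proof system with `r` provers on a fixed input: the two circuits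
`V¹, V²` of `L` gates each, on a private register of `qV` qubits and `r` message registers of `qM`
qubits each. -/
structure Verifier (r : ℕ) where
  qV : ℕ
  qM : ℕ
  L : ℕ
  qV_pos : 0 < qV
  L_pos : 0 < L
  V₁ : Fin L → Gate r qV qM
  V₂ : Fin L → Gate r qV qM

namespace Verifier

variable {r : ℕ} (v : Verifier r)

/-- The first qubit of `𝖵`, which is the output qubit. -/
def out : Fin v.qV := ⟨0, v.qV_pos⟩

/-- The provers: private systems of arbitrary dimensions `d i`, a shared unit vector `Ψ` in
`𝓜 ⊗ 𝓟`, and unitaries `Wⁱ` on `𝓜ᵢ ⊗ 𝓟ᵢ`. -/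
structure Provers where
  d : Fin r → ℕ
  Ψ : (Fin r → Fin v.qM → Bool) × ((i : Fin r) → Fin (d i)) → ℂ
  Ψ_unit : ∑ m, ‖Ψ m‖ ^ 2 = 1
  W : (i : Fin r) → Matrix ((Fin v.qM → Bool) × Fin (d i)) ((Fin v.qM → Bool) × Fin (d i)) ℂ
  W_unitary : ∀ i, W i ∈ Matrix.unitaryGroup ((Fin v.qM → Bool) × Fin (d i)) ℂ

variable {v}

/-- The initial vector `|0^{qV}⟩_𝖵 |Ψ⟩_{𝖬,𝖯}`. -/
def Provers.init (P : v.Provers) : Basis (Wire r v.qV v.qM) P.d → ℂ := fun s =>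
  if ∀ j, s.1 (.V j) = false then P.Ψ (fun i j => s.1 (.M i j), s.2) else 0

/-- The operator `1_𝖵 ⊗ W¹ ⊗ ⋯ ⊗ Wʳ`. -/
def Provers.op (P : v.Provers) : Op (Wire r v.qV v.qM) P.d := fun s s' =>
  if ∀ j, s.1 (.V j) = s'.1 (.V j)
  then ∏ i, P.W i (fun j => s.1 (.M i j), s.2 i) (fun j => s'.1 (.M i j), s'.2 i)
  else 0

/-- The acceptance probability `‖Π_acc V² W V¹ |0^{qV}⟩|Ψ⟩‖²`. -/
def Provers.acceptProb (P : v.Provers) : ℝ :=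
  ∑ s with s.1 (.V v.out) = true,
    ‖((circuitOp v.V₂ * P.op * circuitOp v.V₁).mulVec P.init) s‖ ^ 2

variable (v)

/-- The maximum acceptance probability. -/
def MAP : ℝ := sSup (Set.range fun P : v.Provers => P.acceptProb)

end Verifier

/-! ### Uniform families of verifiers -/

def Wire.code {r qV qM : ℕ} : Wire r qV qM → List ℕ
  | .V j => [0, j]
  | .M i j => [1, i, j]

def Gate.code {r qV qM : ℕ} : Gate r qV qM → List ℕ
  | .toffoli u₁ u₂ u₃ _ _ _ => 0 :: (u₁.code ++ u₂.code ++ u₃.code)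
  | .hadamardV j₁ j₂ _ => [1, j₁, j₂]
  | .hadamardM i j₁ j₂ _ => [2, i, j₁, j₂]

/-- A verifier as a bit string: the sizes and the gates are listed as a sequence of natural numbers,
each of them written in unary. -/
def Verifier.code {r : ℕ} (v : Verifier r) : List Bool :=
  ([v.qV, v.qM, v.L] ++ (List.ofFn fun k => (v.V₁ k).code).flatten ++
    (List.ofFn fun k => (v.V₂ k).code).flatten).flatMap
      fun n => List.replicate n true ++ [false]

/-- A three-message quantum interactive proof system with `r |x|` provers: a verifier for each input
`x`, whose circuits are generated from `x` in polynomial time. -/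
structure ProofSystem (r : ℕ → ℕ) where
  verifier : (x : List Bool) → Verifier (r x.length)
  uniform : Nonempty (Turing.TM2ComputableInPolyTime (id : List Bool → List Bool)
    (id : List Bool → List Bool) fun x => (verifier x).code)

/-- The proof system recognizes the language `A` with completeness `c` and soundness `s`. -/
def ProofSystem.Recognizes {r : ℕ → ℕ} (S : ProofSystem r) (A : Set (List Bool)) (c s : ℕ → ℝ) :
    Prop :=
  ∀ x, (x ∈ A → c x.length ≤ (S.verifier x).MAP) ∧ (x ∉ A → (S.verifier x).MAP ≤ s x.length)

/-- The sizes `qV`, `qM`, `L` of the verifier on input `x` are at most `p |x|`. -/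
def ProofSystem.SizeLE {r : ℕ → ℕ} (S : ProofSystem r) (p : ℕ → ℕ) : Prop :=
  ∀ x, (S.verifier x).qV ≤ p x.length ∧ (S.verifier x).qM ≤ p x.length ∧
    (S.verifier x).L ≤ p x.length

/-! ### The game with honest players -/

/-- The qubits of the clock register `𝖢`, the copies `𝖡ᵢ`, the register `𝖵` and the message
registers `𝖬ᵢ`. -/
inductive Qubit (r T qV qM : ℕ) : Type
  | C (t : Fin T)
  | B (i : Fin r)
  | V (j : Fin qV)
  | M (i : Fin r) (j : Fin qM)
  deriving DecidableEq, Fintype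

/-- The qubits held by the referee. -/
inductive RefereeQubit (T qV : ℕ) : Type
  | C (t : Fin T)
  | V (j : Fin qV)

/-- The qubits held by one player (apart from those of the private system `𝖯ᵢ`). -/
inductive PlayerQubit (qM : ℕ) : Type
  | B
  | M (j : Fin qM)

def RefereeQubit.toQubit {r T qV qM : ℕ} : RefereeQubit T qV → Qubit r T qV qM
  | .C t => .C t
  | .V j => .V j

def PlayerQubit.toQubit {r T qV qM : ℕ} (i : Fin r) : PlayerQubit qM → Qubit r T qV qM
  | .B => .B i
  | .M j => .M i j

inductive Letter : Type
  | X
  | Z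

def Letter.matrix : Letter → Matrix Bool Bool ℂ
  | .X => pauliX
  | .Z => pauliZ

namespace Verifier

variable {r : ℕ} (v : Verifier r)

/-- The number of time steps, which is the number of clock qubits. -/
abbrev T : ℕ := 2 * v.L + 1

abbrev GameQubit : Type := Qubit r v.T v.qV v.qM

/-- A two-outcome measurement in the course of the game. The Pauli operators in `XZ`-form are given
as the list of their factors. All Pauli operators that a player is asked for in one play commute, and
together they are the measurement specification that the player receives. -/
inductive Query : Type
  /-- The referee measures a Pauli operator on his own qubits. -/
  | referee (P : List (Letter × RefereeQubit v.T v.qV))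
  /-- Player `i` is asked to measure a Pauli operator on the qubits of `𝖡ᵢ` and `𝖬ᵢ`. -/
  | player (i : Fin r) (P : List (Letter × PlayerQubit v.qM))
  /-- Player `i` is asked the special question. -/
  | special (i : Fin r)

/-- A strategy: private systems `𝖯ᵢ` of arbitrary dimensions `d i`, a density operator `ρ` on all
registers, and for each player `i` the reflection on `𝓑ᵢ ⊗ 𝓜ᵢ ⊗ 𝓟ᵢ` used for the special
question. -/
structure Strategy where
  d : Fin r → ℕ
  ρ : Op v.GameQubit d
  ρ_posSemidef : ρ.PosSemidef
  ρ_trace : ρ.trace = 1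
  R : (i : Fin r) → Matrix (Bool × (Fin v.qM → Bool) × Fin (d i))
    (Bool × (Fin v.qM → Bool) × Fin (d i)) ℂ
  R_isHermitian : ∀ i, (R i).IsHermitian
  R_mul_self : ∀ i, R i * R i = 1

variable {v}

/-- The operator `A` on `𝓑ᵢ ⊗ 𝓜ᵢ ⊗ 𝓟ᵢ`, tensored with the identity on all other registers. -/
def playerOp {d : Fin r → ℕ} (i : Fin r)
    (A : Matrix (Bool × (Fin v.qM → Bool) × Fin (d i)) (Bool × (Fin v.qM → Bool) × Fin (d i)) ℂ) :
    Op v.GameQubit d := fun s s' =>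
  if (∀ t, s.1 (.C t) = s'.1 (.C t)) ∧ (∀ j, s.1 (.V j) = s'.1 (.V j)) ∧
    (∀ k, k ≠ i → s.1 (.B k) = s'.1 (.B k) ∧ (∀ j, s.1 (.M k j) = s'.1 (.M k j)) ∧
      s.2 k = s'.2 k)
  then A (s.1 (.B i), fun j => s.1 (.M i j), s.2 i) (s'.1 (.B i), fun j => s'.1 (.M i j), s'.2 i)
  else 0

/-- The reflection measured for a query: the players are honest on Pauli queries and use the
reflections of the strategy for the special question. -/
def Strategy.observable (S : v.Strategy) : v.Query → Op v.GameQubit S.d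
  | .referee P => (P.map fun a => qubitOp a.1.matrix a.2.toQubit).prod
  | .player i P => (P.map fun a => qubitOp a.1.matrix (a.2.toQubit i)).prod
  | .special i => playerOp i (S.R i)

/-- The projection `(1 + (-1)^b R) / 2` for outcome `b` of the measurement of a query. -/
def Strategy.proj (S : v.Strategy) (q : v.Query) (b : Bool) : Op v.GameQubit S.d :=
  (1 / 2 : ℂ) • (1 + (if b then -1 else 1 : ℂ) • S.observable q)

variable (v)

/-- The referee's course of action: accept, reject, perform or ask for a measurement and continue
according to the outcome bit, or sample uniformly from a set of `n` elements and continue. -/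
inductive Protocol : Type
  | accept
  | reject
  | measure (q : v.Query) (next : Bool → Protocol)
  | sample (n : ℕ) (next : Fin n → Protocol)

variable {v}

/-- The probability of acceptance, on the (unnormalized) state `σ`. -/
def Protocol.prob (S : v.Strategy) : v.Protocol → Op v.GameQubit S.d → ℝ
  | .accept, σ => σ.trace.re
  | .reject, _ => 0
  | .measure q next, σ => ∑ b, (next b).prob S (S.proj q b * σ * S.proj q b)
  | .sample n next, σ => (∑ k, (next k).prob S σ) / n

open Protocol

/-- Accept if and only if `b` is true. -/
def verdict (b : Bool) : v.Protocol := if b then accept else reject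

/-- Measure `Z` on the `t`-th clock qubit, `1 ≤ t ≤ T`. For `t = 0` the outcome is taken to be `1`
and for `t = T + 1` it is taken to be `0`. -/
def measureZC (t : ℕ) (next : Bool → v.Protocol) : v.Protocol :=
  if t = 0 then next true
  else if h : t - 1 < v.T then measure (.referee [(.Z, .C ⟨t - 1, h⟩)]) next
  else next false

/-- Measure `X` on the `t`-th clock qubit, `1 ≤ t ≤ T` (other values of `t` do not occur). -/
def measureXC (t : ℕ) (next : Bool → v.Protocol) : v.Protocol :=
  if h : t - 1 < v.T then measure (.referee [(.X, .C ⟨t - 1, h⟩)]) next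
  else next false

/-- The holder of the qubit `u` measures `X` or `Z` on it. -/
def wireQuery (a : Letter) : Wire r v.qV v.qM → v.Query
  | .V j => .referee [(a, .V j)]
  | .M i j => .player i [(a, .M j)]

/-- Measure the two operators; reject if both outcome bits differ from the outcome `x` of the
measurement of the clock qubit. -/
def hadamardDecision (x : Bool) (q₁ q₂ : v.Query) : v.Protocol :=
  measure q₁ fun a₁ => measure q₂ fun a₂ => verdict (!(xor x a₁ && xor x a₂))

/-- The Hadamard check at time `t`; `pairQuery a b` is the query for the measurement of
`a_{u₁} b_{u₂}`. -/
def hadamardCheck (t : ℕ) (pairQuery : Letter → Letter → v.Query) : v.Protocol :=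
  measureXC t fun x => sample 2
    ![hadamardDecision x (pairQuery .X .X) (pairQuery .Z .Z),
      hadamardDecision x (pairQuery .X .Z) (pairQuery .Z .X)]

/-- The Toffoli check at time `t`. -/
def toffoliCheck (t : ℕ) (u₁ u₂ u₃ : Wire r v.qV v.qM) : v.Protocol :=
  measureXC t fun x => sample 2
    ![measure (wireQuery .Z u₁) fun a₁ => measure (wireQuery .Z u₂) fun a₂ =>
        measure (wireQuery .X u₃) fun a₃ => verdict (!(if a₁ && a₂ then xor x a₃ else x)),
      accept]

def gateCheck (t : ℕ) : Gate r v.qV v.qM → v.Protocol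
  | .toffoli u₁ u₂ u₃ _ _ _ => toffoliCheck t u₁ u₂ u₃
  | .hadamardV j₁ j₂ _ => hadamardCheck t fun a b => .referee [(a, .V j₁), (b, .V j₂)]
  | .hadamardM i j₁ j₂ _ => hadamardCheck t fun a b => .player i [(a, .M j₁), (b, .M j₂)]

variable (v)

def clockCheck : v.Protocol :=
  sample 2
    ![sample (v.T - 1) fun k =>
        measureZC ((k : ℕ) + 1) fun a => measureZC ((k : ℕ) + 2) fun b => verdict (!(!a && b)),
      sample r fun i =>
        measure (.player i [(.Z, .B)]) fun a => measureZC (v.L + 1) fun b => verdict (a == b)]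

/-- The check at time `t` that the gate `g` has been applied. -/
def stepCheck (t : ℕ) (g : Gate r v.qV v.qM) : v.Protocol :=
  measureZC (t - 1) fun a => measureZC (t + 1) fun b =>
    if a && !b then gateCheck t g else accept

/-- Sampling `t ∈ [T] ∖ {L + 1}` is sampling one of the `L` gates of `V¹` (at the times `1, …, L`)
or one of the `L` gates of `V²` (at the times `L + 2, …, T`). -/
def verifierPropagationCheck : v.Protocol :=
  sample (v.L + v.L) (Fin.append
    (fun k : Fin v.L => v.stepCheck ((k : ℕ) + 1) (v.V₁ k))
    (fun k : Fin v.L => v.stepCheck (v.L + 2 + (k : ℕ)) (v.V₂ k)))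

variable {v}

/-- Ask the special question to the players in the list and add up their answers modulo two. -/
def askSpecial : List (Fin r) → Bool → (Bool → v.Protocol) → v.Protocol
  | [], a, next => next a
  | i :: l, a, next => measure (.special i) fun b => askSpecial l (xor a b) next

variable (v)

def proverPropagationCheck : v.Protocol :=
  measureZC v.L fun a => measureZC (v.L + 2) fun b =>
    if a && !b then
      askSpecial (List.finRange r) false fun c => measureXC (v.L + 1) fun x => verdict (x == c)
    else accept

def initializationCheck : v.Protocol :=
  measureZC 1 fun a =>
    if a then accept
    else sample v.qV fun j => measure (.referee [(.Z, .V j)]) fun b => verdict (!b)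

def outputCheck : v.Protocol :=
  measureZC v.T fun a =>
    if a then measure (.referee [(.Z, .V v.out)]) fun b => verdict b else accept

/-- The multi-player one-round game with honest players. -/
def game : v.Protocol :=
  sample 5 ![v.clockCheck, v.verifierPropagationCheck, v.proverPropagationCheck,
    v.initializationCheck, v.outputCheck]

variable {v}

/-- The probability that the referee accepts the players' strategy. -/
def Strategy.acceptProb (S : v.Strategy) : ℝ := v.game.prob S S.ρ

variable (v)

/-- The supremum of the acceptance probability over all strategies. -/
def gameValue : ℝ := sSup (Set.range fun S : v.Strategy => S.acceptProb)

end Verifier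

end HonestGame

end

/-! Every course of action of the referee has an acceptance effect `E`, and a density operator is a
sum of unnormalized pure states, so everything reduces to the rejection forms ⟨φ, (1 - E)φ⟩ on
vectors φ. These are computed exactly. With H = (X + Z)/√2 a pair of Hadamard gates is half a sum of
four Pauli products, and a Toffoli gate is 1 + (1 - Z₁)(1 - Z₂)(X₃ - 1)/4. Hence the Pauli tests for
a gate U at time t have effect 1 - (1 - X_t ⊗ U)/4 (`effect_gateCheck`), although nobody ever
applies U. The special question yields in the same way the projection (1 + X_{L+1} ⊗ R₁ ⊗ ⋯ ⊗
R_r)/2. A propagation check therefore rejects with probability proportional to ‖φ - (X_t ⊗ U)φ‖²,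
restricted to clocks that read 1, 0 around t.

Soundness. Let φ be rejected with weight ε, and let φ_n be its part at the legal clock value
1ⁿ0^{T-n}. A reflection Rᵢ is itself unitary, so with 𝖡ᵢ absorbed into the private system the
players become provers applying Wⁱ = Rᵢ. The propagation checks bound ‖φ_{n+1} - U_{n+1} φ_n‖ by
some η with η² = O(poly · ε), and the initialization check puts φ₀ within η of a vector χ with 𝖵 in
the zero state. Errors add up under unitaries (`nrm_slice_sub_run_le`), so φ_n is within (n + 1)η of
the actual run from χ. That run is rejected with weight at least (1 - MAP)‖χ‖²
(`one_sub_MAP_mul_le`), whereas the output check makes this weight at most ((T + 2)η)². So χ is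
small, hence all φ_n are small, and the clock check bounds the weight on illegal clocks. Altogether
‖φ‖² ≤ poly · ε (`nrm_sq_le_mul_rej`); summing over the pure parts of the state bounds the rejection
probability from below.

Completeness. The players share the history state Σ_n |1ⁿ0^{T-n}⟩ |bⁿ⋯bⁿ⟩_𝖡 ψ_n, where ψ_n is the
state of the proof system after n steps and bⁿ = 1 iff n > L. The unitary Wⁱ need not be a
reflection, but |1⟩⟨0| ⊗ Wⁱ + |0⟩⟨1| ⊗ (Wⁱ)ᴴ is one; the copy of the clock bit in 𝖡ᵢ selects the
direction. All checks but the output check then accept with certainty, and the output check sees the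
rejection probability of the provers (`rej_game_history`). -/

noncomputable section

namespace HonestGame

open Matrix
open scoped Kronecker

/-! ### Euclidean norms and quadratic forms -/

section Norms

variable {α : Type*} [Fintype α]

/-- The Euclidean norm of a vector. -/
def nrm (f : α → ℂ) : ℝ := ‖(WithLp.toLp 2 f : EuclideanSpace ℂ α)‖

theorem nrm_nonneg (f : α → ℂ) : 0 ≤ nrm f := norm_nonneg _

theorem nrm_sq (f : α → ℂ) : nrm f ^ 2 = ∑ s, ‖f s‖ ^ 2 := by
  simp [nrm, EuclideanSpace.norm_sq_eq]

theorem nrm_add_le (f g : α → ℂ) : nrm (f + g) ≤ nrm f + nrm g := by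
  simpa [nrm] using norm_add_le (WithLp.toLp 2 f : EuclideanSpace ℂ α) (WithLp.toLp 2 g)

theorem nrm_sub_comm (f g : α → ℂ) : nrm (f - g) = nrm (g - f) := by
  simpa [nrm] using norm_sub_rev (WithLp.toLp 2 f : EuclideanSpace ℂ α) (WithLp.toLp 2 g)

theorem nrm_le_nrm {f g : α → ℂ} (h : ∀ s, ‖f s‖ ≤ ‖g s‖) : nrm f ≤ nrm g := by
  refine (sq_le_sq₀ (nrm_nonneg _) (nrm_nonneg _)).1 ?_
  rw [nrm_sq, nrm_sq]
  gcongr with s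
  exact h s

theorem nrm_smul (c : ℂ) (f : α → ℂ) : nrm (c • f) = ‖c‖ * nrm f := by
  simpa [nrm] using norm_smul c (WithLp.toLp 2 f : EuclideanSpace ℂ α)

/-- The real part of `⟨f, M f⟩`. -/
def quad (M : Matrix α α ℂ) (f : α → ℂ) : ℝ := (star f ⬝ᵥ M *ᵥ f).re

/-- This turns rejection forms into squared norms, to which the triangle inequality applies. -/
theorem quad_conjTranspose_mul_self (K : Matrix α α ℂ) (f : α → ℂ) :
    quad (Kᴴ * K) f = nrm (K *ᵥ f) ^ 2 := by
  rw [quad, ← mulVec_mulVec, dotProduct_mulVec, ← star_mulVec, nrm_sq]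
  simp only [dotProduct, Complex.re_sum]
  refine Finset.sum_congr rfl fun s _ => ?_
  rw [Pi.star_apply, Complex.star_def, ← Complex.normSq_eq_conj_mul_self, Complex.ofReal_re,
    Complex.normSq_eq_norm_sq]

theorem quad_one [DecidableEq α] (f : α → ℂ) : quad 1 f = nrm f ^ 2 := by
  simpa using quad_conjTranspose_mul_self (1 : Matrix α α ℂ) f

theorem quad_zero (f : α → ℂ) : quad 0 f = 0 := by simp [quad]

theorem quad_add (M N : Matrix α α ℂ) (f : α → ℂ) : quad (M + N) f = quad M f + quad N f := by
  simp [quad, add_mulVec]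

theorem quad_sub (M N : Matrix α α ℂ) (f : α → ℂ) : quad (M - N) f = quad M f - quad N f := by
  simp [quad, sub_mulVec]

theorem quad_smul (c : ℝ) (M : Matrix α α ℂ) (f : α → ℂ) :
    quad ((c : ℂ) • M) f = c * quad M f := by
  simp [quad, smul_mulVec]

theorem quad_sum {ι : Type*} (t : Finset ι) (M : ι → Matrix α α ℂ) (f : α → ℂ) :
    quad (∑ i ∈ t, M i) f = ∑ i ∈ t, quad (M i) f := by
  classical
  induction t using Finset.induction_on with
  | empty => simp [quad_zero]
  | insert a t ha ih => rw [Finset.sum_insert ha, Finset.sum_insert ha, quad_add, ih]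

theorem quad_diagonal [DecidableEq α] (g : α → ℝ) (f : α → ℂ) :
    quad (diagonal fun s => (g s : ℂ)) f = ∑ s, g s * ‖f s‖ ^ 2 := by
  simp only [quad, dotProduct, mulVec_diagonal, Complex.re_sum]
  refine Finset.sum_congr rfl fun s _ => ?_
  have : star f s * ((g s : ℂ) * f s) = ((g s * ‖f s‖ ^ 2 : ℝ) : ℂ) := by
    rw [mul_left_comm]
    simp [← Complex.normSq_eq_conj_mul_self, Complex.normSq_eq_norm_sq]
  rw [this, Complex.ofReal_re]

theorem nrm_mulVec_of_isometry [DecidableEq α] {U : Matrix α α ℂ} (hU : Uᴴ * U = 1)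
    (f : α → ℂ) : nrm (U *ᵥ f) = nrm f := by
  have h := quad_conjTranspose_mul_self U f
  rw [hU, quad_one] at h
  exact ((sq_eq_sq₀ (nrm_nonneg _) (nrm_nonneg _)).1 h).symm

/-- The quadratic form of `D (1 - G)` for a Hermitian reflection `G` that commutes with a diagonal
projection `D`. -/
theorem quad_diagonal_mul_one_sub [DecidableEq α] (p : α → Prop) [DecidablePred p]
    {G : Matrix α α ℂ} (hG : G.IsHermitian) (hGG : G * G = 1)
    (hc : Commute G (diagonal fun s => if p s then (1 : ℂ) else 0)) (f : α → ℂ) :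
    quad ((diagonal fun s => if p s then (1 : ℂ) else 0) * (1 - G)) f =
      (1 / 2 : ℝ) * ∑ s, if p s then ‖f s - (G *ᵥ f) s‖ ^ 2 else 0 := by
  set D : Matrix α α ℂ := diagonal fun s => if p s then (1 : ℂ) else 0 with hD
  have hDD : D * D = D := by simp [hD]
  have hDH : Dᴴ = D := by
    rw [hD, diagonal_conjTranspose]
    congr 1; ext s; by_cases h : p s <;> simp [h]
  -- Since (1 - G)² = 2(1 - G) and D is a projection commuting with G, the operator K = D(1 - G)
  -- satisfies Kᴴ K = 2K. This is the source of the factor 1/2.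
  have key : D * (1 - G) = ((1 / 2 : ℝ) : ℂ) • ((D * (1 - G))ᴴ * (D * (1 - G))) := by
    have h1 : (D * (1 - G))ᴴ * (D * (1 - G)) = (2 : ℂ) • (D * (1 - G)) := by
      rw [conjTranspose_mul, conjTranspose_sub, hG.eq, hDH, conjTranspose_one]
      have hc' : (1 - G) * D = D * (1 - G) := by rw [sub_mul, mul_sub, hc.eq, one_mul, mul_one]
      calc (1 - G) * D * (D * (1 - G)) = (1 - G) * (D * D) * (1 - G) := by simp only [mul_assoc]
        _ = D * ((1 - G) * (1 - G)) := by rw [hDD, hc', mul_assoc]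
        _ = _ := by
          have : (1 - G) * (1 - G) = (2 : ℂ) • (1 - G) := by
            rw [sub_mul, mul_sub, mul_sub, hGG, two_smul, one_mul, mul_one, one_mul]; abel
          rw [this, mul_smul_comm]
    rw [h1, smul_smul]; norm_num
  rw [key, quad_smul, quad_conjTranspose_mul_self, nrm_sq]
  congr 1
  refine Finset.sum_congr rfl fun s _ => ?_
  rw [← mulVec_mulVec, hD, mulVec_diagonal, sub_mulVec, one_mulVec]
  by_cases h : p s <;> simp [h]

open scoped MatrixOrder Matrix.Norms.L2Operator in
/-- A positive semidefinite matrix is a sum of rank-one ones. -/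
theorem exists_trace_mul_eq_sum_quad {ρ : Matrix α α ℂ} (hρ : ρ.PosSemidef) :
    ∃ b : α → α → ℂ, ∀ M : Matrix α α ℂ, (M * ρ).trace.re = ∑ k, quad M (b k) := by
  classical
  obtain ⟨B, rfl⟩ := CStarAlgebra.nonneg_iff_eq_star_mul_self.mp hρ.nonneg
  -- With ρ = Bᴴ B, cyclicity gives tr(Mρ) = Σ_k (B M Bᴴ)_{kk}, and the k-th term is the form of M
  -- at the conjugated k-th row of B.
  refine ⟨fun k => star (B k), fun M => ?_⟩
  rw [star_eq_conjTranspose, ← mul_assoc, trace_mul_comm, ← mul_assoc, trace, Complex.re_sum]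
  refine Finset.sum_congr rfl fun k _ => ?_
  rw [quad, star_star, diag_apply, mul_assoc, mul_apply']
  rfl

end Norms

/-! ### Operators on single qubits -/

section QubitOps

variable {r : ℕ} {Q : Type} [Fintype Q] [DecidableEq Q] {d : Fin r → ℕ}

/-- The basis element `s` with the bit of the qubit `u` replaced by `b`. -/
def setBit (s : Basis Q d) (u : Q) (b : Bool) : Basis Q d := (Function.update s.1 u b, s.2)

/-- Row s of the operator is supported on the two basis elements that agree with s away from u. -/
theorem sum_qubitOp (A : Matrix Bool Bool ℂ) (u : Q) (s : Basis Q d) (f : Basis Q d → ℂ) :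
    ∑ s', qubitOp A u s s' * f s' = ∑ b, A (s.1 u) b * f (setBit s u b) := by
  symm
  refine Fintype.sum_of_injective (fun b => setBit s u b) ?_ _ _ ?_ ?_
  · intro b b' h
    simpa [setBit] using congrFun (congrArg Prod.fst h) u
  · intro s' hs'
    rw [qubitOp, if_neg, zero_mul]
    rintro ⟨h1, h2⟩
    refine hs' ⟨s'.1 u, Prod.ext ?_ h2⟩
    ext w
    by_cases hw : w = u
    · subst hw; simp [setBit]
    · simp [setBit, hw, h1 w hw]
  · intro b
    rw [qubitOp, if_pos]
    · simp [setBit]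
    · exact ⟨fun w hw => by simp [setBit, hw], rfl⟩

theorem qubitOp_mulVec (A : Matrix Bool Bool ℂ) (u : Q) (f : Basis Q d → ℂ) (s : Basis Q d) :
    (qubitOp A u *ᵥ f) s = ∑ b, A (s.1 u) b * f (setBit s u b) :=
  sum_qubitOp A u s f

theorem qubitOp_mul_apply (A : Matrix Bool Bool ℂ) (u : Q) (N : Op Q d) (s s' : Basis Q d) :
    (qubitOp A u * N : Op Q d) s s' = ∑ b, A (s.1 u) b * N (setBit s u b) s' := by
  rw [mul_apply]; exact sum_qubitOp A u s fun s'' => N s'' s'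

theorem qubitOp_mul_qubitOp (A B : Matrix Bool Bool ℂ) (u : Q) :
    (qubitOp A u * qubitOp B u : Op Q d) = qubitOp (A * B) u := by
  ext s s'
  rw [qubitOp_mul_apply]
  simp only [qubitOp, mul_apply]
  by_cases h : (∀ w, w ≠ u → s.1 w = s'.1 w) ∧ s.2 = s'.2
  · rw [if_pos h]
    refine Finset.sum_congr rfl fun b _ => ?_
    rw [if_pos]
    · simp [setBit]
    · exact ⟨fun w hw => by simp [setBit, hw, h.1 w hw], h.2⟩
  · rw [if_neg h]
    refine Finset.sum_eq_zero fun b _ => ?_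
    rw [if_neg, mul_zero]
    rintro ⟨h1, h2⟩
    refine h ⟨fun w hw => ?_, h2⟩
    have := h1 w hw
    simpa [setBit, hw] using this

theorem qubitOp_one (u : Q) : (qubitOp 1 u : Op Q d) = 1 := by
  ext s s'
  simp only [qubitOp, one_apply]
  by_cases h : s = s'
  · subst h; simp
  · rw [if_neg h]
    split_ifs with h1 h2
    · refine absurd (Prod.ext (funext fun w => ?_) h1.2) h
      by_cases hw : w = u
      · rw [hw, h2]
      · exact h1.1 w hw
    · rfl
    · rfl

theorem qubitOp_add (A B : Matrix Bool Bool ℂ) (u : Q) :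
    (qubitOp (A + B) u : Op Q d) = qubitOp A u + qubitOp B u := by
  ext s s'
  simp only [qubitOp, Matrix.add_apply]
  split_ifs <;> simp

theorem qubitOp_smul (c : ℂ) (A : Matrix Bool Bool ℂ) (u : Q) :
    (qubitOp (c • A) u : Op Q d) = c • qubitOp A u := by
  ext s s'
  simp only [qubitOp, Matrix.smul_apply]
  split_ifs <;> simp

theorem qubitOp_commute (A B : Matrix Bool Bool ℂ) {u w : Q} (h : u ≠ w) :
    Commute (qubitOp A u : Op Q d) (qubitOp B w) := by
  have key : ∀ f : Basis Q d → ℂ, qubitOp A u *ᵥ (qubitOp B w *ᵥ f) =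
      qubitOp B w *ᵥ (qubitOp A u *ᵥ f) := by
    intro f
    ext s
    simp only [qubitOp_mulVec, Finset.mul_sum]
    rw [Finset.sum_comm]
    refine Finset.sum_congr rfl fun b _ => Finset.sum_congr rfl fun b' _ => ?_
    simp only [setBit, Function.update_of_ne h, Function.update_of_ne h.symm]
    rw [Function.update_comm h]
    ring
  refine Matrix.mulVec_injective (funext fun f => ?_)
  simpa using key f

theorem qubitOp_isHermitian {A : Matrix Bool Bool ℂ} (hA : A.IsHermitian) (u : Q) :
    (qubitOp A u : Op Q d).IsHermitian := by
  ext s s'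
  simp only [conjTranspose_apply, qubitOp]
  have h : ((∀ w, w ≠ u → s'.1 w = s.1 w) ∧ s'.2 = s.2) ↔
      ((∀ w, w ≠ u → s.1 w = s'.1 w) ∧ s.2 = s'.2) := by
    simp only [eq_comm]
  simp only [h]
  split_ifs
  · exact hA.apply _ _
  · simp

/-- The sign `(-1)^b`. -/
def sgn (b : Bool) : ℂ := if b then -1 else 1

theorem pauliX_mul_pauliX : pauliX * pauliX = 1 := by
  ext a b; cases a <;> cases b <;> simp [pauliX, mul_apply]

theorem pauliZ_mul_pauliZ : pauliZ * pauliZ = 1 := by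
  ext a b; cases a <;> cases b <;> simp [pauliZ, mul_apply]

theorem pauliZ_mul_pauliX : pauliZ * pauliX = -(pauliX * pauliZ) := by
  ext a b; cases a <;> cases b <;> simp [pauliZ, pauliX, mul_apply]

theorem pauliX_isHermitian : pauliX.IsHermitian := by
  ext a b; cases a <;> cases b <;> simp [pauliX]

/-- Two such factors multiply to a combination of Pauli products with rational coefficients, as
(1/√2)² = 1/2. This is why Hadamard gates come in pairs. -/
theorem hadamard_eq : hadamard = ((Real.sqrt 2 : ℝ) : ℂ)⁻¹ • (pauliX + pauliZ) := by
  ext a b; cases a <;> cases b <;> simp [hadamard, pauliX, pauliZ, div_eq_inv_mul]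

theorem hadamard_isHermitian : hadamard.IsHermitian := by
  ext a b; cases a <;> cases b <;> simp [hadamard]

theorem inv_sqrt_two_mul_self :
    ((Real.sqrt 2 : ℝ) : ℂ)⁻¹ * ((Real.sqrt 2 : ℝ) : ℂ)⁻¹ = 1 / 2 := by
  rw [← mul_inv, ← Complex.ofReal_mul, Real.mul_self_sqrt (by norm_num)]
  norm_num

theorem hadamard_mul_hadamard : hadamard * hadamard = 1 := by
  rw [hadamard_eq, smul_mul_smul_comm, inv_sqrt_two_mul_self, add_mul, mul_add, mul_add,
    pauliX_mul_pauliX, pauliZ_mul_pauliZ, pauliZ_mul_pauliX]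
  module

/-- A pair of Hadamard gates in terms of Pauli operators. -/
theorem qubitOp_hadamard_mul (u₁ u₂ : Q) :
    (qubitOp hadamard u₁ * qubitOp hadamard u₂ : Op Q d) = (1 / 2 : ℂ) •
      (qubitOp pauliX u₁ * qubitOp pauliX u₂ + qubitOp pauliZ u₁ * qubitOp pauliZ u₂ +
        (qubitOp pauliX u₁ * qubitOp pauliZ u₂ + qubitOp pauliZ u₁ * qubitOp pauliX u₂)) := by
  simp only [hadamard_eq, qubitOp_smul, qubitOp_add, smul_mul_smul_comm, inv_sqrt_two_mul_self,
    add_mul, mul_add]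
  module

theorem Letter.matrix_mul_self (a : Letter) : a.matrix * a.matrix = 1 := by
  cases a
  · exact pauliX_mul_pauliX
  · exact pauliZ_mul_pauliZ

theorem qubitOp_pauliZ_eq_diagonal (u : Q) :
    (qubitOp pauliZ u : Op Q d) = diagonal fun s => sgn (s.1 u) := by
  ext s s'
  by_cases h : s = s'
  · subst h; simp [qubitOp, pauliZ, sgn]
  · rw [diagonal_apply_ne _ h, qubitOp]
    split_ifs with h1
    · rw [pauliZ, if_neg]
      intro h2
      refine h (Prod.ext (funext fun w => ?_) h1.2)
      by_cases hw : w = u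
      · rw [hw, h2]
      · exact h1.1 w hw
    · rfl

theorem qubitOp_pauliX_mulVec (u : Q) (f : Basis Q d → ℂ) (s : Basis Q d) :
    (qubitOp pauliX u *ᵥ f) s = f (setBit s u (!s.1 u)) := by
  rw [qubitOp_mulVec, Fintype.sum_bool]
  cases h : s.1 u <;> simp [pauliX]

/-- The action of the Toffoli gate on basis elements. -/
def toffoliMap (u₁ u₂ u₃ : Q) (s : Basis Q d) : Basis Q d :=
  setBit s u₃ (xor (s.1 u₃) (s.1 u₁ && s.1 u₂))

theorem toffoliMap_toffoliMap {u₁ u₂ u₃ : Q} (h₁₃ : u₁ ≠ u₃) (h₂₃ : u₂ ≠ u₃) (s : Basis Q d) :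
    toffoliMap u₁ u₂ u₃ (toffoliMap u₁ u₂ u₃ s) = s := by
  simp [toffoliMap, setBit, h₁₃, h₂₃]

theorem toffoliOp_apply (u₁ u₂ u₃ : Q) (s s' : Basis Q d) :
    toffoliOp u₁ u₂ u₃ s s' = if s = toffoliMap u₁ u₂ u₃ s' then 1 else 0 := by
  rw [toffoliOp]
  exact if_congr (Prod.ext_iff (x := s) (y := toffoliMap u₁ u₂ u₃ s')).symm rfl rfl

theorem eq_toffoliMap_comm {u₁ u₂ u₃ : Q} (h₁₃ : u₁ ≠ u₃) (h₂₃ : u₂ ≠ u₃) {s s' : Basis Q d} :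
    s = toffoliMap u₁ u₂ u₃ s' ↔ s' = toffoliMap u₁ u₂ u₃ s := by
  constructor <;> rintro rfl <;> rw [toffoliMap_toffoliMap h₁₃ h₂₃]

theorem toffoliOp_mulVec {u₁ u₂ u₃ : Q} (h₁₃ : u₁ ≠ u₃) (h₂₃ : u₂ ≠ u₃) (f : Basis Q d → ℂ)
    (s : Basis Q d) : (toffoliOp u₁ u₂ u₃ *ᵥ f) s = f (toffoliMap u₁ u₂ u₃ s) := by
  simp [mulVec, dotProduct, toffoliOp_apply, eq_toffoliMap_comm h₁₃ h₂₃ (s := s)]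

theorem toffoliOp_isHermitian {u₁ u₂ u₃ : Q} (h₁₃ : u₁ ≠ u₃) (h₂₃ : u₂ ≠ u₃) :
    (toffoliOp u₁ u₂ u₃ : Op Q d).IsHermitian := by
  ext s s'
  rw [conjTranspose_apply, toffoliOp_apply, toffoliOp_apply]
  simp only [eq_toffoliMap_comm h₁₃ h₂₃ (s := s)]
  split_ifs <;> simp

theorem toffoliOp_mul_self {u₁ u₂ u₃ : Q} (h₁₃ : u₁ ≠ u₃) (h₂₃ : u₂ ≠ u₃) :
    (toffoliOp u₁ u₂ u₃ * toffoliOp u₁ u₂ u₃ : Op Q d) = 1 := by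
  refine Matrix.mulVec_injective (funext fun f => ?_)
  ext s
  rw [← mulVec_mulVec, one_mulVec, toffoliOp_mulVec h₁₃ h₂₃, toffoliOp_mulVec h₁₃ h₂₃,
    toffoliMap_toffoliMap h₁₃ h₂₃]

/-- The Toffoli gate in terms of Pauli operators. -/
theorem toffoliOp_eq {u₁ u₂ u₃ : Q} (h₁₃ : u₁ ≠ u₃) (h₂₃ : u₂ ≠ u₃) :
    (toffoliOp u₁ u₂ u₃ : Op Q d) = 1 + (1 / 4 : ℂ) •
      ((1 - qubitOp pauliZ u₁) * ((1 - qubitOp pauliZ u₂) * (qubitOp pauliX u₃ - 1))) := by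
  refine Matrix.mulVec_injective (funext fun f => ?_)
  ext s
  have e : ∀ u : Q, (1 - qubitOp pauliZ u : Op Q d) = diagonal fun s => 1 - sgn (s.1 u) := by
    intro u
    rw [qubitOp_pauliZ_eq_diagonal, ← diagonal_one, diagonal_sub]
  rw [toffoliOp_mulVec h₁₃ h₂₃, add_mulVec, smul_mulVec, ← mulVec_mulVec, ← mulVec_mulVec, e, e]
  simp only [Pi.add_apply, Pi.smul_apply, mulVec_diagonal, sub_mulVec, one_mulVec, Pi.sub_apply,
    qubitOp_pauliX_mulVec, toffoliMap]
  have hs : setBit s u₃ (s.1 u₃) = s := by simp [setBit]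
  -- The diagonal factor (1 - sgn)(1 - sgn) is 4 if both controls are 1, and 0 otherwise.
  cases h1 : s.1 u₁ <;> cases h2 : s.1 u₂ <;> simp [sgn, hs]
  ring

end QubitOps

/-! ### Tensor products of finitely many operators -/

section PiMatrix

variable {ι : Type*} [Fintype ι] {β : ι → Type*}

/-- The tensor product of the operators `A i`. -/
def piMatrix (A : ∀ i, Matrix (β i) (β i) ℂ) : Matrix (∀ i, β i) (∀ i, β i) ℂ :=
  fun x y => ∏ i, A i (x i) (y i)

theorem piMatrix_mul [DecidableEq ι] [∀ i, Fintype (β i)] (A B : ∀ i, Matrix (β i) (β i) ℂ) :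
    piMatrix A * piMatrix B = piMatrix fun i => A i * B i := by
  ext x y
  simp only [piMatrix, mul_apply, Finset.prod_univ_sum, Fintype.piFinset_univ,
    Finset.prod_mul_distrib]

theorem piMatrix_one [DecidableEq ι] [∀ i, DecidableEq (β i)] :
    piMatrix (fun i => (1 : Matrix (β i) (β i) ℂ)) = 1 := by
  ext x y
  by_cases h : x = y
  · subst h; simp [piMatrix]
  · rw [one_apply_ne h]
    obtain ⟨i, hi⟩ := Function.ne_iff.1 h
    exact Finset.prod_eq_zero (Finset.mem_univ i) (one_apply_ne hi)

theorem piMatrix_conjTranspose (A : ∀ i, Matrix (β i) (β i) ℂ) :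
    (piMatrix A)ᴴ = piMatrix fun i => (A i)ᴴ := by
  ext x y
  simp [piMatrix]

end PiMatrix

/-! ### Gates on embedded wires -/

section Gates

variable {r qV qM : ℕ} {Q : Type} [Fintype Q] [DecidableEq Q] {d : Fin r → ℕ}

/-- The unitary of a gate whose wires are embedded into a larger set of qubits. -/
def Gate.opOn (e : Wire r qV qM → Q) : Gate r qV qM → Op Q d
  | .toffoli u₁ u₂ u₃ _ _ _ => toffoliOp (e u₁) (e u₂) (e u₃)
  | .hadamardV j₁ j₂ _ => qubitOp hadamard (e (.V j₁)) * qubitOp hadamard (e (.V j₂))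
  | .hadamardM i j₁ j₂ _ => qubitOp hadamard (e (.M i j₁)) * qubitOp hadamard (e (.M i j₂))

theorem Gate.opOn_id (g : Gate r qV qM) : (g.opOn id : Op (Wire r qV qM) d) = g.op := by
  cases g <;> rfl

theorem isHermitian_qubitOp_hadamard_mul {u w : Q} (h : u ≠ w) :
    (qubitOp hadamard u * qubitOp hadamard w : Op Q d).IsHermitian := by
  rw [IsHermitian, conjTranspose_mul, (qubitOp_isHermitian hadamard_isHermitian u).eq,
    (qubitOp_isHermitian hadamard_isHermitian w).eq]
  exact (qubitOp_commute _ _ h).symm.eq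

theorem qubitOp_mul_mul_self {A B : Matrix Bool Bool ℂ} (hA : A * A = 1) (hB : B * B = 1)
    {u w : Q} (h : u ≠ w) :
    (qubitOp A u * qubitOp B w * (qubitOp A u * qubitOp B w) : Op Q d) = 1 := by
  rw [(qubitOp_commute B A h.symm).mul_mul_mul_comm, qubitOp_mul_qubitOp,
    qubitOp_mul_qubitOp, hA, hB, qubitOp_one, qubitOp_one, mul_one]

theorem Gate.opOn_isHermitian {e : Wire r qV qM → Q} (he : e.Injective) (g : Gate r qV qM) :
    (g.opOn e : Op Q d).IsHermitian := by
  cases g with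
  | toffoli u₁ u₂ u₃ h₁₂ h₁₃ h₂₃ => exact toffoliOp_isHermitian (he.ne h₁₃) (he.ne h₂₃)
  | hadamardV j₁ j₂ h => exact isHermitian_qubitOp_hadamard_mul (he.ne (by simpa using h))
  | hadamardM i j₁ j₂ h => exact isHermitian_qubitOp_hadamard_mul (he.ne (by simpa using h))

theorem Gate.opOn_mul_self {e : Wire r qV qM → Q} (he : e.Injective) (g : Gate r qV qM) :
    (g.opOn e * g.opOn e : Op Q d) = 1 := by
  cases g with
  | toffoli u₁ u₂ u₃ h₁₂ h₁₃ h₂₃ => exact toffoliOp_mul_self (he.ne h₁₃) (he.ne h₂₃)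
  | hadamardV j₁ j₂ h =>
    exact qubitOp_mul_mul_self hadamard_mul_hadamard hadamard_mul_hadamard
      (he.ne (by simpa using h))
  | hadamardM i j₁ j₂ h =>
    exact qubitOp_mul_mul_self hadamard_mul_hadamard hadamard_mul_hadamard
      (he.ne (by simpa using h))

theorem Gate.op_isHermitian (g : Gate r qV qM) : (g.op : Op (Wire r qV qM) d).IsHermitian :=
  g.opOn_id ▸ g.opOn_isHermitian Function.injective_id

theorem Gate.op_mul_self (g : Gate r qV qM) : (g.op * g.op : Op (Wire r qV qM) d) = 1 := by
  rw [← g.opOn_id]; exact g.opOn_mul_self Function.injective_id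

theorem Gate.op_isometry (g : Gate r qV qM) : (g.opᴴ * g.op : Op (Wire r qV qM) d) = 1 := by
  rw [g.op_isHermitian.eq, g.op_mul_self]

/-- An operator on a qubit outside of the wires commutes with all gates. -/
theorem Gate.commute_opOn {e : Wire r qV qM → Q} (A : Matrix Bool Bool ℂ) {u : Q}
    (hu : ∀ w, e w ≠ u) (he : e.Injective) (g : Gate r qV qM) :
    Commute (qubitOp A u : Op Q d) (g.opOn e) := by
  have h : ∀ (B : Matrix Bool Bool ℂ) (w), Commute (qubitOp A u : Op Q d) (qubitOp B (e w)) :=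
    fun B w => qubitOp_commute A B (hu w).symm
  cases g with
  | toffoli u₁ u₂ u₃ h₁₂ h₁₃ h₂₃ =>
    rw [Gate.opOn, toffoliOp_eq (he.ne h₁₃) (he.ne h₂₃)]
    exact (Commute.one_right _).add_right (Commute.smul_right
      (((Commute.one_right _).sub_right (h _ _)).mul_right
        (((Commute.one_right _).sub_right (h _ _)).mul_right
          ((h _ _).sub_right (Commute.one_right _)))) _)
  | hadamardV j₁ j₂ _ => exact (h _ _).mul_right (h _ _)
  | hadamardM i j₁ j₂ _ => exact (h _ _).mul_right (h _ _)

/-- A map of basis elements is compatible with an embedding of qubits. -/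
structure Intertwines {Q' : Type} [DecidableEq Q'] {d' : Fin r → ℕ} (e : Q' → Q)
    (J : Basis Q' d' → Basis Q d) : Prop where
  bit : ∀ s u, (J s).1 (e u) = s.1 u
  setBit : ∀ s u b, J (setBit s u b) = HonestGame.setBit (J s) (e u) b

variable {Q' : Type} [Fintype Q'] [DecidableEq Q'] {d' : Fin r → ℕ}

/-- The value at J s involves φ only at J s with the bit e u replaced, and these points are again in
the image of J. Thus restriction along J commutes with operators on embedded qubits. -/
theorem Intertwines.qubitOp_mulVec {e : Q' → Q} {J : Basis Q' d' → Basis Q d}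
    (h : Intertwines e J) (A : Matrix Bool Bool ℂ) (u : Q') (φ : Basis Q d → ℂ) :
    (qubitOp A (e u) *ᵥ φ) ∘ J = qubitOp A u *ᵥ (φ ∘ J) := by
  ext s
  rw [Function.comp_apply, HonestGame.qubitOp_mulVec, HonestGame.qubitOp_mulVec, h.bit]
  simp [h.setBit]

/-- Used along `place` for soundness and along `assemble` for completeness, to transfer gates
between the game and the proof system. -/
theorem Intertwines.gate_mulVec {e : Wire r qV qM → Q} (he : e.Injective)
    {J : Basis (Wire r qV qM) d' → Basis Q d}
    (h : Intertwines e J) (g : Gate r qV qM) (φ : Basis Q d → ℂ) :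
    (g.opOn e *ᵥ φ) ∘ J = g.op *ᵥ (φ ∘ J) := by
  cases g with
  | toffoli u₁ u₂ u₃ h₁₂ h₁₃ h₂₃ =>
    ext s
    rw [Function.comp_apply, Gate.opOn, Gate.op, toffoliOp_mulVec (he.ne h₁₃) (he.ne h₂₃),
      toffoliOp_mulVec h₁₃ h₂₃, Function.comp_apply, toffoliMap, toffoliMap, h.setBit]
    simp only [h.bit]
  | hadamardV j₁ j₂ _ =>
    rw [Gate.opOn, Gate.op, ← mulVec_mulVec, ← mulVec_mulVec, h.qubitOp_mulVec, h.qubitOp_mulVec]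
  | hadamardM i j₁ j₂ _ =>
    rw [Gate.opOn, Gate.op, ← mulVec_mulVec, ← mulVec_mulVec, h.qubitOp_mulVec, h.qubitOp_mulVec]

end Gates

/-- The qubit of the game that corresponds to a wire of the verifier. -/
def Wire.toQubit {r T qV qM : ℕ} : Wire r qV qM → Qubit r T qV qM
  | .V j => .V j
  | .M i j => .M i j

theorem Wire.toQubit_injective {r T qV qM : ℕ} :
    Function.Injective (Wire.toQubit : Wire r qV qM → Qubit r T qV qM) := by
  rintro (_ | _) (_ | _) h <;> simp_all [Wire.toQubit]

theorem Wire.toQubit_ne_C {r T qV qM : ℕ} (t : Fin T) (w : Wire r qV qM) :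
    w.toQubit ≠ Qubit.C t := by
  cases w <;> simp [Wire.toQubit]

/-! ### Operators of the players -/

namespace Verifier

section PlayerOps

variable {r : ℕ} {v : Verifier r} {d : Fin r → ℕ}

/-- The basis elements, with the registers of each player put together. -/
def splitGame (v : Verifier r) (d : Fin r → ℕ) : Basis v.GameQubit d ≃
    ((Fin v.T → Bool) × (Fin v.qV → Bool)) ×
      ((i : Fin r) → Bool × (Fin v.qM → Bool) × Fin (d i)) where
  toFun s := ((fun t => s.1 (.C t), fun j => s.1 (.V j)),
    fun i => (s.1 (.B i), fun j => s.1 (.M i j), s.2 i))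
  invFun z := (fun
    | .C t => z.1.1 t
    | .B i => (z.2 i).1
    | .V j => z.1.2 j
    | .M i j => (z.2 i).2.1 j, fun i => (z.2 i).2.2)
  left_inv s := by
    refine Prod.ext (funext fun u => ?_) rfl
    cases u <;> rfl
  right_inv z := rfl

/-- The tensor product of operators of the players. -/
def playersOp (A : (i : Fin r) → Matrix (Bool × (Fin v.qM → Bool) × Fin (d i))
    (Bool × (Fin v.qM → Bool) × Fin (d i)) ℂ) : Op v.GameQubit d :=
  (1 ⊗ₖ piMatrix A).submatrix (splitGame v d) (splitGame v d)

theorem playersOp_mul (A B : (i : Fin r) → Matrix (Bool × (Fin v.qM → Bool) × Fin (d i))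
    (Bool × (Fin v.qM → Bool) × Fin (d i)) ℂ) :
    playersOp A * playersOp B = playersOp fun i => A i * B i := by
  rw [playersOp, playersOp, submatrix_mul_equiv, ← mul_kronecker_mul, one_mul, piMatrix_mul]
  rfl

theorem playersOp_one : playersOp (fun i => (1 : Matrix (Bool × (Fin v.qM → Bool) × Fin (d i))
    (Bool × (Fin v.qM → Bool) × Fin (d i)) ℂ)) = 1 := by
  rw [playersOp, piMatrix_one]
  ext s s'
  simp only [submatrix_apply, kroneckerMap_apply, one_apply, mul_ite, mul_one, mul_zero, ← ite_and]
  refine if_congr ?_ rfl rfl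
  rw [and_comm, ← Prod.ext_iff, (splitGame v d).injective.eq_iff]

theorem playersOp_conjTranspose (A : (i : Fin r) →
    Matrix (Bool × (Fin v.qM → Bool) × Fin (d i)) (Bool × (Fin v.qM → Bool) × Fin (d i)) ℂ) :
    (playersOp A)ᴴ = playersOp fun i => (A i)ᴴ := by
  rw [playersOp, conjTranspose_submatrix, conjTranspose_kronecker, conjTranspose_one,
    piMatrix_conjTranspose]
  rfl

theorem playersOp_mulVec (A : (i : Fin r) →
    Matrix (Bool × (Fin v.qM → Bool) × Fin (d i)) (Bool × (Fin v.qM → Bool) × Fin (d i)) ℂ)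
    (φ : Basis v.GameQubit d → ℂ) (z) :
    (playersOp A *ᵥ φ) ((splitGame v d).symm z) =
      ∑ y, (∏ i, A i (z.2 i) (y i)) * φ ((splitGame v d).symm (z.1, y)) := by
  rw [mulVec, dotProduct, ← (splitGame v d).symm.sum_comp, Fintype.sum_prod_type,
    Finset.sum_eq_single z.1]
  · simp [playersOp, piMatrix]
  · intro b _ hb
    simp [playersOp, one_apply_ne hb.symm]
  · simp

/-- As a tensor product with a single nontrivial factor, the operator can be multiplied and commuted
factor by factor. -/
theorem playerOp_eq (i : Fin r) (A : Matrix (Bool × (Fin v.qM → Bool) × Fin (d i))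
    (Bool × (Fin v.qM → Bool) × Fin (d i)) ℂ) :
    playerOp i A = playersOp (Function.update (fun _ => 1) i A) := by
  ext s s'
  rw [playerOp, playersOp, submatrix_apply, kroneckerMap_apply, piMatrix, one_apply,
    ← Finset.mul_prod_erase _ _ (Finset.mem_univ i), Function.update_self]
  by_cases hz : (splitGame v d s).1 = (splitGame v d s').1
  · have hz' := Prod.ext_iff.1 hz
    rw [if_pos hz, one_mul]
    by_cases hk : ∀ k, k ≠ i → s.1 (.B k) = s'.1 (.B k) ∧ (∀ j, s.1 (.M k j) = s'.1 (.M k j)) ∧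
      s.2 k = s'.2 k
    · rw [if_pos ⟨fun t => congrFun hz'.1 t, fun j => congrFun hz'.2 j, hk⟩,
        Finset.prod_eq_one, mul_one]
      · rfl
      · intro k hk'
        have hki := Finset.ne_of_mem_erase hk'
        rw [Function.update_of_ne hki, one_apply, if_pos]
        obtain ⟨h1, h2, h3⟩ := hk k hki
        simp [splitGame, h1, h2, h3]
    · rw [if_neg fun h => hk h.2.2]
      push Not at hk
      obtain ⟨k, hki, hk⟩ := hk
      rw [Finset.prod_eq_zero (Finset.mem_erase.2 ⟨hki, Finset.mem_univ k⟩), mul_zero]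
      rw [Function.update_of_ne hki, one_apply, if_neg]
      intro h
      simp only [splitGame, Equiv.coe_fn_mk, Prod.mk.injEq] at h
      exact hk h.1 (fun j => congrFun h.2.1 j) h.2.2
  · rw [if_neg hz, zero_mul, if_neg]
    exact fun h => hz (Prod.ext (funext h.1) (funext h.2.1))

/-- Distinctness is needed because a repeated player would contribute a power of `R i`. -/
theorem prod_playerOp (R : (i : Fin r) → Matrix (Bool × (Fin v.qM → Bool) × Fin (d i))
    (Bool × (Fin v.qM → Bool) × Fin (d i)) ℂ) (l : List (Fin r)) (hl : l.Nodup) :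
    (l.map fun i => playerOp i (R i)).prod = playersOp fun i => if i ∈ l then R i else 1 := by
  induction l with
  | nil => simp [playersOp_one]
  | cons a l ih =>
    rw [List.nodup_cons] at hl
    rw [List.map_cons, List.prod_cons, ih hl.2, playerOp_eq, playersOp_mul]
    congr 1
    ext1 i
    by_cases h : i = a
    · subst h; simp [hl.1]
    · simp [h]

/-- The operator `B` on the clock qubit `t`, as an operator on the registers of the referee. -/
def clockMatrix (v : Verifier r) (B : Matrix Bool Bool ℂ) (t : Fin v.T) :
    Matrix ((Fin v.T → Bool) × (Fin v.qV → Bool)) ((Fin v.T → Bool) × (Fin v.qV → Bool)) ℂ :=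
  fun z z' => if (∀ k, k ≠ t → z.1 k = z'.1 k) ∧ z.2 = z'.2 then B (z.1 t) (z'.1 t) else 0

/-- Along `splitGame` the two operators live on different tensor factors, K ⊗ 1 and 1 ⊗ N. -/
theorem qubitOp_C_commute_playersOp (B : Matrix Bool Bool ℂ) (t : Fin v.T)
    (A : (i : Fin r) → Matrix (Bool × (Fin v.qM → Bool) × Fin (d i))
      (Bool × (Fin v.qM → Bool) × Fin (d i)) ℂ) :
    Commute (qubitOp B (.C t) : Op v.GameQubit d) (playersOp A) := by
  have h : (qubitOp B (.C t) : Op v.GameQubit d) =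
      (clockMatrix v B t ⊗ₖ
        (1 : Matrix ((i : Fin r) → Bool × (Fin v.qM → Bool) × Fin (d i)) _ ℂ)).submatrix
        (splitGame v d) (splitGame v d) := by
    ext s s'
    rw [qubitOp, submatrix_apply, kroneckerMap_apply, clockMatrix, one_apply, mul_ite, mul_one, mul_zero,
      ← ite_and]
    refine if_congr ?_ rfl rfl
    constructor
    · rintro ⟨h1, h2⟩
      refine ⟨?_, fun k hk => h1 _ (by simpa using hk), funext fun j => h1 _ (by simp)⟩
      ext1 i
      simp [splitGame, h1, h2]
    · rintro ⟨h1, h2, h3⟩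
      simp only [splitGame, Equiv.coe_fn_mk] at h1 h2 h3
      have h4 : ∀ i, _ := fun i => Prod.ext_iff.1 (congrFun h1 i)
      refine ⟨?_, funext fun i => (Prod.ext_iff.1 (h4 i).2).2⟩
      rintro (k | i | j | ⟨i, j⟩) hw
      · exact h2 k (by simpa using hw)
      · exact (h4 i).1
      · exact congrFun h3 j
      · exact congrFun (Prod.ext_iff.1 (h4 i).2).1 j
  rw [h, playersOp, Commute, SemiconjBy, submatrix_mul_equiv, submatrix_mul_equiv,
    ← mul_kronecker_mul, ← mul_kronecker_mul, one_mul, one_mul, mul_one, mul_one]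

end PlayerOps

open Protocol

/-! ### Effects of protocols -/

section Effects

variable {r : ℕ} {v : Verifier r} (S : v.Strategy)

/-- The acceptance effect of a protocol. -/
def Strategy.effect : v.Protocol → Op v.GameQubit S.d
  | .accept => 1
  | .reject => 0
  | .measure q next => ∑ b, S.proj q b * Strategy.effect (next b) * S.proj q b
  | .sample n next => ((n : ℝ)⁻¹ : ℂ) • ∑ k, Strategy.effect (next k)

/-- Heisenberg picture: cyclicity of the trace moves the measurement projections from the state to
the effect. -/
theorem prob_eq_trace (p : v.Protocol) (σ : Op v.GameQubit S.d) :
    p.prob S σ = (S.effect p * σ).trace.re := by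
  induction p generalizing σ with
  | accept => simp [Protocol.prob, Strategy.effect]
  | reject => simp [Protocol.prob, Strategy.effect]
  | measure q next ih =>
    simp only [Protocol.prob, Strategy.effect, ih, Finset.sum_mul, trace_sum, Complex.re_sum]
    refine Finset.sum_congr rfl fun b _ => ?_
    rw [← mul_assoc, trace_mul_comm, ← mul_assoc, ← mul_assoc]
  | sample n next ih =>
    simp only [Protocol.prob, Strategy.effect, ih, smul_mul_assoc, Finset.sum_mul, trace_smul,
      trace_sum, smul_eq_mul, ← Complex.ofReal_inv, Complex.re_ofReal_mul, Complex.re_sum]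
    rw [div_eq_inv_mul]

variable {S}

/-- The main computational rule. If the effect after outcome b is α + (-1)^b β with α, β commuting
with the observable O, then with the projections P₀, P₁ of O the total is α(P₀ + P₁) + β(P₀ - P₁) =
α + Oβ. Measuring replaces the sign of the outcome by the observable. -/
theorem effect_measure {q : v.Query} {next : Bool → v.Protocol} {α β : Op v.GameQubit S.d}
    (hq : S.observable q * S.observable q = 1) (hα : Commute (S.observable q) α)
    (hβ : Commute (S.observable q) β) (h : ∀ b, S.effect (next b) = α + sgn b • β) :
    S.effect (measure q next) = α + S.observable q * β := by
  set O := S.observable q with hO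
  have e1 : O * α * O = α := by rw [hα.eq, mul_assoc, hq, mul_one]
  have e2 : O * β * O = β := by rw [hβ.eq, mul_assoc, hq, mul_one]
  simp only [Strategy.effect, Strategy.proj, Fintype.sum_bool, h, ← hO, sgn]
  simp only [if_true, Bool.false_eq_true, if_false, smul_mul_assoc, mul_smul_comm, mul_add, add_mul,
    one_mul, mul_one, e1, e2, smul_add, ← hα.eq, ← hβ.eq]
  module

theorem effect_sample_two (p₀ p₁ : v.Protocol) :
    S.effect (sample 2 ![p₀, p₁]) = (1 / 2 : ℂ) • (S.effect p₀ + S.effect p₁) := by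
  simp [Strategy.effect]

theorem effect_verdict (b : Bool) : S.effect (verdict b) = if b then 1 else 0 := by
  cases b <;> simp [verdict, Strategy.effect]

/-- A Z measurement substitutes the basis bit for the outcome. The shape 1 - diagonal · F is
preserved, so such measurements can be nested around a check with rejection operator F. -/
theorem effect_measure_pauliZ {q : v.Query} {next : Bool → v.Protocol} {u : v.GameQubit}
    (hq : S.observable q = qubitOp pauliZ u) {f : Bool → Basis v.GameQubit S.d → ℂ}
    {F : Op v.GameQubit S.d} (hF : Commute (qubitOp pauliZ u) F)
    (h : ∀ b, S.effect (next b) = 1 - diagonal (f b) * F) :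
    S.effect (measure q next) = 1 - diagonal (fun s => f (s.1 u) s) * F := by
  have hd : ∀ g : Basis v.GameQubit S.d → ℂ,
      Commute (qubitOp pauliZ u : Op v.GameQubit S.d) (diagonal g) := fun g => by
    rw [qubitOp_pauliZ_eq_diagonal]; exact commute_diagonal _ _
  -- α and β are the half-sum and half-difference of the effects of the two branches.
  rw [effect_measure (α := 1 - (1 / 2 : ℂ) • (diagonal (f false + f true) * F))
    (β := (1 / 2 : ℂ) • (diagonal (f true - f false) * F))]
  · rw [hq, qubitOp_pauliZ_eq_diagonal, mul_smul_comm, ← mul_assoc, diagonal_mul_diagonal,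
      sub_add, sub_right_inj, ← smul_sub, ← sub_mul, diagonal_sub, ← smul_mul_assoc, ← diagonal_smul]
    congr 2
    ext s
    cases hb : s.1 u <;> simp [sgn, hb] <;> ring
  · rw [hq, qubitOp_mul_qubitOp, pauliZ_mul_pauliZ, qubitOp_one]
  · rw [hq]
    exact (Commute.one_right _).sub_right (((hd _).mul_right hF).smul_right _)
  · rw [hq]
    exact ((hd _).mul_right hF).smul_right _
  · intro b
    have hadd : ∀ g g' : Basis v.GameQubit S.d → ℂ,
        (diagonal (g + g') : Op v.GameQubit S.d) = diagonal g + diagonal g' := fun g g' =>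
      (diagonal_add _ _).symm
    have hsub : ∀ g g' : Basis v.GameQubit S.d → ℂ,
        (diagonal (g - g') : Op v.GameQubit S.d) = diagonal g - diagonal g' := fun g g' =>
      (diagonal_sub _ _).symm
    rw [h, hadd, hsub]
    cases b <;> simp only [sgn, add_mul, sub_mul, if_true, Bool.false_eq_true, if_false] <;> module

/-- The value of the `t`-th clock qubit, with the conventions of `measureZC`. -/
def clk {d : Fin r → ℕ} (t : ℕ) (s : Basis v.GameQubit d) : Bool :=
  if t = 0 then true else if h : t - 1 < v.T then s.1 (.C ⟨t - 1, h⟩) else false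

theorem effect_measureZC {t : ℕ} {next : Bool → v.Protocol}
    {f : Bool → Basis v.GameQubit S.d → ℂ} {F : Op v.GameQubit S.d}
    (hF : ∀ k : Fin v.T, (k : ℕ) + 1 = t → Commute (qubitOp pauliZ (.C k)) F)
    (h : ∀ b, S.effect (next b) = 1 - diagonal (f b) * F) :
    S.effect (measureZC t next) = 1 - diagonal (fun s => f (clk t s) s) * F := by
  unfold measureZC clk
  split_ifs with h0 h1
  · exact h true
  · refine effect_measure_pauliZ (u := .C ⟨t - 1, h1⟩) ?_ (hF _ ?_) h
    · simp [Strategy.observable, Letter.matrix, RefereeQubit.toQubit]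
    · simp only; omega
  · exact h false

/-- A function of one clock bit is a linear combination of 1 and Z on that qubit; at the boundary
values of t it is a scalar. -/
theorem commute_diagonal_clk {d : Fin r → ℕ} {t : ℕ} {F : Op v.GameQubit d}
    (hF : ∀ k : Fin v.T, (k : ℕ) + 1 = t → Commute (qubitOp pauliZ (.C k)) F) (g : Bool → ℂ) :
    Commute F (diagonal fun s => g (clk t s)) := by
  unfold clk
  split_ifs with h0 h1
  · rw [show (diagonal fun _ => g true : Op v.GameQubit d) = g true • 1 by
      rw [← diagonal_one, ← diagonal_smul]; simp [Pi.smul_def]]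
    exact (Commute.one_right _).smul_right _
  · rw [show (diagonal fun s => g (s.1 (.C ⟨t - 1, h1⟩)) : Op v.GameQubit d) =
      ((g false + g true) / 2) • 1 + ((g false - g true) / 2) • qubitOp pauliZ (.C ⟨t - 1, h1⟩) by
        rw [qubitOp_pauliZ_eq_diagonal, ← diagonal_one, ← diagonal_smul, ← diagonal_smul,
          diagonal_add]
        congr 1; ext s
        cases hb : s.1 (.C ⟨t - 1, h1⟩) <;> simp [sgn, hb] <;> ring]
    exact ((Commute.one_right _).smul_right _).add_right
      ((hF _ (by simp only; omega)).symm.smul_right _)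
  · rw [show (diagonal fun _ => g false : Op v.GameQubit d) = g false • 1 by
      rw [← diagonal_one, ← diagonal_smul]; simp [Pi.smul_def]]
    exact (Commute.one_right _).smul_right _

theorem effect_measureXC {k : Fin v.T} {next : Bool → v.Protocol} {α β : Op v.GameQubit S.d}
    (hα : Commute (qubitOp pauliX (.C k)) α) (hβ : Commute (qubitOp pauliX (.C k)) β)
    (h : ∀ b, S.effect (next b) = α + sgn b • β) :
    S.effect (measureXC ((k : ℕ) + 1) next) = α + qubitOp pauliX (.C k) * β := by
  have hk : (k : ℕ) + 1 - 1 < v.T := by simpa using k.2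
  have hO : S.observable (.referee [(.X, .C ⟨(k : ℕ) + 1 - 1, hk⟩)]) = qubitOp pauliX (.C k) := by
    simp [Strategy.observable, Letter.matrix, RefereeQubit.toQubit]
  rw [measureXC, dif_pos hk, effect_measure (α := α) (β := β), hO]
  · rw [hO, qubitOp_mul_qubitOp, pauliX_mul_pauliX, qubitOp_one]
  · rwa [hO]
  · rwa [hO]
  · exact h

/-! ### The gate checks -/

/-- The indicator of rejection is (1 - sgn x sgn a₁)(1 - sgn x sgn a₂)/4; expanding with (sgn x)² =
1 and replacing signs by observables gives the formula. -/
theorem effect_hadamardDecision (x : Bool) {q₁ q₂ : v.Query}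
    (h₁ : S.observable q₁ * S.observable q₁ = 1) (h₂ : S.observable q₂ * S.observable q₂ = 1)
    (hc : Commute (S.observable q₁) (S.observable q₂)) :
    S.effect (hadamardDecision x q₁ q₂) = 1 - (1 / 4 : ℂ) •
      (1 - sgn x • (S.observable q₁ + S.observable q₂) + S.observable q₁ * S.observable q₂) := by
  rw [hadamardDecision,
    effect_measure (α := 1 - (1 / 4 : ℂ) • (1 - sgn x • S.observable q₂))
      (β := (1 / 4 : ℂ) • (sgn x • (1 : Op v.GameQubit S.d) - S.observable q₂)) h₁]
  · simp only [mul_smul_comm, mul_sub, mul_one]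
    module
  · exact (Commute.one_right _).sub_right
      (((Commute.one_right _).sub_right (hc.smul_right _)).smul_right _)
  · exact (((Commute.one_right _).smul_right _).sub_right hc).smul_right _
  · intro a₁
    rw [effect_measure (α := (1 - (1 / 4 : ℂ) • (1 - (sgn x * sgn a₁) • (1 : Op v.GameQubit S.d))))
        (β := (1 / 4 : ℂ) • ((sgn x - sgn a₁) • (1 : Op v.GameQubit S.d))) h₂]
    · simp only [mul_smul_comm, mul_one]
      module
    · exact (Commute.one_right _).sub_right
        (((Commute.one_right _).sub_right ((Commute.one_right _).smul_right _)).smul_right _)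
    · exact ((Commute.one_right _).smul_right _).smul_right _
    · intro a₂
      rw [effect_verdict]
      cases x <;> cases a₁ <;> cases a₂ <;> simp [sgn] <;> module

/-- The qubit operator of the game that belongs to a gate. -/
abbrev gateOp {d : Fin r → ℕ} (g : Gate r v.qV v.qM) : Op v.GameQubit d := g.opOn Wire.toQubit

/-- The quadratic terms of the two branches are XX · ZZ and XZ · ZX, which are negatives of each
other and cancel in the average over j. The four linear terms add up to twice the pair of Hadamard
gates. -/
theorem effect_hadamardCheck (k : Fin v.T) {u₁ u₂ : Wire r v.qV v.qM} (hu : u₁ ≠ u₂)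
    (pairQuery : Letter → Letter → v.Query)
    (hq : ∀ a b, S.observable (pairQuery a b) =
      qubitOp a.matrix u₁.toQubit * qubitOp b.matrix u₂.toQubit) :
    S.effect (hadamardCheck ((k : ℕ) + 1) pairQuery) = 1 - (1 / 4 : ℂ) •
      (1 - qubitOp pauliX (.C k) *
        (qubitOp hadamard u₁.toQubit * qubitOp hadamard u₂.toQubit)) := by
  have hne : (u₁.toQubit : v.GameQubit) ≠ u₂.toQubit := Wire.toQubit_injective.ne hu
  have hrefl : ∀ a b, S.observable (pairQuery a b) * S.observable (pairQuery a b) = 1 := by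
    intro a b
    rw [hq]
    exact qubitOp_mul_mul_self a.matrix_mul_self b.matrix_mul_self hne
  have hprod : ∀ a b a' b' : Letter,
      S.observable (pairQuery a b) * S.observable (pairQuery a' b') =
        qubitOp (a.matrix * a'.matrix) u₁.toQubit * qubitOp (b.matrix * b'.matrix) u₂.toQubit := by
    intro a b a' b'
    rw [hq, hq, (qubitOp_commute b.matrix a'.matrix hne.symm).mul_mul_mul_comm,
      qubitOp_mul_qubitOp, qubitOp_mul_qubitOp]
  have hneg : ∀ (A : Matrix Bool Bool ℂ) (u : v.GameQubit),
      (qubitOp (-A) u : Op v.GameQubit S.d) = -qubitOp A u := by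
    intro A u
    rw [← neg_one_smul ℂ A, qubitOp_smul, neg_one_smul]
  have hC : ∀ (A : Matrix Bool Bool ℂ) (w : Wire r v.qV v.qM),
      Commute (qubitOp pauliX (.C k) : Op v.GameQubit S.d) (qubitOp A w.toQubit) := fun A w =>
    qubitOp_commute _ _ (w.toQubit_ne_C k).symm
  rw [hadamardCheck, effect_measureXC (α := (3 / 4 : ℂ) • 1)
    (β := (1 / 4 : ℂ) • (qubitOp hadamard u₁.toQubit * qubitOp hadamard u₂.toQubit))]
  · rw [mul_smul_comm]; module
  · exact (Commute.one_right _).smul_right _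
  · exact ((hC _ _).mul_right (hC _ _)).smul_right _
  · intro x
    rw [effect_sample_two, effect_hadamardDecision x (hrefl _ _) (hrefl _ _),
      effect_hadamardDecision x (hrefl _ _) (hrefl _ _), hprod, hprod, qubitOp_hadamard_mul,
      hq, hq, hq, hq]
    · simp only [Letter.matrix, pauliZ_mul_pauliX, hneg, mul_neg]
      module
    · rw [Commute, SemiconjBy, hprod, hprod]
      simp only [Letter.matrix, pauliZ_mul_pauliX, hneg, mul_neg, neg_mul]
    · rw [Commute, SemiconjBy, hprod, hprod]
      simp only [Letter.matrix, pauliZ_mul_pauliX, hneg, mul_neg, neg_mul, neg_neg]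

theorem observable_wireQuery (a : Letter) (u : Wire r v.qV v.qM) :
    S.observable (wireQuery a u) = qubitOp a.matrix u.toQubit := by
  cases u <;> simp [wireQuery, Strategy.observable, RefereeQubit.toQubit, PlayerQubit.toQubit,
    Wire.toQubit]

/-- The branch j = 0 alone has effect (1 + sgn x · U)/2. Averaging with the branch that always
accepts gives the same constant 1/4 as for Hadamard pairs, so all gates can be treated alike. -/
theorem effect_toffoliCheck (k : Fin v.T) {u₁ u₂ u₃ : Wire r v.qV v.qM} (h₁₂ : u₁ ≠ u₂)
    (h₁₃ : u₁ ≠ u₃) (h₂₃ : u₂ ≠ u₃) :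
    S.effect (toffoliCheck ((k : ℕ) + 1) u₁ u₂ u₃) = 1 - (1 / 4 : ℂ) •
      (1 - qubitOp pauliX (.C k) * toffoliOp u₁.toQubit u₂.toQubit u₃.toQubit) := by
  have hinj : Function.Injective (Wire.toQubit : Wire r v.qV v.qM → v.GameQubit) :=
    Wire.toQubit_injective
  have hC : ∀ (A : Matrix Bool Bool ℂ) (w : Wire r v.qV v.qM),
      Commute (qubitOp pauliX (.C k) : Op v.GameQubit S.d) (qubitOp A w.toQubit) := fun A w =>
    qubitOp_commute _ _ (w.toQubit_ne_C k).symm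
  have hrefl : ∀ (a : Letter) (u : Wire r v.qV v.qM),
      S.observable (wireQuery a u) * S.observable (wireQuery a u) = 1 := by
    intro a u
    rw [observable_wireQuery, qubitOp_mul_qubitOp, a.matrix_mul_self, qubitOp_one]
  have hcomm : ∀ (a b : Letter) {u w : Wire r v.qV v.qM}, u ≠ w →
      Commute (S.observable (wireQuery a u)) (S.observable (wireQuery b w)) := by
    intro a b u w h
    rw [observable_wireQuery, observable_wireQuery]
    exact qubitOp_commute _ _ (hinj.ne h)
  have hU : (toffoliOp u₁.toQubit u₂.toQubit u₃.toQubit : Op v.GameQubit S.d) = 1 + (1 / 4 : ℂ) •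
      ((1 - S.observable (wireQuery .Z u₁)) * ((1 - S.observable (wireQuery .Z u₂)) *
        (S.observable (wireQuery .X u₃) - 1))) := by
    simp only [observable_wireQuery, Letter.matrix]
    exact toffoliOp_eq (hinj.ne h₁₃) (hinj.ne h₂₃)
  rw [toffoliCheck, effect_measureXC (α := (3 / 4 : ℂ) • 1)
    (β := (1 / 4 : ℂ) • toffoliOp u₁.toQubit u₂.toQubit u₃.toQubit)]
  · rw [mul_smul_comm]; module
  · exact (Commute.one_right _).smul_right _
  · exact (Gate.commute_opOn _ (Wire.toQubit_ne_C k) hinj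
      (.toffoli u₁ u₂ u₃ h₁₂ h₁₃ h₂₃)).smul_right _
  · intro x
    rw [effect_sample_two, hU]
    set Z₁ := S.observable (wireQuery .Z u₁)
    set Z₂ := S.observable (wireQuery .Z u₂)
    set X₃ := S.observable (wireQuery .X u₃)
    have c12 : Commute Z₁ Z₂ := hcomm _ _ h₁₂
    have c13 : Commute Z₁ X₃ := hcomm _ _ h₁₃
    have c23 : Commute Z₂ X₃ := hcomm _ _ h₂₃
    have o : ∀ Y : Op v.GameQubit S.d, Commute Y 1 := Commute.one_right
    rw [effect_measure
      (α := (1 / 2 : ℂ) • (1 + sgn x • (1 + (1 / 4 : ℂ) • ((1 - Z₂) * (X₃ - 1)))))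
      (β := (1 / 2 : ℂ) • (sgn x • ((-1 / 4 : ℂ) • ((1 - Z₂) * (X₃ - 1))))) (hrefl _ _)]
    · change (1 / 2 : ℂ) • (_ + Z₁ * _ + 1) = _
      simp only [mul_smul_comm, sub_mul (1 : Op v.GameQubit S.d) Z₁, one_mul]
      module
    · exact ((o _).add_right (((o _).add_right ((((o _).sub_right c12).mul_right
        (c13.sub_right (o _))).smul_right _)).smul_right _)).smul_right _
    · exact (((((o _).sub_right c12).mul_right
        (c13.sub_right (o _))).smul_right _).smul_right _).smul_right _
    · intro a₁
      rw [effect_measure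
        (α := (1 / 2 : ℂ) • (1 + sgn x • (1 + ((1 - sgn a₁) / 4) • (X₃ - 1))))
        (β := (1 / 2 : ℂ) • (sgn x • ((-(1 - sgn a₁) / 4) • (X₃ - 1)))) (hrefl _ _)]
      · change _ + Z₂ * _ = _
        simp only [mul_smul_comm, sub_mul (1 : Op v.GameQubit S.d) Z₂, one_mul]
        module
      · exact ((o _).add_right (((o _).add_right
          ((c23.sub_right (o _)).smul_right _)).smul_right _)).smul_right _
      · exact (((c23.sub_right (o _)).smul_right _).smul_right _).smul_right _
      · intro a₂
        -- The product ((1 - sgn a₁)/2)((1 - sgn a₂)/2) is the indicator that both control outcomes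
        -- are 1; if it is 0, the clock outcome alone decides.
        rw [effect_measure
          (α := (1 / 2 : ℂ) • (1 + sgn x • (1 - ((1 - sgn a₁) / 2 * ((1 - sgn a₂) / 2)) •
            (1 : Op v.GameQubit S.d))))
          (β := ((1 / 2) * sgn x * ((1 - sgn a₁) / 2 * ((1 - sgn a₂) / 2))) • 1) (hrefl _ _)]
        · change _ + X₃ * _ = _
          simp only [mul_smul_comm, mul_one]
          module
        · exact ((o _).add_right (((o _).sub_right ((o _).smul_right _)).smul_right _)).smul_right _
        · exact (o _).smul_right _
        · intro a₃
          rw [effect_verdict]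
          cases x <;> cases a₁ <;> cases a₂ <;> cases a₃ <;>
            simp only [sgn, Bool.and_true, Bool.and_false, Bool.and_self, Bool.false_eq_true, if_true,
              if_false, Bool.xor_true, Bool.xor_false, Bool.not_true, Bool.not_false] <;> module

theorem effect_gateCheck (k : Fin v.T) (g : Gate r v.qV v.qM) :
    S.effect (gateCheck ((k : ℕ) + 1) g) =
      1 - (1 / 4 : ℂ) • (1 - qubitOp pauliX (.C k) * gateOp g) := by
  cases g with
  | toffoli u₁ u₂ u₃ h₁₂ h₁₃ h₂₃ => exact effect_toffoliCheck k h₁₂ h₁₃ h₂₃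
  | hadamardV j₁ j₂ h =>
    rw [gateCheck, gateOp, Gate.opOn]
    exact effect_hadamardCheck k (u₁ := .V j₁) (u₂ := .V j₂) (by simpa using h) _ fun a b => by
      simp [Strategy.observable, RefereeQubit.toQubit, Wire.toQubit]
  | hadamardM i j₁ j₂ h =>
    rw [gateCheck, gateOp, Gate.opOn]
    exact effect_hadamardCheck k (u₁ := .M i j₁) (u₂ := .M i j₂) (by simpa using h) _ fun a b => by
      simp [Strategy.observable, PlayerQubit.toQubit, Wire.toQubit]

end Effects

/-! ### Rejection probabilities -/

section Rejection

variable {r : ℕ} {v : Verifier r} (S : v.Strategy)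

/-- The rejection probability of a protocol on the (unnormalized) pure state `φ`. -/
def Strategy.rej (p : v.Protocol) (φ : Basis v.GameQubit S.d → ℂ) : ℝ := quad (1 - S.effect p) φ

variable {S}

/-- For n = 0 the effect is 0, so the rejection form would be ‖φ‖² instead of the empty average. -/
theorem rej_sample {n : ℕ} (hn : 0 < n) (next : Fin n → v.Protocol)
    (φ : Basis v.GameQubit S.d → ℂ) :
    S.rej (sample n next) φ = (∑ k, S.rej (next k) φ) / n := by
  have hn' : (n : ℝ) ≠ 0 := by positivity
  simp only [Strategy.rej, quad_sub, Strategy.effect, ← Complex.ofReal_inv, quad_smul, quad_sum,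
    Finset.sum_sub_distrib, Finset.sum_const, Finset.card_univ, Fintype.card_fin, nsmul_eq_mul]
  field_simp

theorem rej_sample_two (p₀ p₁ : v.Protocol) (φ : Basis v.GameQubit S.d → ℂ) :
    S.rej (sample 2 ![p₀, p₁]) φ = (S.rej p₀ φ + S.rej p₁ φ) / 2 := by
  rw [rej_sample two_pos]; simp [Fin.sum_univ_two]

theorem rej_of_effect_eq {p : v.Protocol} {g : Basis v.GameQubit S.d → Bool}
    (h : S.effect p = 1 - diagonal (fun s => if g s then (1 : ℂ) else 0) * 1)
    (φ : Basis v.GameQubit S.d → ℂ) :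
    S.rej p φ = ∑ s, if g s then ‖φ s‖ ^ 2 else 0 := by
  have e : (fun s => if g s then (1 : ℂ) else 0) = fun s => (((if g s then 1 else 0 : ℝ)) : ℂ) := by
    ext s; split_ifs <;> simp
  rw [Strategy.rej, h, mul_one, sub_sub_cancel, e, quad_diagonal]
  simp

theorem effect_verdict_eq (b : Bool) :
    S.effect (verdict b) = 1 - diagonal (fun _ => if !b then (1 : ℂ) else 0) * 1 := by
  cases b <;> simp [effect_verdict]

/-- Two successive measurements of clock qubits. -/
theorem effect_measureZC_measureZC {t t' : ℕ} {next : Bool → Bool → v.Protocol}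
    {f : Bool → Bool → ℂ} {F : Op v.GameQubit S.d}
    (hF : ∀ k : Fin v.T, (k : ℕ) + 1 = t ∨ (k : ℕ) + 1 = t' → Commute (qubitOp pauliZ (.C k)) F)
    (h : ∀ a b, S.effect (next a b) = 1 - f a b • F) :
    S.effect (measureZC t fun a => measureZC t' fun b => next a b) =
      1 - diagonal (fun s => f (clk t s) (clk t' s)) * F := by
  refine effect_measureZC (f := fun a s => f a (clk t' s)) (fun k hk => hF k (.inl hk)) fun a => ?_
  refine effect_measureZC (f := fun b _ => f a b) (fun k hk => hF k (.inr hk)) fun b => ?_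
  rw [h, show (diagonal fun _ => f a b : Op v.GameQubit S.d) = f a b • 1 by
    rw [← diagonal_one, ← diagonal_smul]; simp [Pi.smul_def], smul_mul_assoc, one_mul]

theorem commute_diagonal_clk_clk {d : Fin r → ℕ} {t t' : ℕ} {F : Op v.GameQubit d}
    (hF : ∀ k : Fin v.T, (k : ℕ) + 1 = t ∨ (k : ℕ) + 1 = t' → Commute (qubitOp pauliZ (.C k)) F)
    (g : Bool → Bool → ℂ) :
    Commute F (diagonal fun s => g (clk t s) (clk t' s)) := by
  rw [show (diagonal fun s => g (clk t s) (clk t' s) : Op v.GameQubit d) =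
    (diagonal fun s => if clk t s then 1 else 0) * (diagonal fun s => g true (clk t' s)) +
    (diagonal fun s => if clk t s then 0 else 1) * (diagonal fun s => g false (clk t' s)) by
      rw [diagonal_mul_diagonal, diagonal_mul_diagonal, diagonal_add]
      congr 1; ext s
      cases clk t s <;> simp]
  have h1 := fun g => commute_diagonal_clk (t := t) (F := F) (fun k hk => hF k (.inl hk)) g
  have h2 := fun g => commute_diagonal_clk (t := t') (F := F) (fun k hk => hF k (.inr hk)) g
  exact ((h1 fun b => if b then 1 else 0).mul_right (h2 _)).add_right
    ((h1 fun b => if b then 0 else 1).mul_right (h2 _))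

/-- The rejection probability of a check that `φ` is invariant under a reflection `G` if the clock
qubits `t, t'` are `1, 0`. -/
theorem rej_propagation {t t' : ℕ} {p : v.Protocol} {G : Op v.GameQubit S.d} (c : ℝ)
    (hG : G.IsHermitian) (hGG : G * G = 1)
    (hF : ∀ k : Fin v.T, (k : ℕ) + 1 = t ∨ (k : ℕ) + 1 = t' → Commute (qubitOp pauliZ (.C k)) G)
    (h : S.effect p = 1 - (c : ℂ) • (1 - G)) (φ : Basis v.GameQubit S.d → ℂ) :
    S.rej (measureZC t fun a => measureZC t' fun b => if a && !b then p else accept) φ =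
      c / 2 * ∑ s, if clk t s && !clk t' s then ‖φ s - (G *ᵥ φ) s‖ ^ 2 else 0 := by
  rw [Strategy.rej, effect_measureZC_measureZC (F := (c : ℂ) • (1 - G))
    (f := fun a b => if a && !b then 1 else 0), sub_sub_cancel, mul_smul_comm, quad_smul,
    quad_diagonal_mul_one_sub _ hG hGG, ← mul_assoc, mul_one_div]
  · exact commute_diagonal_clk_clk hF fun a b => if a && !b then 1 else 0
  · exact fun k hk => ((Commute.one_right _).sub_right (hF k hk)).smul_right _
  · intro a b
    cases a <;> cases b <;> simp [h, Strategy.effect]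

/-- The operator `X_t ⊗ U_t` that is checked for the gate `g`. -/
def stepOp {d : Fin r → ℕ} (k : Fin v.T) (g : Gate r v.qV v.qM) : Op v.GameQubit d :=
  qubitOp pauliX (.C k) * gateOp g

theorem isHermitian_mul_of_commute {α : Type*} [Fintype α] {A B : Matrix α α ℂ}
    (hA : A.IsHermitian) (hB : B.IsHermitian) (h : Commute A B) : (A * B).IsHermitian := by
  rw [IsHermitian, conjTranspose_mul, hA.eq, hB.eq, h.eq]

theorem mul_mul_self_of_commute {α : Type*} [Fintype α] [DecidableEq α] {A B : Matrix α α ℂ}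
    (hA : A * A = 1) (hB : B * B = 1) (h : Commute A B) : A * B * (A * B) = 1 := by
  rw [h.symm.mul_mul_mul_comm, hA, hB, one_mul]

theorem qubitOp_pauliX_mul_self {d : Fin r → ℕ} (u : v.GameQubit) :
    (qubitOp pauliX u * qubitOp pauliX u : Op v.GameQubit d) = 1 := by
  rw [qubitOp_mul_qubitOp, pauliX_mul_pauliX, qubitOp_one]

/-- The factor is 1/8 = 1/4 · 1/2: the constant of the gate check times the 1/2 of
`quad_diagonal_mul_one_sub`. Here `k` counts from 0, so the gate acts on the clock qubit of time k +
1, whose neighbours are at times k and k + 2. -/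
theorem rej_stepCheck (k : Fin v.T) (g : Gate r v.qV v.qM) (φ : Basis v.GameQubit S.d → ℂ) :
    S.rej (v.stepCheck ((k : ℕ) + 1) g) φ =
      1 / 8 * ∑ s, if clk (k : ℕ) s && !clk ((k : ℕ) + 2) s
        then ‖φ s - (stepOp k g *ᵥ φ) s‖ ^ 2 else 0 := by
  have hc : ∀ (A : Matrix Bool Bool ℂ) (t : Fin v.T),
      Commute (qubitOp A (.C t) : Op v.GameQubit S.d) (gateOp g) := fun A t =>
    Gate.commute_opOn A (Wire.toQubit_ne_C t) Wire.toQubit_injective g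
  have hH : (stepOp k g : Op v.GameQubit S.d).IsHermitian := by
    rw [stepOp]
    exact isHermitian_mul_of_commute (qubitOp_isHermitian pauliX_isHermitian _)
      (g.opOn_isHermitian Wire.toQubit_injective) (hc _ k)
  have hR : (stepOp k g * stepOp k g : Op v.GameQubit S.d) = 1 := by
    rw [stepOp]
    exact mul_mul_self_of_commute (qubitOp_pauliX_mul_self _)
      (g.opOn_mul_self Wire.toQubit_injective) (hc _ k)
  have hZ : ∀ t : Fin v.T, (t : ℕ) + 1 = k ∨ (t : ℕ) + 1 = (k : ℕ) + 2 →
      Commute (qubitOp pauliZ (.C t)) (stepOp k g : Op v.GameQubit S.d) := by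
    intro t ht
    have htk : (.C t : v.GameQubit) ≠ .C k := by
      intro h
      have h' := Qubit.C.inj h
      subst h'
      omega
    rw [stepOp]
    exact (qubitOp_commute pauliZ pauliX htk).mul_right (hc pauliZ t)
  have hE : S.effect (gateCheck ((k : ℕ) + 1) g) = 1 - ((1 / 4 : ℝ) : ℂ) • (1 - stepOp k g) := by
    rw [effect_gateCheck, stepOp]; norm_num
  have h := rej_propagation (1 / 4) hH hR hZ hE φ
  rw [show (1 : ℝ) / 8 = 1 / 4 / 2 by norm_num, ← h]
  rfl

/-- The clock qubit that belongs to the action of the provers. -/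
def mid (v : Verifier r) : Fin v.T := ⟨v.L, by simp only [T]; omega⟩

/-- The operator `X_{L+1} ⊗ R₁ ⊗ ⋯ ⊗ R_r` of the prover propagation check. -/
def Strategy.proverStepOp (S : v.Strategy) : Op v.GameQubit S.d :=
  qubitOp pauliX (.C v.mid) * playersOp S.R

theorem playerOp_commute (i j : Fin r) : Commute (playerOp i (S.R i)) (playerOp j (S.R j)) := by
  by_cases h : i = j
  · subst h; exact Commute.refl _
  · rw [playerOp_eq, playerOp_eq, Commute, SemiconjBy, playersOp_mul, playersOp_mul]
    congr 1; ext1 k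
    by_cases hi : k = i
    · subst hi; simp [h]
    · simp [hi]

theorem playerOp_mul_self (i : Fin r) : playerOp i (S.R i) * playerOp i (S.R i) = 1 := by
  rw [playerOp_eq, playersOp_mul, ← playersOp_one]
  congr 1; ext1 k
  by_cases hi : k = i
  · subst hi; simp [S.R_mul_self]
  · simp [hi]

/-- The accumulated parity enters only through its sign, so each further answer replaces a sign by
the reflection of that player. -/
theorem effect_askSpecial (l : List (Fin r)) (a : Bool) :
    S.effect (askSpecial l a fun c => measureXC (v.L + 1) fun x => verdict (x == c)) =
      (1 / 2 : ℂ) • (1 + sgn a •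
        ((l.map fun i => playerOp i (S.R i)).prod * qubitOp pauliX (.C v.mid))) := by
  induction l generalizing a with
  | nil =>
    rw [askSpecial]
    refine (effect_measureXC (k := v.mid) (α := (1 / 2 : ℂ) • 1) (β := (1 / 2 * sgn a) • 1)
      ((Commute.one_right _).smul_right _) ((Commute.one_right _).smul_right _) ?_).trans ?_
    · intro b
      rw [effect_verdict]
      cases a <;> cases b <;> simp [sgn] <;> module
    · simp only [List.map_nil, List.prod_nil, mul_smul_comm, mul_one, one_mul]
      module
  | cons i l ih =>
    have hc : Commute (playerOp i (S.R i))
        ((l.map fun i => playerOp i (S.R i)).prod * qubitOp pauliX (.C v.mid)) := by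
      refine (Commute.list_prod_right _ _ fun A hA => ?_).mul_right ?_
      · obtain ⟨j, -, rfl⟩ := List.mem_map.1 hA
        exact playerOp_commute i j
      · rw [playerOp_eq]
        exact (qubitOp_C_commute_playersOp _ _ _).symm
    set P : Op v.GameQubit S.d :=
      (l.map fun i => playerOp i (S.R i)).prod * qubitOp pauliX (.C v.mid) with hP
    have hO : S.observable (.special i) = playerOp i (S.R i) := rfl
    rw [askSpecial, effect_measure (α := (1 / 2 : ℂ) • 1) (β := (1 / 2 * sgn a) • P)]
    · rw [hO, List.map_cons, List.prod_cons, mul_smul_comm, mul_assoc, ← hP]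
      module
    · rw [hO, playerOp_mul_self]
    · exact (Commute.one_right _).smul_right _
    · rw [hO]
      exact hc.smul_right _
    · intro b
      rw [ih]
      cases a <;> cases b <;> simp [sgn]

theorem rej_proverPropagationCheck (φ : Basis v.GameQubit S.d → ℂ) :
    S.rej v.proverPropagationCheck φ =
      1 / 4 * ∑ s, if clk v.L s && !clk (v.L + 2) s
        then ‖φ s - (S.proverStepOp *ᵥ φ) s‖ ^ 2 else 0 := by
  have hc : ∀ (A : Matrix Bool Bool ℂ) (t : Fin v.T),
      Commute (qubitOp A (.C t) : Op v.GameQubit S.d) (playersOp S.R) := fun A t =>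
    qubitOp_C_commute_playersOp A t _
  rw [proverPropagationCheck, rej_propagation (1 / 2) (G := S.proverStepOp)]
  · norm_num
  · refine isHermitian_mul_of_commute (qubitOp_isHermitian pauliX_isHermitian _) ?_ (hc _ _)
    rw [IsHermitian, playersOp_conjTranspose]
    congr 1; ext1 i; exact S.R_isHermitian i
  · refine mul_mul_self_of_commute (qubitOp_pauliX_mul_self _) ?_ (hc _ _)
    rw [playersOp_mul, ← playersOp_one]
    congr 1; ext1 i; exact S.R_mul_self i
  · intro t ht
    refine (qubitOp_commute _ _ fun h => ?_).mul_right (hc _ t)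
    have h' : (t : ℕ) = v.L := congrArg Fin.val (Qubit.C.inj h)
    omega
  · rw [effect_askSpecial, prod_playerOp _ _ (List.nodup_finRange r), Strategy.proverStepOp,
      (hc _ _).eq]
    simp only [List.mem_finRange, if_true, sgn, Bool.false_eq_true, if_false]
    push_cast
    module

theorem rej_clockCheck (hr : 0 < r) (φ : Basis v.GameQubit S.d → ℂ) :
    S.rej v.clockCheck φ =
      ((∑ k : Fin (v.T - 1), ∑ s, if !clk ((k : ℕ) + 1) s && clk ((k : ℕ) + 2) s
          then ‖φ s‖ ^ 2 else 0) / (v.T - 1 : ℕ) +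
        (∑ i : Fin r, ∑ s, if !(s.1 (.B i) == clk (v.L + 1) s) then ‖φ s‖ ^ 2 else 0) / r) / 2 := by
  have hT : 0 < v.T - 1 := by have := v.L_pos; simp only [T]; omega
  rw [clockCheck, rej_sample_two, rej_sample hT, rej_sample hr]
  congr 4
  · ext1 k
    refine rej_of_effect_eq (g := fun s => !clk ((k : ℕ) + 1) s && clk ((k : ℕ) + 2) s) ?_ φ
    refine effect_measureZC_measureZC (f := fun a b => if !a && b then 1 else 0)
      (fun _ _ => Commute.one_right _) fun a b => ?_
    rw [effect_verdict]
    cases a <;> cases b <;> simp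
  · ext1 i
    refine rej_of_effect_eq (g := fun s => !(s.1 (.B i) == clk (v.L + 1) s)) ?_ φ
    refine effect_measure_pauliZ (u := .B i)
      (f := fun a s => if !(a == clk (v.L + 1) s) then 1 else 0) ?_ (Commute.one_right _) fun a => ?_
    · simp [Strategy.observable, Letter.matrix, PlayerQubit.toQubit]
    · exact effect_measureZC (f := fun b _ => if !(a == b) then 1 else 0)
        (fun _ _ => Commute.one_right _) fun b => effect_verdict_eq _

theorem observable_pauliZ_V (j : Fin v.qV) :
    S.observable (.referee [(.Z, .V j)]) = qubitOp pauliZ (.V j) := by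
  simp [Strategy.observable, Letter.matrix, RefereeQubit.toQubit]

theorem rej_initializationCheck (φ : Basis v.GameQubit S.d → ℂ) :
    S.rej v.initializationCheck φ =
      (∑ j : Fin v.qV, ∑ s, if !clk 1 s && s.1 (.V j) then ‖φ s‖ ^ 2 else 0) / v.qV := by
  have hV : (v.qV : ℂ) ≠ 0 := by exact_mod_cast v.qV_pos.ne'
  have h1 : S.effect v.initializationCheck = 1 - diagonal (fun s => (((v.qV : ℝ)⁻¹ *
      ∑ j : Fin v.qV, if !clk 1 s && s.1 (.V j) then 1 else 0 : ℝ) : ℂ)) * 1 := by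
    refine effect_measureZC (f := fun a s => (((v.qV : ℝ)⁻¹ *
      ∑ j : Fin v.qV, if !a && s.1 (.V j) then 1 else 0 : ℝ) : ℂ))
      (fun _ _ => Commute.one_right _) fun a => ?_
    cases a with
    | true => simp [Strategy.effect]
    | false =>
      have h2 : ∀ j : Fin v.qV, S.effect (measure (.referee [(.Z, .V j)]) fun b => verdict (!b)) =
          1 - diagonal (fun s => if s.1 (.V j) then (1 : ℂ) else 0) * 1 := fun j =>
        effect_measure_pauliZ (u := .V j) (f := fun b _ => if b then 1 else 0)
          (observable_pauliZ_V j) (Commute.one_right _) fun b => by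
            rw [effect_verdict_eq, Bool.not_not]
      rw [if_neg (by simp), Strategy.effect]
      simp only [h2, mul_one, Finset.sum_sub_distrib, Finset.sum_const, Finset.card_univ,
        Fintype.card_fin, smul_sub]
      congr 1
      · rw [← Nat.cast_smul_eq_nsmul ℂ, smul_smul]
        simp [hV]
      · ext s s'
        by_cases h : s = s'
        · subst h
          simp [Matrix.sum_apply]
        · simp [Matrix.sum_apply, h]
  rw [Strategy.rej, h1, mul_one, sub_sub_cancel, quad_diagonal, Finset.sum_comm, Finset.sum_div]
  refine Finset.sum_congr rfl fun s _ => ?_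
  rw [div_eq_inv_mul, mul_assoc, Finset.sum_mul]
  simp

theorem rej_outputCheck (φ : Basis v.GameQubit S.d → ℂ) :
    S.rej v.outputCheck φ = ∑ s, if clk v.T s && !s.1 (.V v.out) then ‖φ s‖ ^ 2 else 0 := by
  refine rej_of_effect_eq (g := fun s => clk v.T s && !s.1 (.V v.out)) ?_ φ
  refine effect_measureZC (f := fun a s => if a && !s.1 (.V v.out) then 1 else 0)
    (fun _ _ => Commute.one_right _) fun a => ?_
  cases a with
  | true =>
    rw [if_pos rfl]
    simp only [Bool.true_and]
    exact effect_measure_pauliZ (u := .V v.out) (f := fun b _ => if !b then 1 else 0)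
      (observable_pauliZ_V _) (Commute.one_right _) fun b => effect_verdict_eq _
  | false => simp [Strategy.effect]

/-- The clock qubit of the `k`-th gate of `V¹`. -/
def fstTime (k : Fin v.L) : Fin v.T := ⟨k, by have := k.2; simp only [T]; omega⟩

/-- The clock qubit of the `k`-th gate of `V²`. -/
def sndTime (k : Fin v.L) : Fin v.T := ⟨v.L + 1 + k, by have := k.2; simp only [T]; omega⟩

theorem rej_verifierPropagationCheck (φ : Basis v.GameQubit S.d → ℂ) :
    S.rej v.verifierPropagationCheck φ =
      (∑ k, S.rej (v.stepCheck ((fstTime k : ℕ) + 1) (v.V₁ k)) φ +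
        ∑ k, S.rej (v.stepCheck ((sndTime k : ℕ) + 1) (v.V₂ k)) φ) / (2 * v.L) := by
  rw [verifierPropagationCheck, rej_sample (by have := v.L_pos; omega), Fin.sum_univ_add]
  simp only [Fin.append_left, Fin.append_right]
  push_cast
  rw [two_mul]
  congr 3
  ext1 k
  congr 2
  simp only [sndTime]; omega

theorem rej_game (φ : Basis v.GameQubit S.d → ℂ) :
    S.rej v.game φ = (S.rej v.clockCheck φ + S.rej v.verifierPropagationCheck φ +
      S.rej v.proverPropagationCheck φ + S.rej v.initializationCheck φ +
      S.rej v.outputCheck φ) / 5 := by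
  rw [game, rej_sample (by norm_num)]
  simp [Fin.sum_univ_succ]
  ring

/-- A bound ‖φ‖² ≤ C · rej(φ) for all vectors becomes 1 ≤ C · (1 - acceptance probability) after
summation over k. -/
theorem exists_acceptProb_eq (S : v.Strategy) :
    ∃ b : Basis v.GameQubit S.d → Basis v.GameQubit S.d → ℂ,
      ∑ k, nrm (b k) ^ 2 = 1 ∧ S.acceptProb = 1 - ∑ k, S.rej v.game (b k) := by
  obtain ⟨b, hb⟩ := exists_trace_mul_eq_sum_quad S.ρ_posSemidef
  have h1 : ∑ k, nrm (b k) ^ 2 = 1 := by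
    have := hb 1
    rw [one_mul, S.ρ_trace] at this
    simpa [quad_one] using this.symm
  refine ⟨b, h1, ?_⟩
  rw [Strategy.acceptProb, prob_eq_trace, hb]
  simp only [Strategy.rej, quad_sub, Finset.sum_sub_distrib, quad_one, h1]
  ring

theorem acceptProb_eq_of_pure {S : v.Strategy} {φ : Basis v.GameQubit S.d → ℂ} {c : ℝ}
    (h : S.ρ = (c : ℂ) • vecMulVec φ (star φ)) :
    S.acceptProb = 1 - c * S.rej v.game φ := by
  have e : ∀ M : Op v.GameQubit S.d, (M * S.ρ).trace.re = c * quad M φ := by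
    intro M
    rw [h, mul_smul_comm, trace_smul, smul_eq_mul, Complex.re_ofReal_mul, mul_vecMulVec,
      trace_vecMulVec, dotProduct_comm]
    rfl
  have h1 : c * nrm φ ^ 2 = 1 := by
    have := e 1
    rw [one_mul, S.ρ_trace, quad_one] at this
    simpa using this.symm
  rw [Strategy.acceptProb, prob_eq_trace, e, Strategy.rej, quad_sub, quad_one, mul_sub, h1]
  ring

end Rejection

/-! ### Runs of the proof system -/

section Runs

variable {r : ℕ} {v : Verifier r} {d : Fin r → ℕ}

/-- The basis elements of the proof system, with the registers of each prover put together. -/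
def splitWire (v : Verifier r) (d : Fin r → ℕ) : Basis (Wire r v.qV v.qM) d ≃
    (Fin v.qV → Bool) × ((i : Fin r) → (Fin v.qM → Bool) × Fin (d i)) where
  toFun s := (fun j => s.1 (.V j), fun i => (fun j => s.1 (.M i j), s.2 i))
  invFun z := (fun
    | .V j => z.1 j
    | .M i j => (z.2 i).1 j, fun i => (z.2 i).2)
  left_inv s := by
    refine Prod.ext (funext fun u => ?_) rfl
    cases u <;> rfl
  right_inv z := rfl

/-- The tensor product of operators of the provers. -/
def proversOp (W : (i : Fin r) →
    Matrix ((Fin v.qM → Bool) × Fin (d i)) ((Fin v.qM → Bool) × Fin (d i)) ℂ) :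
    Op (Wire r v.qV v.qM) d :=
  (1 ⊗ₖ piMatrix W).submatrix (splitWire v d) (splitWire v d)

theorem Provers.op_eq (P : v.Provers) : P.op = proversOp P.W := by
  ext s s'
  rw [Provers.op, proversOp, submatrix_apply, kroneckerMap_apply, one_apply, ite_mul, one_mul,
    zero_mul]
  refine if_congr ?_ rfl rfl
  exact funext_iff.symm

theorem proversOp_mul (A B : (i : Fin r) →
    Matrix ((Fin v.qM → Bool) × Fin (d i)) ((Fin v.qM → Bool) × Fin (d i)) ℂ) :
    proversOp A * proversOp B = proversOp fun i => A i * B i := by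
  rw [proversOp, proversOp, submatrix_mul_equiv, ← mul_kronecker_mul, one_mul, piMatrix_mul]
  rfl

theorem proversOp_one : proversOp (fun i =>
    (1 : Matrix ((Fin v.qM → Bool) × Fin (d i)) ((Fin v.qM → Bool) × Fin (d i)) ℂ)) = 1 := by
  rw [proversOp, piMatrix_one]
  ext s s'
  simp only [submatrix_apply, kroneckerMap_apply, one_apply, mul_ite, mul_one, mul_zero, ← ite_and]
  refine if_congr ?_ rfl rfl
  rw [and_comm, ← Prod.ext_iff, (splitWire v d).injective.eq_iff]

theorem proversOp_conjTranspose (A : (i : Fin r) →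
    Matrix ((Fin v.qM → Bool) × Fin (d i)) ((Fin v.qM → Bool) × Fin (d i)) ℂ) :
    (proversOp A)ᴴ = proversOp fun i => (A i)ᴴ := by
  rw [proversOp, conjTranspose_submatrix, conjTranspose_kronecker, conjTranspose_one,
    piMatrix_conjTranspose]
  rfl

theorem proversOp_isometry {W : (i : Fin r) →
    Matrix ((Fin v.qM → Bool) × Fin (d i)) ((Fin v.qM → Bool) × Fin (d i)) ℂ}
    (hW : ∀ i, (W i)ᴴ * W i = 1) : (proversOp W)ᴴ * proversOp W = 1 := by
  rw [proversOp_conjTranspose, proversOp_mul, ← proversOp_one]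
  congr 1; ext1 i; exact hW i

theorem proversOp_mulVec (A : (i : Fin r) →
    Matrix ((Fin v.qM → Bool) × Fin (d i)) ((Fin v.qM → Bool) × Fin (d i)) ℂ)
    (φ : Basis (Wire r v.qV v.qM) d → ℂ) (z) :
    (proversOp A *ᵥ φ) ((splitWire v d).symm z) =
      ∑ y, (∏ i, A i (z.2 i) (y i)) * φ ((splitWire v d).symm (z.1, y)) := by
  rw [mulVec, dotProduct, ← (splitWire v d).symm.sum_comp, Fintype.sum_prod_type,
    Finset.sum_eq_single z.1]
  · simp [proversOp, piMatrix]
  · intro b _ hb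
    simp [proversOp, one_apply_ne hb.symm]
  · simp

/-- The unitary at the time step from `k` to `k + 1`, where `W` is the action of the provers. -/
def stepUnitary (W : Op (Wire r v.qV v.qM) d) (k : ℕ) : Op (Wire r v.qV v.qM) d :=
  if h : k < v.L then (v.V₁ ⟨k, h⟩).op
  else if k = v.L then W
  else if h : k - (v.L + 1) < v.L then (v.V₂ ⟨k - (v.L + 1), h⟩).op else 1

theorem stepUnitary_fst (W : Op (Wire r v.qV v.qM) d) (k : Fin v.L) :
    stepUnitary W k = (v.V₁ k).op := by
  rw [stepUnitary, dif_pos k.2]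

theorem stepUnitary_mid (W : Op (Wire r v.qV v.qM) d) : stepUnitary W v.L = W := by
  simp [stepUnitary]

theorem stepUnitary_snd (W : Op (Wire r v.qV v.qM) d) (k : Fin v.L) :
    stepUnitary W (v.L + 1 + k) = (v.V₂ k).op := by
  rw [stepUnitary, dif_neg (by omega), if_neg (by omega), dif_pos (by have := k.2; omega)]
  congr 2
  ext
  simp

theorem stepUnitary_isometry {W : Op (Wire r v.qV v.qM) d} (hW : Wᴴ * W = 1) (k : ℕ) :
    (stepUnitary W k)ᴴ * stepUnitary W k = 1 := by
  unfold stepUnitary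
  split_ifs
  · exact Gate.op_isometry _
  · exact hW
  · exact Gate.op_isometry _
  · simp

/-- The state after `k` time steps. -/
def run (W : Op (Wire r v.qV v.qM) d) (χ : Basis (Wire r v.qV v.qM) d → ℂ) :
    ℕ → Basis (Wire r v.qV v.qM) d → ℂ
  | 0 => χ
  | k + 1 => stepUnitary W k *ᵥ run W χ k

theorem nrm_run {W : Op (Wire r v.qV v.qM) d} (hW : Wᴴ * W = 1)
    (χ : Basis (Wire r v.qV v.qM) d → ℂ) (k : ℕ) : nrm (run W χ k) = nrm χ := by
  induction k with
  | zero => rfl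
  | succ k ih => rw [run, nrm_mulVec_of_isometry (stepUnitary_isometry hW k), ih]

/-- Stated for an arbitrary sequence of vectors, so that it covers both circuits; the run is shifted
by L + 1 for the second. -/
theorem circuitOp_mulVec {qV qM L : ℕ} (g : Fin L → Gate r qV qM)
    (x : ℕ → Basis (Wire r qV qM) d → ℂ) (hx : ∀ k : Fin L, x (k + 1) = (g k).op *ᵥ x k) :
    circuitOp g *ᵥ x 0 = x L := by
  induction L with
  | zero => simp [circuitOp]
  | succ L ih =>
    have h : (circuitOp g : Op (Wire r qV qM) d) =
        (g (Fin.last L)).op * circuitOp (fun k => g k.castSucc) := by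
      rw [circuitOp, List.ofFn_succ_last]
      simp [circuitOp]
    rw [h, ← mulVec_mulVec, ih (fun k => g k.castSucc) (fun k => hx k.castSucc)]
    exact (hx (Fin.last L)).symm

theorem run_last (W : Op (Wire r v.qV v.qM) d) (χ : Basis (Wire r v.qV v.qM) d → ℂ) :
    run W χ v.T = (circuitOp v.V₂ * W * circuitOp v.V₁) *ᵥ χ := by
  have h1 : circuitOp v.V₁ *ᵥ χ = run W χ v.L :=
    circuitOp_mulVec v.V₁ (run W χ) fun k => by rw [run, stepUnitary_fst]
  have h2 : circuitOp v.V₂ *ᵥ run W χ (v.L + 1) = run W χ (v.L + 1 + v.L) :=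
    circuitOp_mulVec v.V₂ (fun k => run W χ (v.L + 1 + k)) fun k => by
      rw [← add_assoc, run, stepUnitary_snd]
  rw [← mulVec_mulVec, ← mulVec_mulVec, h1]
  rw [run, stepUnitary_mid] at h2
  rw [h2]
  congr 1
  simp only [T]; omega

theorem nrm_sq_eq_add {α : Type*} [Fintype α] (f : α → ℂ) (g : α → Bool) :
    nrm f ^ 2 = (∑ s with g s = true, ‖f s‖ ^ 2) + ∑ s, if !g s then ‖f s‖ ^ 2 else 0 := by
  rw [nrm_sq, Finset.sum_filter, ← Finset.sum_add_distrib]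
  refine Finset.sum_congr rfl fun s _ => ?_
  cases g s <;> simp

theorem Provers.op_isometry (P : v.Provers) : P.opᴴ * P.op = 1 := by
  rw [P.op_eq]
  exact proversOp_isometry fun i => mem_unitaryGroup_iff'.1 (P.W_unitary i)

/-- The basis element of the proof system with `𝖵` in the all-zero state. -/
def zeroV (m : (Fin r → Fin v.qM → Bool) × ((i : Fin r) → Fin (d i))) :
    Basis (Wire r v.qV v.qM) d :=
  (splitWire v d).symm (fun _ => false, fun i => (m.1 i, m.2 i))

theorem zeroV_eq {w : Basis (Wire r v.qV v.qM) d} (h : ∀ j, w.1 (.V j) = false) :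
    zeroV (fun i j => w.1 (.M i j), w.2) = w :=
  (Equiv.symm_apply_eq _).2 (Prod.ext (funext fun j => (h j).symm) rfl)

theorem sum_zeroV {F : Basis (Wire r v.qV v.qM) d → ℝ}
    (hF : ∀ w, F w ≠ 0 → ∀ j, w.1 (.V j) = false) : ∑ m, F (zeroV m) = ∑ w, F w := by
  refine Fintype.sum_of_injective zeroV ?_ _ _ ?_ fun _ => rfl
  · intro m m' h
    have h' := congrArg Prod.snd ((splitWire v d).symm.injective h)
    refine Prod.ext (funext fun i => ?_) (funext fun i => ?_)
    · exact congrArg Prod.fst (congrFun h' i)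
    · exact congrArg Prod.snd (congrFun h' i)
  · intro s hs
    by_contra h
    exact hs ⟨_, zeroV_eq (hF s h)⟩

theorem Provers.nrm_init (P : v.Provers) : nrm P.init = 1 := by
  refine (sq_eq_sq₀ (nrm_nonneg _) zero_le_one).1 ?_
  rw [nrm_sq, one_pow, ← P.Ψ_unit, ← sum_zeroV]
  · refine Finset.sum_congr rfl fun m _ => ?_
    rw [Provers.init, if_pos]
    · rfl
    · exact fun _ => rfl
  · intro w hw
    by_contra h
    exact hw (by rw [Provers.init, if_neg h]; simp)

theorem Provers.acceptProb_eq (P : v.Provers) :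
    P.acceptProb = 1 - ∑ w, if !w.1 (.V v.out) then ‖run P.op P.init v.T w‖ ^ 2 else 0 := by
  have h := nrm_sq_eq_add (run P.op P.init v.T) fun w => w.1 (.V v.out)
  rw [nrm_run P.op_isometry, P.nrm_init, one_pow] at h
  rw [Provers.acceptProb, ← run_last]
  linarith

theorem Provers.acceptProb_le_one (P : v.Provers) : P.acceptProb ≤ 1 := by
  rw [P.acceptProb_eq, sub_le_self_iff]
  exact Finset.sum_nonneg fun w _ => by split_ifs <;> positivity

theorem Provers.acceptProb_le_MAP (P : v.Provers) : P.acceptProb ≤ v.MAP :=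
  le_csSup ⟨1, by rintro _ ⟨P, rfl⟩; exact P.acceptProb_le_one⟩ ⟨P, rfl⟩

theorem run_smul (W : Op (Wire r v.qV v.qM) d) (c : ℂ) (χ : Basis (Wire r v.qV v.qM) d → ℂ)
    (k : ℕ) : run W (c • χ) k = c • run W χ k := by
  induction k with
  | zero => rfl
  | succ k ih => rw [run, run, ih, mulVec_smul]

/-- Every initial state with `𝖵` in the all-zero state is rejected with probability at least
`1 - MAP`. -/
theorem one_sub_MAP_mul_le {W : (i : Fin r) →
    Matrix ((Fin v.qM → Bool) × Fin (d i)) ((Fin v.qM → Bool) × Fin (d i)) ℂ}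
    (hW : ∀ i, W i ∈ Matrix.unitaryGroup ((Fin v.qM → Bool) × Fin (d i)) ℂ)
    {χ : Basis (Wire r v.qV v.qM) d → ℂ} (hχ : ∀ w, χ w ≠ 0 → ∀ j, w.1 (.V j) = false) :
    (1 - v.MAP) * nrm χ ^ 2 ≤
      ∑ w, if !w.1 (.V v.out) then ‖run (proversOp W) χ v.T w‖ ^ 2 else 0 := by
  -- The zero vector cannot be normalized, but for it the left side is 0.
  rcases eq_or_ne (nrm χ) 0 with h0 | h0
  · rw [h0]
    simp only [ne_eq, OfNat.ofNat_ne_zero, not_false_eq_true, zero_pow, mul_zero]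
    exact Finset.sum_nonneg fun w _ => by split_ifs <;> positivity
  set c : ℂ := (((nrm χ)⁻¹ : ℝ) : ℂ) with hc
  have hcn : ‖c‖ = (nrm χ)⁻¹ := by
    rw [hc, Complex.norm_real, Real.norm_of_nonneg (inv_nonneg.2 (nrm_nonneg _))]
  let Ψ : (Fin r → Fin v.qM → Bool) × ((i : Fin r) → Fin (d i)) → ℂ := fun m =>
    (c • χ) (zeroV m)
  have hχ' : ∀ w, (c • χ) w ≠ 0 → ∀ j, w.1 (.V j) = false := fun w hw =>
    hχ w fun h => hw (by simp [h])
  have hstart : (fun w : Basis (Wire r v.qV v.qM) d =>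
      if ∀ j, w.1 (.V j) = false then Ψ (fun i j => w.1 (.M i j), w.2) else 0) = c • χ := by
    ext w
    split_ifs with h
    · simp only [Ψ, zeroV_eq h]
    · by_contra h'
      exact h (hχ' w (Ne.symm h'))
  have hunit : ∑ m, ‖Ψ m‖ ^ 2 = 1 := by
    rw [sum_zeroV (F := fun w => ‖(c • χ) w‖ ^ 2) fun w hw => hχ' w fun h => hw (by simp [h]),
      ← nrm_sq, nrm_smul, hcn, inv_mul_cancel₀ h0, one_pow]
  -- The normalized χ is a legitimate initial state, so these provers are accepted with probability
  -- at most MAP; undoing the normalization gives the factor ‖χ‖².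
  let P : v.Provers := ⟨d, Ψ, hunit, W, hW⟩
  have hP : P.init = c • χ := hstart
  have h := P.acceptProb_le_MAP
  rw [P.acceptProb_eq, hP, P.op_eq, run_smul] at h
  have e : ∀ w : Basis (Wire r v.qV v.qM) d,
      (if !w.1 (.V v.out) then ‖(c • run (proversOp W) χ v.T) w‖ ^ 2 else 0) = (nrm χ ^ 2)⁻¹ *
        (if !w.1 (.V v.out) then ‖run (proversOp W) χ v.T w‖ ^ 2 else 0) := by
    intro w
    split_ifs
    · rw [Pi.smul_apply, norm_smul, hcn, mul_pow, inv_pow]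
    · rw [mul_zero]
  have h2 : 1 - (nrm χ ^ 2)⁻¹ *
      (∑ w, if !w.1 (.V v.out) then ‖run (proversOp W) χ v.T w‖ ^ 2 else 0) ≤ v.MAP := by
    rw [Finset.mul_sum]
    simp only [← e]
    exact h
  have h3 : 0 < nrm χ ^ 2 := by positivity
  have h4 := mul_le_mul_of_nonneg_right (sub_le_comm.1 h2) h3.le
  rwa [mul_comm (nrm χ ^ 2)⁻¹, mul_assoc, inv_mul_cancel₀ h3.ne', mul_one] at h4

end Runs

/-! ### Unary clock states -/

section Clock

variable {r : ℕ} {v : Verifier r} {d : Fin r → ℕ}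

/-- The clock qubits of `s` show the time `n`. -/
def AtTime (n : ℕ) (s : Basis v.GameQubit d) : Prop :=
  ∀ k : Fin v.T, s.1 (.C k) = decide ((k : ℕ) < n)

instance (n : ℕ) (s : Basis v.GameQubit d) : Decidable (AtTime n s) :=
  inferInstanceAs (Decidable (∀ _, _))

/-- The conventions 1 at t = 0 and 0 beyond T are exactly those that make one formula hold for every
t; beyond T this needs n ≤ T. -/
theorem AtTime.clk_eq {n : ℕ} {s : Basis v.GameQubit d} (h : AtTime n s) (hn : n ≤ v.T) (t : ℕ) :
    clk t s = decide (t ≤ n) := by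
  unfold clk
  split_ifs with h0 h1
  · simp [h0]
  · rw [h]
    simp only [decide_eq_decide]
    omega
  · symm
    simp only [decide_eq_false_iff_not]
    omega

theorem clk_succ (k : Fin v.T) (s : Basis v.GameQubit d) : clk ((k : ℕ) + 1) s = s.1 (.C k) := by
  rw [clk, if_neg (by omega), dif_pos (by simpa using k.2)]
  rfl

theorem AtTime.setBit_succ {k : Fin v.T} {s : Basis v.GameQubit d} (h : AtTime ((k : ℕ) + 1) s) :
    AtTime k (setBit s (.C k) false) := by
  intro l
  by_cases hl : l = k
  · subst hl; simp [setBit]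
  · have h1 : (l : ℕ) ≠ k := fun h => hl (Fin.ext h)
    have hne : (Qubit.C l : v.GameQubit) ≠ .C k := by simpa using hl
    simp only [setBit, Function.update_of_ne hne]
    rw [h]
    simp only [decide_eq_decide]
    omega

theorem AtTime.setBit_self {k : Fin v.T} {s : Basis v.GameQubit d} (h : AtTime (k : ℕ) s) :
    AtTime ((k : ℕ) + 1) (setBit s (.C k) true) := by
  intro l
  by_cases hl : l = k
  · subst hl; simp [setBit]
  · have h1 : (l : ℕ) ≠ k := fun h => hl (Fin.ext h)
    have hne : (Qubit.C l : v.GameQubit) ≠ .C k := by simpa using hl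
    simp only [setBit, Function.update_of_ne hne]
    rw [h]
    simp only [decide_eq_decide]
    omega

/-- A clock register that never shows `0, 1` at two successive qubits shows some time. -/
theorem exists_atTime {s : Basis v.GameQubit d}
    (h : ∀ k : Fin (v.T - 1), ¬ (!clk ((k : ℕ) + 1) s && clk ((k : ℕ) + 2) s) = true) :
    ∃ n ≤ v.T, AtTime n s := by
  -- The time is the position of the first 0. The guard `n < v.T` makes n = T, the all-ones clock,
  -- qualify vacuously.
  have hex : ∃ n, ∀ hn : n < v.T, s.1 (.C ⟨n, hn⟩) = false :=
    ⟨v.T, fun hn => absurd hn (lt_irrefl _)⟩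
  refine ⟨Nat.find hex, Nat.find_le fun hn => absurd hn (lt_irrefl _), fun k => ?_⟩
  by_cases hk : (k : ℕ) < Nat.find hex
  · have := Nat.find_min hex hk
    push Not at this
    obtain ⟨_, h2⟩ := this
    rw [decide_eq_true hk]
    simpa using h2
  -- After the first 0 all bits are 0, since 0 followed by 1 is excluded.
  · have key : ∀ j, Nat.find hex ≤ j → ∀ hj : j < v.T, s.1 (.C ⟨j, hj⟩) = false := by
      intro j hj
      induction j, hj using Nat.le_induction with
      | base => exact Nat.find_spec hex
      | succ j hj ih =>
        intro hj'
        have h1 := h ⟨j, by omega⟩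
        have e1 := clk_succ ⟨j, by omega⟩ s
        have e2 := clk_succ ⟨j + 1, hj'⟩ s
        simp only at h1 e1 e2
        rw [e1, ih (by omega), show j + 2 = j + 1 + 1 from rfl, e2] at h1
        simpa using h1
    rw [key k (not_lt.1 hk) k.2, decide_eq_false hk]

/-- The operator `X_t ⊗ A` compares the times `k + 1` and `k`. -/
theorem qubitOp_pauliX_mul_mulVec (k : Fin v.T) (A : Op v.GameQubit d)
    (φ : Basis v.GameQubit d → ℂ) (s : Basis v.GameQubit d) :
    ((qubitOp pauliX (.C k) * A) *ᵥ φ) s = (A *ᵥ φ) (setBit s (.C k) (!s.1 (.C k))) := by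
  rw [← mulVec_mulVec, qubitOp_pauliX_mulVec]

end Clock

/-! ### Soundness -/

section Soundness

variable {r : ℕ} {v : Verifier r} {d : Fin r → ℕ}

/-- The qubit `𝖡ᵢ` and the private system of a player as one private system of a prover. -/
def privEquiv (n : ℕ) : Fin (2 * n) ≃ Bool × Fin n :=
  finProdFinEquiv.symm.trans (finTwoEquiv.prodCongr (Equiv.refl _))

/-- The registers of a player as the registers of a prover. -/
def regEquiv (m n : ℕ) : (Fin m → Bool) × Fin (2 * n) ≃ Bool × (Fin m → Bool) × Fin n where
  toFun x := ((privEquiv n x.2).1, x.1, (privEquiv n x.2).2)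
  invFun y := (y.2.1, (privEquiv n).symm (y.1, y.2.2))
  left_inv x := by simp
  right_inv y := by simp

/-- The basis elements of the proof system, placed into the game with the clock showing `n`. -/
def place (n : ℕ) (w : Basis (Wire r v.qV v.qM) fun i => 2 * d i) : Basis v.GameQubit d :=
  (splitGame v d).symm ((fun k => decide ((k : ℕ) < n), (splitWire v _ w).1),
    fun i => regEquiv v.qM (d i) ((splitWire v _ w).2 i))

theorem atTime_place (n : ℕ) (w : Basis (Wire r v.qV v.qM) fun i => 2 * d i) :
    AtTime n (place n w : Basis v.GameQubit d) := fun _ => rfl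

theorem place_injective (n : ℕ) : Function.Injective
    (place n : Basis (Wire r v.qV v.qM) (fun i => 2 * d i) → Basis v.GameQubit d) := by
  intro w w' h
  have h1 := Prod.ext_iff.1 ((splitGame v d).symm.injective h)
  refine (splitWire v _).injective (Prod.ext (congrArg Prod.snd h1.1) (funext fun i => ?_))
  exact (regEquiv v.qM (d i)).injective (congrFun h1.2 i)

theorem AtTime.exists_place {n : ℕ} {s : Basis v.GameQubit d} (h : AtTime n s) :
    ∃ w, place n w = s := by
  refine ⟨(splitWire v _).symm ((splitGame v d s).1.2,
    fun i => (regEquiv v.qM (d i)).symm ((splitGame v d s).2 i)), ?_⟩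
  rw [place, Equiv.symm_apply_eq]
  refine Prod.ext (Prod.ext (funext fun k => (h k).symm) ?_) (funext fun i => ?_)
  · simp
  · simp

theorem intertwines_place (n : ℕ) : Intertwines Wire.toQubit
    (place n : Basis (Wire r v.qV v.qM) (fun i => 2 * d i) → Basis v.GameQubit d) where
  bit w u := by cases u <;> rfl
  setBit w u b := by
    refine Prod.ext (funext fun q => ?_) rfl
    cases u <;> cases q <;>
      simp [place, splitGame, splitWire, regEquiv, setBit, Wire.toQubit, Function.update_apply]

/-- Thus X on the clock qubit with index k links the slices at times k + 1 and k. -/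
theorem place_setBit (k : Fin v.T) (w : Basis (Wire r v.qV v.qM) fun i => 2 * d i) :
    setBit (place ((k : ℕ) + 1) w : Basis v.GameQubit d) (.C k)
      (!(place ((k : ℕ) + 1) w : Basis v.GameQubit d).1 (.C k)) = place k w := by
  refine Prod.ext (funext fun q => ?_) rfl
  cases q with
  | C l =>
    have e : (setBit (place ((k : ℕ) + 1) w : Basis v.GameQubit d) (.C k)
        (!(place ((k : ℕ) + 1) w : Basis v.GameQubit d).1 (.C k))) =
        setBit (place ((k : ℕ) + 1) w : Basis v.GameQubit d) (.C k) false := by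
      rw [atTime_place _ w k]; simp
    rw [e, (atTime_place _ w).setBit_succ l, atTime_place _ w l]
  | B i => simp [setBit]; rfl
  | V j => simp [setBit]; rfl
  | M i j => simp [setBit]; rfl

/-- The unitaries of the provers that belong to the reflections of the players. -/
def Strategy.unitary (S : v.Strategy) (i : Fin r) :
    Matrix ((Fin v.qM → Bool) × Fin (2 * S.d i)) ((Fin v.qM → Bool) × Fin (2 * S.d i)) ℂ :=
  (S.R i).submatrix (regEquiv v.qM (S.d i)) (regEquiv v.qM (S.d i))

/-- A Hermitian operator of square 1 is unitary, so it can be played as it stands in the proof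
system. -/
theorem Strategy.unitary_mem (S : v.Strategy) (i : Fin r) :
    S.unitary i ∈ Matrix.unitaryGroup ((Fin v.qM → Bool) × Fin (2 * S.d i)) ℂ := by
  rw [mem_unitaryGroup_iff', star_eq_conjTranspose, unitary, conjTranspose_submatrix,
    (S.R_isHermitian i).eq, submatrix_mul_equiv, S.R_mul_self, submatrix_one_equiv]

theorem playersOp_mulVec_place (S : v.Strategy) (φ : Basis v.GameQubit S.d → ℂ) (n : ℕ) :
    (playersOp S.R *ᵥ φ) ∘ place n = proversOp S.unitary *ᵥ (φ ∘ place n) := by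
  ext w
  obtain ⟨z, rfl⟩ := (splitWire v _).symm.surjective w
  rw [Function.comp_apply, proversOp_mulVec, place, playersOp_mulVec,
    ← (Equiv.piCongrRight fun i => regEquiv v.qM (S.d i)).sum_comp]
  refine Finset.sum_congr rfl fun y _ => ?_
  rfl

/-- The part of `φ` at time `n`. -/
def slice (φ : Basis v.GameQubit d → ℂ) (n : ℕ) : Basis (Wire r v.qV v.qM) (fun i => 2 * d i) → ℂ :=
  φ ∘ place n

theorem sum_place_le {F : Basis v.GameQubit d → ℝ} (hF : ∀ s, 0 ≤ F s) (n : ℕ) :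
    ∑ w, F (place n w) ≤ ∑ s, F s := by
  have h := Finset.sum_map Finset.univ ⟨place n, place_injective n⟩ F
  simp only [Function.Embedding.coeFn_mk] at h
  rw [← h]
  exact Finset.sum_le_sum_of_subset_of_nonneg (Finset.subset_univ _) fun s _ _ => hF s

theorem sum_place_eq (F : Basis v.GameQubit d → ℝ) (n : ℕ) :
    ∑ w, F (place n w) = ∑ s, if AtTime n s then F s else 0 := by
  refine Fintype.sum_of_injective _ (place_injective n) _ _ (fun s hs => ?_) fun w => ?_
  · rw [if_neg]
    intro h
    exact hs (h.exists_place)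
  · rw [if_pos (atTime_place n w)]

/-- At time k + 1 the neighbouring clock bits read 1, 0, and X_k carries the value of Aφ over from
time k. The left side therefore collects some terms of the sum on the right; those at time k and at
illegal clocks are dropped. -/
theorem slice_sub_step (S : v.Strategy) (φ : Basis v.GameQubit S.d → ℂ) (k : Fin v.T)
    {A : Op v.GameQubit S.d} {U : Op (Wire r v.qV v.qM) fun i => 2 * S.d i}
    (hAU : (A *ᵥ φ) ∘ place k = U *ᵥ (φ ∘ place k)) :
    nrm (slice φ ((k : ℕ) + 1) - U *ᵥ slice φ k) ^ 2 ≤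
      ∑ s, if clk (k : ℕ) s && !clk ((k : ℕ) + 2) s
        then ‖φ s - ((qubitOp pauliX (.C k) * A) *ᵥ φ) s‖ ^ 2 else 0 := by
  rw [nrm_sq]
  refine le_trans (le_of_eq ?_)
    (sum_place_le (fun s => by split_ifs <;> positivity) ((k : ℕ) + 1))
  refine Finset.sum_congr rfl fun w _ => ?_
  have hclk := (atTime_place ((k : ℕ) + 1) w : AtTime _ (_ : Basis v.GameQubit S.d)).clk_eq k.2
  rw [if_pos (by simp [hclk]), qubitOp_pauliX_mul_mulVec, place_setBit, Pi.sub_apply]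
  have := congrFun hAU w
  simp only [Function.comp_apply] at this
  rw [this]
  rfl

theorem rej_stepCheck_ge (S : v.Strategy) (φ : Basis v.GameQubit S.d → ℂ) (k : Fin v.T)
    (g : Gate r v.qV v.qM) :
    nrm (slice φ ((k : ℕ) + 1) - g.op *ᵥ slice φ k) ^ 2 ≤
      8 * S.rej (v.stepCheck ((k : ℕ) + 1) g) φ := by
  rw [rej_stepCheck, ← mul_assoc, mul_one_div, div_self (by norm_num), one_mul]
  exact slice_sub_step S φ k ((intertwines_place k).gate_mulVec Wire.toQubit_injective g φ)

theorem rej_stepCheck_nonneg (S : v.Strategy) (φ : Basis v.GameQubit S.d → ℂ) (k : Fin v.T)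
    (g : Gate r v.qV v.qM) : 0 ≤ S.rej (v.stepCheck ((k : ℕ) + 1) g) φ := by
  have := rej_stepCheck_ge S φ k g
  have h := sq_nonneg (nrm (slice φ ((k : ℕ) + 1) - g.op *ᵥ slice φ k))
  linarith

/-- The five rejection probabilities are nonnegative. -/
theorem rej_checks_nonneg (hr : 0 < r) (S : v.Strategy) (φ : Basis v.GameQubit S.d → ℂ) :
    0 ≤ S.rej v.clockCheck φ ∧ 0 ≤ S.rej v.verifierPropagationCheck φ ∧
      0 ≤ S.rej v.proverPropagationCheck φ ∧ 0 ≤ S.rej v.initializationCheck φ ∧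
      0 ≤ S.rej v.outputCheck φ := by
  have hite : ∀ (b : Prop) [Decidable b] (x : ℂ), 0 ≤ if b then ‖x‖ ^ 2 else 0 := by
    intro b _ x; split_ifs <;> positivity
  refine ⟨?_, ?_, ?_, ?_, ?_⟩
  · rw [rej_clockCheck hr]
    have h1 : 0 ≤ ∑ k : Fin (v.T - 1), ∑ s, if !clk ((k : ℕ) + 1) s && clk ((k : ℕ) + 2) s
          then ‖φ s‖ ^ 2 else 0 := Finset.sum_nonneg fun _ _ => Finset.sum_nonneg fun _ _ => hite _ _
    have h2 : 0 ≤ ∑ i : Fin r, ∑ s, if !(s.1 (.B i) == clk (v.L + 1) s) then ‖φ s‖ ^ 2 else 0 :=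
      Finset.sum_nonneg fun _ _ => Finset.sum_nonneg fun _ _ => hite _ _
    positivity
  · rw [rej_verifierPropagationCheck]
    exact div_nonneg (add_nonneg (Finset.sum_nonneg fun _ _ => rej_stepCheck_nonneg _ _ _ _)
      (Finset.sum_nonneg fun _ _ => rej_stepCheck_nonneg _ _ _ _)) (by positivity)
  · rw [rej_proverPropagationCheck]
    exact mul_nonneg (by norm_num) (Finset.sum_nonneg fun _ _ => hite _ _)
  · rw [rej_initializationCheck]
    exact div_nonneg (Finset.sum_nonneg fun _ _ => Finset.sum_nonneg fun _ _ => hite _ _)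
      (by positivity)
  · rw [rej_outputCheck]
    exact Finset.sum_nonneg fun _ _ => hite _ _

theorem rej_game_nonneg (hr : 0 < r) (S : v.Strategy) (φ : Basis v.GameQubit S.d → ℂ) :
    0 ≤ S.rej v.game φ := by
  obtain ⟨h1, h2, h3, h4, h5⟩ := rej_checks_nonneg hr S φ
  have hg := rej_game φ
  linarith

theorem Strategy.acceptProb_le_one (hr : 0 < r) (S : v.Strategy) : S.acceptProb ≤ 1 := by
  obtain ⟨b, -, h⟩ := exists_acceptProb_eq S
  rw [h, sub_le_self_iff]
  exact Finset.sum_nonneg fun k _ => rej_game_nonneg hr S (b k)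

/-- Each time step is propagated correctly up to an error controlled by the rejection
probability. -/
theorem nrm_slice_sub_step_le (hr : 0 < r) (S : v.Strategy) (φ : Basis v.GameQubit S.d → ℂ)
    {k : ℕ} (hk : k < v.T) :
    nrm (slice φ (k + 1) - stepUnitary (proversOp S.unitary) k *ᵥ slice φ k) ^ 2 ≤
      80 * v.L * S.rej v.game φ := by
  obtain ⟨h1, h2, h3, h4, h5⟩ := rej_checks_nonneg hr S φ
  have hg := rej_game φ
  have hL : (1 : ℝ) ≤ v.L := by exact_mod_cast v.L_pos
  have hv : S.rej v.verifierPropagationCheck φ ≤ 5 * S.rej v.game φ := by linarith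
  have hp : S.rej v.proverPropagationCheck φ ≤ 5 * S.rej v.game φ := by linarith
  -- A factor 5 comes from the choice of the check and 2L from the choice of the gate. With the 8 of
  -- `rej_stepCheck_ge` this makes 80L.
  have hvs : ∑ k, S.rej (v.stepCheck ((fstTime k : ℕ) + 1) (v.V₁ k)) φ +
        ∑ k, S.rej (v.stepCheck ((sndTime k : ℕ) + 1) (v.V₂ k)) φ ≤
      10 * v.L * S.rej v.game φ := by
    rw [rej_verifierPropagationCheck, div_le_iff₀ (by positivity)] at hv
    linarith
  have hs1 : 0 ≤ ∑ k, S.rej (v.stepCheck ((fstTime k : ℕ) + 1) (v.V₁ k)) φ :=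
    Finset.sum_nonneg fun _ _ => rej_stepCheck_nonneg _ _ _ _
  have hs2 : 0 ≤ ∑ k, S.rej (v.stepCheck ((sndTime k : ℕ) + 1) (v.V₂ k)) φ :=
    Finset.sum_nonneg fun _ _ => rej_stepCheck_nonneg _ _ _ _
  rcases lt_trichotomy k v.L with hkL | rfl | hkL
  · have e := rej_stepCheck_ge S φ (fstTime ⟨k, hkL⟩) (v.V₁ ⟨k, hkL⟩)
    have hle := Finset.single_le_sum (s := Finset.univ)
      (f := fun k => S.rej (v.stepCheck ((fstTime k : ℕ) + 1) (v.V₁ k)) φ)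
      (fun _ _ => rej_stepCheck_nonneg _ _ _ _) (Finset.mem_univ (⟨k, hkL⟩ : Fin v.L))
    rw [← stepUnitary_fst (proversOp S.unitary)] at e
    simp only [fstTime] at e hle hvs hs1
    linarith
  · have e := slice_sub_step S φ v.mid (playersOp_mulVec_place S φ v.mid)
    rw [rej_proverPropagationCheck] at hp
    rw [stepUnitary_mid]
    have e' : nrm (slice φ (v.L + 1) - proversOp S.unitary *ᵥ slice φ v.L) ^ 2 ≤
        20 * S.rej v.game φ := by
      refine e.trans ?_
      change (∑ s, if clk v.L s && !clk (v.L + 2) s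
        then ‖φ s - (S.proverStepOp *ᵥ φ) s‖ ^ 2 else 0) ≤ _
      linarith
    have h0 := rej_game_nonneg hr S φ
    -- The prover step costs only 4 · 5 = 20, which is at most 80L because L ≥ 1.
    nlinarith
  · obtain ⟨j, rfl⟩ := Nat.exists_eq_add_of_lt hkL
    have hj : j < v.L := by simp only [T] at hk; omega
    have e := rej_stepCheck_ge S φ (sndTime ⟨j, hj⟩) (v.V₂ ⟨j, hj⟩)
    have hle := Finset.single_le_sum (s := Finset.univ)
      (f := fun k => S.rej (v.stepCheck ((sndTime k : ℕ) + 1) (v.V₂ k)) φ)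
      (fun _ _ => rej_stepCheck_nonneg _ _ _ _) (Finset.mem_univ (⟨j, hj⟩ : Fin v.L))
    rw [← stepUnitary_snd (proversOp S.unitary)] at e
    simp only [sndTime] at e hle hvs hs2
    rw [show v.L + j + 1 = v.L + 1 + j by omega]
    linarith

/-- The vector `χ` with its components outside of the all-zero state of `𝖵` removed. -/
def zeroPart {d : Fin r → ℕ} (χ : Basis (Wire r v.qV v.qM) d → ℂ) :
    Basis (Wire r v.qV v.qM) d → ℂ :=
  fun w => if ∀ j, w.1 (.V j) = false then χ w else 0

/-- A basis element with 𝖵 not all zero is caught by at least one qubit j, and each j is sampled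
with probability 1/qV. -/
theorem nrm_slice_zero_sub_le (hr : 0 < r) (S : v.Strategy) (φ : Basis v.GameQubit S.d → ℂ) :
    nrm (slice φ 0 - zeroPart (slice φ 0)) ^ 2 ≤ 5 * v.qV * S.rej v.game φ := by
  obtain ⟨h1, h2, h3, h4, h5⟩ := rej_checks_nonneg hr S φ
  have hg := rej_game φ
  have hi : S.rej v.initializationCheck φ ≤ 5 * S.rej v.game φ := by linarith
  have hV : (0 : ℝ) < v.qV := by exact_mod_cast v.qV_pos
  rw [rej_initializationCheck, div_le_iff₀ hV] at hi
  refine le_trans ?_ (hi.trans_eq (by ring))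
  refine le_trans ?_ (Finset.sum_le_sum fun j _ =>
    sum_place_le (fun s => by split_ifs <;> positivity) 0)
  rw [Finset.sum_comm, nrm_sq]
  refine Finset.sum_le_sum fun w _ => ?_
  have hite : ∀ j : Fin v.qV, 0 ≤ if !clk 1 (place 0 w : Basis v.GameQubit S.d) &&
      (place 0 w : Basis v.GameQubit S.d).1 (.V j) then ‖φ (place 0 w)‖ ^ 2 else 0 := by
    intro j; split_ifs <;> positivity
  rw [Pi.sub_apply, zeroPart]
  split_ifs with h
  · rw [sub_self, norm_zero, zero_pow two_ne_zero]
    exact Finset.sum_nonneg fun j _ => hite j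
  · push Not at h
    obtain ⟨j, hj⟩ := h
    refine le_trans (le_of_eq ?_) (Finset.single_le_sum (fun j _ => hite j) (Finset.mem_univ j))
    have hclk := (atTime_place 0 w : AtTime _ (_ : Basis v.GameQubit S.d)).clk_eq (by omega) 1
    have hbit : (place 0 w : Basis v.GameQubit S.d).1 (.V j) = w.1 (.V j) := rfl
    rw [if_pos (by simpa [hclk, hbit] using hj), sub_zero]
    rfl

theorem sum_slice_last_le (hr : 0 < r) (S : v.Strategy) (φ : Basis v.GameQubit S.d → ℂ) :
    (∑ w, if !w.1 (.V v.out) then ‖slice φ v.T w‖ ^ 2 else 0) ≤ 5 * S.rej v.game φ := by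
  obtain ⟨h1, h2, h3, h4, h5⟩ := rej_checks_nonneg hr S φ
  have hg := rej_game φ
  have ho : S.rej v.outputCheck φ ≤ 5 * S.rej v.game φ := by linarith
  rw [rej_outputCheck] at ho
  refine le_trans (le_of_eq ?_)
    ((sum_place_le (fun s => by split_ifs <;> positivity) v.T).trans ho)
  refine Finset.sum_congr rfl fun w _ => ?_
  have hclk := (atTime_place v.T w : AtTime _ (_ : Basis v.GameQubit S.d)).clk_eq le_rfl v.T
  have hbit : (place v.T w : Basis v.GameQubit S.d).1 (.V v.out) = w.1 (.V v.out) := rfl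
  rw [hclk, hbit]
  simp [slice]

/-- A clock string either shows a time or has 0, 1 at adjacent places. The latter weight is bounded
by part (a) of the clock check, at cost 5 · 2 · 2L; the part about 𝖡ᵢ is dropped as nonnegative. -/
theorem nrm_sq_le_sum_slice (hr : 0 < r) (S : v.Strategy) (φ : Basis v.GameQubit S.d → ℂ) :
    nrm φ ^ 2 ≤ ∑ n ∈ Finset.range (v.T + 1), nrm (slice φ n) ^ 2 +
      20 * v.L * S.rej v.game φ := by
  obtain ⟨h1, h2, h3, h4, h5⟩ := rej_checks_nonneg hr S φ
  have hg := rej_game φ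
  have hc : S.rej v.clockCheck φ ≤ 5 * S.rej v.game φ := by linarith
  have hite : ∀ (b : Prop) [Decidable b] (x : ℂ), 0 ≤ if b then ‖x‖ ^ 2 else 0 := by
    intro b _ x; split_ifs <;> positivity
  have hbad : (∑ k : Fin (v.T - 1), ∑ s, if !clk ((k : ℕ) + 1) s && clk ((k : ℕ) + 2) s
      then ‖φ s‖ ^ 2 else 0) ≤ 20 * v.L * S.rej v.game φ := by
    rw [rej_clockCheck hr] at hc
    have hB : 0 ≤ (∑ i : Fin r, ∑ s, if !(s.1 (.B i) == clk (v.L + 1) s)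
        then ‖φ s‖ ^ 2 else 0) / r :=
      div_nonneg (Finset.sum_nonneg fun _ _ => Finset.sum_nonneg fun _ _ => hite _ _)
        (by positivity)
    have hT : ((v.T - 1 : ℕ) : ℝ) = 2 * v.L := by simp [T]
    have hL : (0 : ℝ) < 2 * v.L := by have := v.L_pos; positivity
    rw [hT] at hc
    have : (∑ k : Fin (v.T - 1), ∑ s, if !clk ((k : ℕ) + 1) s && clk ((k : ℕ) + 2) s
      then ‖φ s‖ ^ 2 else 0) / (2 * v.L) ≤ 10 * S.rej v.game φ := by linarith
    rw [div_le_iff₀ hL] at this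
    linarith
  refine le_trans ?_ (add_le_add_right hbad _)
  have hslice : ∀ n, nrm (slice φ n) ^ 2 = ∑ s, if AtTime n s then ‖φ s‖ ^ 2 else 0 := by
    intro n
    rw [nrm_sq, ← sum_place_eq fun s => ‖φ s‖ ^ 2]
    rfl
  simp only [hslice]
  rw [nrm_sq, Finset.sum_comm, Finset.sum_comm (s := Finset.univ) (t := Finset.univ),
    ← Finset.sum_add_distrib]
  refine Finset.sum_le_sum fun s _ => ?_
  by_cases h : ∀ k : Fin (v.T - 1), ¬ (!clk ((k : ℕ) + 1) s && clk ((k : ℕ) + 2) s) = true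
  · obtain ⟨n, hn, hs⟩ := exists_atTime h
    refine le_trans ?_ (le_add_of_nonneg_right (Finset.sum_nonneg fun _ _ => hite _ _))
    refine le_trans (le_of_eq ?_) (Finset.single_le_sum (f := fun n => if AtTime n s
      then ‖φ s‖ ^ 2 else 0) (fun _ _ => hite _ _) (Finset.mem_range.2 (Nat.lt_succ_of_le hn)))
    rw [if_pos hs]
  · push Not at h
    obtain ⟨k, hk⟩ := h
    refine le_trans ?_ (le_add_of_nonneg_left (Finset.sum_nonneg fun _ _ => hite _ _))
    refine le_trans (le_of_eq ?_) (Finset.single_le_sum (f := fun k : Fin (v.T - 1) =>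
      if !clk ((k : ℕ) + 1) s && clk ((k : ℕ) + 2) s then ‖φ s‖ ^ 2 else 0)
      (fun _ _ => hite _ _) (Finset.mem_univ k))
    rw [if_pos hk]

/-- Hybrid argument: unitary steps do not enlarge earlier errors, so one η is added per step to the
initial one. -/
theorem nrm_slice_sub_run_le {W : Op (Wire r v.qV v.qM) fun i => 2 * d i} (hW : Wᴴ * W = 1)
    {φ : Basis v.GameQubit d → ℂ} {χ : Basis (Wire r v.qV v.qM) (fun i => 2 * d i) → ℂ} {η : ℝ}
    (h0 : nrm (slice φ 0 - χ) ≤ η)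
    (hη : ∀ k < v.T, nrm (slice φ (k + 1) - stepUnitary W k *ᵥ slice φ k) ≤ η) {n : ℕ}
    (hn : n ≤ v.T) : nrm (slice φ n - run W χ n) ≤ (n + 1) * η := by
  induction n with
  | zero => simpa [run] using h0
  | succ n ih =>
    have e : slice φ (n + 1) - run W χ (n + 1) =
        (slice φ (n + 1) - stepUnitary W n *ᵥ slice φ n) +
          stepUnitary W n *ᵥ (slice φ n - run W χ n) := by
      rw [run, mulVec_sub]; abel
    rw [e]
    refine (nrm_add_le _ _).trans ?_
    rw [nrm_mulVec_of_isometry (stepUnitary_isometry hW n)]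
    have := hη n hn
    have := ih (by omega)
    push_cast
    linarith

/-- The arithmetic of the soundness bound, with t = T, a = ‖χ‖, x = ‖φ‖², and q a bound for T + 2 in
terms of the size. -/
theorem le_of_propagation_bounds {t a η γ q x : ℝ} (ht0 : 0 ≤ t) (hγ : 0 < γ) (htq : t + 2 ≤ q)
    (ha : γ * a ^ 2 ≤ ((t + 2) * η) ^ 2)
    (hx : x ≤ (t + 1) * (2 * a ^ 2 + 2 * ((t + 1) * η) ^ 2) + η ^ 2) :
    x ≤ q ^ 3 * (3 + 2 * γ⁻¹) * η ^ 2 := by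
  have ha2 : a ^ 2 ≤ γ⁻¹ * ((t + 2) * η) ^ 2 := by
    rwa [inv_mul_eq_div, le_div_iff₀' hγ]
  have hi : 0 ≤ γ⁻¹ := by positivity
  calc x ≤ (t + 1) * (2 * (γ⁻¹ * ((t + 2) * η) ^ 2) + 2 * ((t + 1) * η) ^ 2) + η ^ 2 := by
        refine hx.trans ?_
        gcongr
    _ = (2 * γ⁻¹ * ((t + 1) * (t + 2) ^ 2) + (2 * (t + 1) ^ 3 + 1)) * η ^ 2 := by ring
    _ ≤ (2 * γ⁻¹ * (t + 2) ^ 3 + 3 * (t + 2) ^ 3) * η ^ 2 := by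
        gcongr
        · nlinarith [sq_nonneg (t + 2)]
        · have h1 : (t + 1) ^ 3 ≤ (t + 2) ^ 3 := by gcongr; linarith
          have h2 : 1 ≤ (t + 2) ^ 3 := one_le_pow₀ (by linarith)
          linarith
    _ = (t + 2) ^ 3 * (3 + 2 * γ⁻¹) * η ^ 2 := by ring
    _ ≤ q ^ 3 * (3 + 2 * γ⁻¹) * η ^ 2 := by gcongr

/-- The core of soundness: a vector that is rarely rejected is close to a run of the proof system,
which is rejected with weight at least γ‖χ‖², so it must be short. -/
theorem nrm_sq_le_mul_rej (hr : 0 < r) {γ : ℝ} (hγ : 0 < γ) (hMAP : γ ≤ 1 - v.MAP) {p : ℕ}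
    (hV : v.qV ≤ p) (hL : v.L ≤ p) (S : v.Strategy) (φ : Basis v.GameQubit S.d → ℂ) :
    nrm φ ^ 2 ≤ 80 * (p + 1) * (2 * p + 3) ^ 3 * (3 + 2 * γ⁻¹) * S.rej v.game φ := by
  set ε := S.rej v.game φ with hε
  have hε0 : 0 ≤ ε := rej_game_nonneg hr S φ
  have hVp : (v.qV : ℝ) ≤ p := by exact_mod_cast hV
  have hLp : (v.L : ℝ) ≤ p := by exact_mod_cast hL
  -- One η for all errors: 80(p + 1) dominates 80L (steps), 5 qV (initialization), 5 (output) and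
  -- 20L (illegal clocks).
  set η := Real.sqrt (80 * (p + 1) * ε) with hη
  have hη0 : 0 ≤ η := Real.sqrt_nonneg _
  have hη2 : η ^ 2 = 80 * (p + 1) * ε := Real.sq_sqrt (by positivity)
  have hle : ∀ x : ℝ, x ^ 2 ≤ 80 * (p + 1) * ε → x ≤ η := fun x hx => Real.le_sqrt_of_sq_le hx
  have hW : (proversOp S.unitary)ᴴ * proversOp S.unitary = 1 :=
    proversOp_isometry fun i => mem_unitaryGroup_iff'.1 (S.unitary_mem i)
  set χ := zeroPart (slice φ 0) with hχ
  set a := nrm χ with ha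
  have hrun := fun n (hn : n ≤ v.T) => nrm_slice_sub_run_le (φ := φ) (χ := χ) hW
    (hle _ ((nrm_slice_zero_sub_le hr S φ).trans (by gcongr ?_ * _; linarith)))
    (fun k hk => hle _ ((nrm_slice_sub_step_le hr S φ hk).trans (by gcongr; linarith))) hn
  have hout : γ * a ^ 2 ≤ ((v.T + 2) * η) ^ 2 := by
    have h1 := one_sub_MAP_mul_le (d := fun i => 2 * S.d i) S.unitary_mem (χ := χ) (by
      intro w hw
      by_contra h
      exact hw (if_neg h))
    -- The projection onto output bit 0, that is, onto rejection.
    let mask : (Basis (Wire r v.qV v.qM) (fun i => 2 * S.d i) → ℂ) →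
        Basis (Wire r v.qV v.qM) (fun i => 2 * S.d i) → ℂ :=
      fun f w => if !w.1 (.V v.out) then f w else 0
    have hmask : ∀ f, nrm (mask f) ^ 2 = ∑ w, if !w.1 (.V v.out) then ‖f w‖ ^ 2 else 0 := by
      intro f
      rw [nrm_sq]
      refine Finset.sum_congr rfl fun w _ => ?_
      simp only [mask]
      split_ifs <;> simp
    rw [← hmask] at h1
    -- T + 1 errors from propagation up to time T, and one more from the output check.
    have h2 : nrm (mask (run (proversOp S.unitary) χ v.T)) ≤ (v.T + 2) * η := by
      have e : mask (run (proversOp S.unitary) χ v.T) =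
          mask (slice φ v.T) + mask (run (proversOp S.unitary) χ v.T - slice φ v.T) := by
        ext w
        simp only [mask, Pi.add_apply, Pi.sub_apply]
        split_ifs <;> simp
      have h3 : nrm (mask (slice φ v.T)) ≤ η := by
        refine hle _ ?_
        rw [hmask]
        refine (sum_slice_last_le hr S φ).trans ?_
        gcongr
        have : (0 : ℝ) ≤ p := by positivity
        linarith
      have h4 : nrm (mask (run (proversOp S.unitary) χ v.T - slice φ v.T)) ≤ (v.T + 1) * η := by
        refine le_trans (nrm_le_nrm fun w => ?_) ((nrm_sub_comm _ _).trans_le (hrun v.T le_rfl))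
        simp only [mask]
        split_ifs <;> simp
      rw [e]
      refine (nrm_add_le _ _).trans ?_
      linarith
    calc γ * a ^ 2 ≤ (1 - v.MAP) * a ^ 2 := by gcongr
      _ ≤ _ := h1
      _ ≤ _ := pow_le_pow_left₀ (nrm_nonneg _) h2 2
  have hslice : ∀ n ∈ Finset.range (v.T + 1),
      nrm (slice φ n) ^ 2 ≤ 2 * a ^ 2 + 2 * ((v.T + 1) * η) ^ 2 := by
    intro n hn
    have hn' : n ≤ v.T := Nat.lt_succ_iff.1 (Finset.mem_range.1 hn)
    have h1 : nrm (slice φ n) ≤ a + (v.T + 1) * η := by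
      have e : slice φ n = run (proversOp S.unitary) χ n +
          (slice φ n - run (proversOp S.unitary) χ n) := by abel
      rw [e]
      refine (nrm_add_le _ _).trans ?_
      rw [nrm_run hW]
      have h2 : ((n : ℝ) + 1) * η ≤ (v.T + 1) * η := by gcongr
      have := hrun n hn'
      linarith
    calc nrm (slice φ n) ^ 2 ≤ (a + (v.T + 1) * η) ^ 2 := pow_le_pow_left₀ (nrm_nonneg _) h1 2
      _ ≤ _ := by nlinarith [sq_nonneg (a - (v.T + 1) * η)]
  have htot : nrm φ ^ 2 ≤ (v.T + 1) * (2 * a ^ 2 + 2 * ((v.T + 1) * η) ^ 2) + η ^ 2 := by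
    refine (nrm_sq_le_sum_slice hr S φ).trans (add_le_add ?_ ?_)
    · refine (Finset.sum_le_card_nsmul _ _ _ hslice).trans_eq ?_
      rw [Finset.card_range, nsmul_eq_mul, Nat.cast_succ]
    · rw [hη2]
      gcongr <;> linarith
  have htp : (v.T : ℝ) + 2 ≤ 2 * p + 3 := by
    have : (v.T : ℝ) = 2 * v.L + 1 := by simp [T]
    linarith
  refine (le_of_propagation_bounds (Nat.cast_nonneg _) hγ htp hout htot).trans_eq ?_
  rw [hη2]; ring

theorem Strategy.acceptProb_le (hr : 0 < r) {γ : ℝ} (hγ : 0 < γ) (hMAP : γ ≤ 1 - v.MAP) {p : ℕ}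
    (hV : v.qV ≤ p) (hL : v.L ≤ p) (S : v.Strategy) :
    S.acceptProb ≤ 1 - (80 * (p + 1) * (2 * p + 3) ^ 3 * (3 + 2 * γ⁻¹))⁻¹ := by
  obtain ⟨b, h1, h⟩ := exists_acceptProb_eq S
  rw [h]
  refine sub_le_sub_left ?_ 1
  rw [inv_le_iff_one_le_mul₀' (by positivity), Finset.mul_sum]
  refine h1.symm.le.trans ?_
  exact Finset.sum_le_sum fun k _ => nrm_sq_le_mul_rej hr hγ hMAP hV hL S (b k)

end Soundness

/-! ### Completeness -/

section Completeness

variable {r : ℕ} {v : Verifier r} {d : Fin r → ℕ}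

/-- The reflection `|1⟩⟨0| ⊗ W + |0⟩⟨1| ⊗ Wᴴ`. -/
def controlledReflection {α : Type*} (W : Matrix α α ℂ) : Matrix (Bool × α) (Bool × α) ℂ :=
  fun x y => if x.1 = y.1 then 0 else if x.1 then W x.2 y.2 else Wᴴ x.2 y.2

theorem controlledReflection_isHermitian {α : Type*} (W : Matrix α α ℂ) :
    (controlledReflection W).IsHermitian := by
  ext ⟨a, x⟩ ⟨b, y⟩
  cases a <;> cases b <;> simp [controlledReflection]

theorem controlledReflection_mul_self {α : Type*} [Fintype α] [DecidableEq α] {W : Matrix α α ℂ}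
    (hW : W ∈ Matrix.unitaryGroup α ℂ) :
    controlledReflection W * controlledReflection W = 1 := by
  have h1 : Wᴴ * W = 1 := mem_unitaryGroup_iff'.1 hW
  have h2 : W * Wᴴ = 1 := mem_unitaryGroup_iff.1 hW
  ext ⟨a, x⟩ ⟨b, y⟩
  have e1 := congrFun (congrFun h1 x) y
  have e2 := congrFun (congrFun h2 x) y
  rw [mul_apply] at e1 e2
  rw [mul_apply, Fintype.sum_prod_type, Fintype.sum_bool]
  cases a <;> cases b <;> simp [controlledReflection, one_apply] at e1 e2 ⊢ <;>
    assumption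

/-- The wires of a basis element of the game. -/
def restrictWire (s : Basis v.GameQubit d) : Basis (Wire r v.qV v.qM) d :=
  (fun w => s.1 w.toQubit, s.2)

/-- The basis element of the game with the given clock, copies and wires. -/
def assemble (c : Fin v.T → Bool) (b : Fin r → Bool) (w : Basis (Wire r v.qV v.qM) d) :
    Basis v.GameQubit d :=
  (fun
    | .C t => c t
    | .B i => b i
    | .V j => w.1 (.V j)
    | .M i j => w.1 (.M i j), w.2)

theorem restrictWire_assemble (c : Fin v.T → Bool) (b : Fin r → Bool)
    (w : Basis (Wire r v.qV v.qM) d) : restrictWire (assemble c b w) = w := by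
  refine Prod.ext (funext fun u => ?_) rfl
  cases u <;> rfl

theorem assemble_restrictWire (s : Basis v.GameQubit d) :
    assemble (fun t => s.1 (.C t)) (fun i => s.1 (.B i)) (restrictWire s) = s := by
  refine Prod.ext (funext fun u => ?_) rfl
  cases u <;> rfl

theorem assemble_injective (c : Fin v.T → Bool) (b : Fin r → Bool) :
    Function.Injective (assemble c b : Basis (Wire r v.qV v.qM) d → Basis v.GameQubit d) :=
  Function.LeftInverse.injective (restrictWire_assemble c b)

theorem intertwines_assemble (c : Fin v.T → Bool) (b : Fin r → Bool) : Intertwines Wire.toQubit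
    (assemble c b : Basis (Wire r v.qV v.qM) d → Basis v.GameQubit d) where
  bit w u := by cases u <;> rfl
  setBit w u b := by
    refine Prod.ext (funext fun q => ?_) rfl
    cases u <;> cases q <;> simp [assemble, setBit, Wire.toQubit, Function.update_apply]

/-- On the elements with the same clock as `s`, the vector `φ` is `f` tensored with the basis state
`b ⋯ b` of the copies. -/
def SliceEq (φ : Basis v.GameQubit d → ℂ) (s : Basis v.GameQubit d) (b : Bool)
    (f : Basis (Wire r v.qV v.qM) d → ℂ) : Prop :=
  ∀ s', (∀ l, s'.1 (.C l) = s.1 (.C l)) →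
    φ s' = if ∀ i, s'.1 (.B i) = b then f (restrictWire s') else 0

/-- On slices, `A` acts as `U`, and it maps the copies from `b` to `b'`. -/
def ActsAs (A : Op v.GameQubit d) (U : Op (Wire r v.qV v.qM) d) (b b' : Bool) : Prop :=
  ∀ φ s f, SliceEq φ s b f →
    (A *ᵥ φ) s = if ∀ i, s.1 (.B i) = b' then (U *ᵥ f) (restrictWire s) else 0

theorem actsAs_gateOp (g : Gate r v.qV v.qM) (b : Bool) :
    ActsAs (gateOp g : Op v.GameQubit d) g.op b b := by
  intro φ s f h
  set J : Basis (Wire r v.qV v.qM) d → Basis v.GameQubit d :=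
    assemble (fun t => s.1 (.C t)) (fun i => s.1 (.B i)) with hJ
  have h1 := congrFun ((intertwines_assemble (fun t => s.1 (.C t)) (fun i => s.1 (.B i))).gate_mulVec
    Wire.toQubit_injective g φ) (restrictWire s)
  rw [Function.comp_apply, assemble_restrictWire] at h1
  rw [gateOp, h1]
  have h2 : φ ∘ J = if ∀ i, s.1 (.B i) = b then f else 0 := by
    ext w
    rw [Function.comp_apply, h (J w) fun l => rfl, hJ, restrictWire_assemble]
    change (if ∀ i, s.1 (.B i) = b then f w else 0) = _
    by_cases hb : ∀ i, s.1 (.B i) = b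
    · rw [if_pos hb, if_pos hb]
    · rw [if_neg hb, if_neg hb]; rfl
  rw [h2]
  split_ifs
  · rfl
  · simp

/-- Entries of `controlledReflection` vanish unless the bit flips, and rows with bit 1 carry W,
those with bit 0 its adjoint. A single copy with the wrong bit makes the whole product vanish. -/
theorem actsAs_playersOp (W : (i : Fin r) →
    Matrix ((Fin v.qM → Bool) × Fin (d i)) ((Fin v.qM → Bool) × Fin (d i)) ℂ) (b : Bool) :
    ActsAs (playersOp fun i => controlledReflection (W i) : Op v.GameQubit d)
      (proversOp fun i => if b then W i else (W i)ᴴ) (!b) b := by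
  intro φ s f h
  obtain ⟨z, rfl⟩ := (splitGame v d).symm.surjective s
  have hφ : ∀ y, φ ((splitGame v d).symm (z.1, y)) = if ∀ i, (y i).1 = !b
      then f ((splitWire v d).symm (z.1.2, fun i => (y i).2)) else 0 := by
    intro y
    rw [h ((splitGame v d).symm (z.1, y)) fun l => rfl]
    refine if_congr Iff.rfl (congrArg f ?_) rfl
    rw [Equiv.eq_symm_apply]
    rfl
  have hrs : restrictWire ((splitGame v d).symm z) =
      (splitWire v d).symm (z.1.2, fun i => (z.2 i).2) := by
    rw [Equiv.eq_symm_apply]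
    rfl
  rw [playersOp_mulVec]
  by_cases hb : ∀ i, ((splitGame v d).symm z).1 (.B i) = b
  · rw [if_pos hb, hrs, proversOp_mulVec]
    symm
    refine Fintype.sum_of_injective (fun y i => (!b, y i)) ?_ _ _ ?_ ?_
    · intro y y' hy
      exact funext fun i => congrArg Prod.snd (congrFun hy i)
    · intro y hy
      rw [hφ, if_neg, mul_zero]
      intro h'
      exact hy ⟨fun i => (y i).2, funext fun i => Prod.ext (h' i).symm rfl⟩
    · intro y
      rw [hφ, if_pos fun _ => rfl]
      congr 1
      refine Finset.prod_congr rfl fun i _ => ?_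
      have hbi : (z.2 i).1 = b := hb i
      rw [controlledReflection, hbi]
      cases b
      · rfl
      · rfl
  · rw [if_neg hb]
    obtain ⟨i, hi⟩ := not_forall.1 hb
    have hi' : (z.2 i).1 ≠ b := hi
    refine Finset.sum_eq_zero fun y _ => ?_
    rw [hφ]
    split_ifs with hy
    · rw [Finset.prod_eq_zero (Finset.mem_univ i), zero_mul]
      rw [controlledReflection, if_pos]
      rw [hy i]
      exact Bool.eq_not_of_ne hi'
    · rw [mul_zero]

variable (P : v.Provers)

/-- The history state of the provers. -/
def Provers.history : Basis v.GameQubit P.d → ℂ := fun s =>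
  ∑ n ∈ Finset.range (v.T + 1), if AtTime n s ∧ ∀ i, s.1 (.B i) = decide (v.L < n)
    then run P.op P.init n (restrictWire s) else 0

variable {P}

theorem AtTime.unique {n n' : ℕ} {s : Basis v.GameQubit d} (h : AtTime n s) (h' : AtTime n' s)
    (hn : n ≤ v.T) (hn' : n' ≤ v.T) : n = n' := by
  have h1 := h.clk_eq hn n
  have h2 := h'.clk_eq hn' n
  have h3 := h.clk_eq hn n'
  have h4 := h'.clk_eq hn' n'
  rw [h1] at h2
  rw [h3] at h4
  simp only [decide_eq_decide] at h2 h4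
  omega

theorem AtTime.congr {n : ℕ} {s s' : Basis v.GameQubit d} (h : AtTime n s)
    (hs : ∀ l, s'.1 (.C l) = s.1 (.C l)) : AtTime n s' := fun k => (hs k).trans (h k)

theorem history_of_atTime {n : ℕ} (hn : n ≤ v.T) {s : Basis v.GameQubit P.d} (h : AtTime n s) :
    P.history s = if ∀ i, s.1 (.B i) = decide (v.L < n)
      then run P.op P.init n (restrictWire s) else 0 := by
  rw [Provers.history, Finset.sum_eq_single n]
  · simp [h]
  · intro n' hn' hne
    rw [if_neg]
    exact fun h' => hne (h'.1.unique h (Nat.lt_succ_iff.1 (Finset.mem_range.1 hn')) hn)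
  · intro h'
    exact absurd (Finset.mem_range.2 (Nat.lt_succ_of_le hn)) h'

theorem sliceEq_history {n : ℕ} (hn : n ≤ v.T) {s : Basis v.GameQubit P.d} (h : AtTime n s) :
    SliceEq P.history s (decide (v.L < n)) (run P.op P.init n) := fun _ hs =>
  history_of_atTime hn (h.congr hs)

theorem history_eq_zero {s : Basis v.GameQubit P.d} (h : ∀ n ≤ v.T, ¬ AtTime n s) :
    P.history s = 0 :=
  Finset.sum_eq_zero fun n hn =>
    if_neg fun h' => h n (Nat.lt_succ_iff.1 (Finset.mem_range.1 hn)) h'.1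

theorem exists_of_history_ne_zero {s : Basis v.GameQubit P.d} (h : P.history s ≠ 0) :
    ∃ n ≤ v.T, AtTime n s ∧ (∀ i, s.1 (.B i) = decide (v.L < n)) ∧
      P.history s = run P.op P.init n (restrictWire s) := by
  by_contra h'
  push Not at h'
  refine h (history_eq_zero fun n hn hs => ?_)
  have e := history_of_atTime (P := P) hn hs
  by_cases hb : ∀ i, s.1 (.B i) = decide (v.L < n)
  · rw [if_pos hb] at e
    exact h' n hn hs hb e
  · rw [if_neg hb] at e
    exact h e

theorem clk_setBit {k : Fin v.T} {t : ℕ} (ht : t ≠ (k : ℕ) + 1) (s : Basis v.GameQubit d)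
    (b : Bool) : clk t (setBit s (.C k) b) = clk t s := by
  unfold clk
  split_ifs with h0 h1
  · rfl
  · have hne : (Qubit.C ⟨t - 1, h1⟩ : v.GameQubit) ≠ .C k := by
      intro h
      have := congrArg Fin.val (Qubit.C.inj h)
      simp only at this
      omega
    simp only [setBit, Function.update_of_ne hne]
  · rfl

theorem setBit_setBit_self (s : Basis v.GameQubit d) (u : v.GameQubit) (b : Bool) :
    setBit (setBit s u b) u (s.1 u) = s := by
  simp [setBit]

/-- The history state passes the propagation checks. -/
theorem history_sub_step_eq_zero (k : Fin v.T) {A : Op v.GameQubit P.d}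
    {U V : Op (Wire r v.qV v.qM) P.d}
    (hU : ActsAs A U (decide (v.L < (k : ℕ))) (decide (v.L < (k : ℕ) + 1)))
    (hV : ActsAs A V (decide (v.L < (k : ℕ) + 1)) (decide (v.L < (k : ℕ))))
    (hUr : U *ᵥ run P.op P.init k = run P.op P.init ((k : ℕ) + 1))
    (hVr : V *ᵥ run P.op P.init ((k : ℕ) + 1) = run P.op P.init k)
    {s : Basis v.GameQubit P.d} (hs : (clk (k : ℕ) s && !clk ((k : ℕ) + 2) s) = true) :
    P.history s - ((qubitOp pauliX (.C k) * A) *ᵥ P.history) s = 0 := by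
  have hk := k.2
  rw [qubitOp_pauliX_mul_mulVec, sub_eq_zero]
  have hbit : ∀ (u : v.GameQubit) (b : Bool) (i : Fin r), u = .C k →
      (setBit s u b).1 (.B i) = s.1 (.B i) := by
    rintro u b i rfl
    simp [setBit]
  have hres : ∀ b : Bool, restrictWire (setBit s (.C k) b) = restrictWire s := by
    intro b
    refine Prod.ext (funext fun w => ?_) rfl
    simp only [restrictWire, setBit, Function.update_of_ne (w.toQubit_ne_C k)]
  -- At time k + 1 the flipped clock shows k and A acts forward as U; at time k it shows k + 1 and A
  -- acts backward as V.
  by_cases h1 : AtTime ((k : ℕ) + 1) s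
  · have hb : s.1 (.C k) = true := by rw [h1]; simp
    rw [hb, Bool.not_true, hU _ _ _ (sliceEq_history (by omega) h1.setBit_succ), hUr, hres,
      history_of_atTime hk h1]
    simp only [hbit _ _ _ rfl]
  by_cases h0 : AtTime (k : ℕ) s
  · have hb : s.1 (.C k) = false := by rw [h0]; simp
    rw [hb, Bool.not_false, hV _ _ _ (sliceEq_history (by omega) h0.setBit_self), hVr, hres,
      history_of_atTime (by omega) h0]
    simp only [hbit _ _ _ rfl]
  -- Neighbouring bits 1, 0 leave k and k + 1 as the only possible times. In the remaining case the
  -- clock of s is illegal, and so is the flipped one, as flipping back would give a legal clock.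
  have hnone : ∀ s' : Basis v.GameQubit P.d, clk (k : ℕ) s' = clk (k : ℕ) s →
      clk ((k : ℕ) + 2) s' = clk ((k : ℕ) + 2) s → ∀ n ≤ v.T, AtTime n s' →
      n = k ∨ n = (k : ℕ) + 1 := by
    intro s' e1 e2 n hn hs'
    rw [← e1, ← e2, hs'.clk_eq hn, hs'.clk_eq hn] at hs
    simp only [Bool.and_eq_true, decide_eq_true_eq, Bool.not_eq_true', decide_eq_false_iff_not] at hs
    omega
  have hs0 : P.history s = 0 := by
    refine history_eq_zero fun n hn hsn => ?_
    rcases hnone s rfl rfl n hn hsn with rfl | rfl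
    · exact h0 hsn
    · exact h1 hsn
  have hflip : ∀ n ≤ v.T, ¬ AtTime n (setBit s (.C k) (!s.1 (.C k))) := by
    intro n hn hsn
    rcases hnone _ (clk_setBit (by omega) s _) (clk_setBit (by omega) s _) n hn hsn with rfl | rfl
    · have hb := hsn k
      have h := hsn.setBit_self
      rw [show true = s.1 (.C k) by simpa [setBit] using hb, setBit_setBit_self] at h
      exact h1 h
    · have hb := hsn k
      have h := hsn.setBit_succ
      rw [show false = s.1 (.C k) by simpa [setBit] using hb, setBit_setBit_self] at h
      exact h0 h
  rw [hs0, hU _ _ 0]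
  · simp
  · intro s' hs'
    rw [history_eq_zero fun n hn hsn => hflip n hn (hsn.congr fun l => (hs' l).symm)]
    simp

/-- Gates are their own inverses, so U = V, and away from the prover step the copies do not change.
-/
theorem history_sub_gate_eq_zero (k : Fin v.T) (hk : (k : ℕ) ≠ v.L) (g : Gate r v.qV v.qM)
    (hg : stepUnitary P.op k = g.op) {s : Basis v.GameQubit P.d}
    (hs : (clk (k : ℕ) s && !clk ((k : ℕ) + 2) s) = true) :
    P.history s - (stepOp k g *ᵥ P.history) s = 0 := by
  have e : decide (v.L < (k : ℕ) + 1) = decide (v.L < (k : ℕ)) := by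
    simp only [decide_eq_decide]; omega
  refine history_sub_step_eq_zero k (U := g.op) (V := g.op) ?_ ?_ ?_ ?_ hs
  · rw [e]; exact actsAs_gateOp g _
  · rw [e]; exact actsAs_gateOp g _
  · rw [run, hg]
  · rw [run, hg, mulVec_mulVec, g.op_mul_self, one_mulVec]

variable (P)

/-- The slice at time 0 alone contributes the unit vector `P.init`; the exact norm is not needed. -/
theorem one_le_nrm_history : 1 ≤ nrm P.history ^ 2 := by
  have h := Finset.sum_map Finset.univ
    ⟨assemble (fun _ => false) fun _ => false, assemble_injective (d := P.d) (v := v) _ _⟩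
    fun s => ‖P.history s‖ ^ 2
  rw [nrm_sq]
  refine le_trans (h.symm.le.trans' ?_) (Finset.sum_le_sum_of_subset_of_nonneg
    (Finset.subset_univ _) fun s _ _ => sq_nonneg ‖P.history s‖)
  have e : ∀ w : Basis (Wire r v.qV v.qM) P.d,
      P.history (assemble (fun _ => false) (fun _ => false) w) = P.init w := by
    intro w
    rw [history_of_atTime (n := 0) (by omega) (fun k => by simp [assemble]),
      restrictWire_assemble, if_pos]
    · rfl
    · intro i; simp [assemble]
  simp only [Function.Embedding.coeFn_mk, e]
  rw [← nrm_sq, P.nrm_init, one_pow]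

/-- The last clock qubit is 1 only at time T, where the history state carries the final state of the
proof system. -/
theorem sum_history_output :
    (∑ s, if clk v.T s && !s.1 (.V v.out) then ‖P.history s‖ ^ 2 else 0) = 1 - P.acceptProb := by
  rw [P.acceptProb_eq, sub_sub_cancel]
  symm
  have hT : v.L < v.T := by simp only [T]; omega
  have hat : ∀ w : Basis (Wire r v.qV v.qM) P.d,
      AtTime v.T (assemble (fun _ => true) (fun _ => true) w : Basis v.GameQubit P.d) := fun w k => by
    simp only [assemble]
    exact (decide_eq_true k.2).symm
  refine Fintype.sum_of_injective (assemble (fun _ => true) fun _ => true)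
    (assemble_injective _ _) _ _ ?_ ?_
  · intro s hs
    by_cases h0 : P.history s = 0
    · simp [h0]
    · obtain ⟨n, hn, hat, hB, -⟩ := exists_of_history_ne_zero h0
      rw [hat.clk_eq hn, if_neg]
      intro h
      simp only [Bool.and_eq_true, decide_eq_true_eq] at h
      have hnT : n = v.T := le_antisymm hn h.1
      subst hnT
      refine hs ⟨restrictWire s, ?_⟩
      rw [← assemble_restrictWire s, restrictWire_assemble]
      congr 1
      · ext1 t
        rw [hat t]
        exact (decide_eq_true t.2).symm
      · ext1 i
        rw [hB i]
        exact (decide_eq_true hT).symm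
  · intro w
    have e : P.history (assemble (fun _ => true) (fun _ => true) w) = run P.op P.init v.T w := by
      rw [history_of_atTime le_rfl (hat w), restrictWire_assemble, if_pos]
      exact fun i => (decide_eq_true hT).symm
    rw [(hat w).clk_eq le_rfl, e]
    simp [assemble]

/-- The honest strategy of players who share the history state. -/
@[reducible]
def Provers.strategy : v.Strategy where
  d := P.d
  ρ := (((nrm P.history ^ 2)⁻¹ : ℝ) : ℂ) • vecMulVec P.history (star P.history)
  ρ_posSemidef := (posSemidef_vecMulVec_self_star P.history).smul (by
    rw [Complex.zero_le_real]; positivity)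
  ρ_trace := by
    have h0 : nrm P.history ^ 2 ≠ 0 := (zero_lt_one.trans_le (one_le_nrm_history P)).ne'
    have h : (vecMulVec P.history (star P.history)).trace = ((nrm P.history ^ 2 : ℝ) : ℂ) := by
      rw [trace_vecMulVec, dotProduct, nrm_sq, Complex.ofReal_sum]
      refine Finset.sum_congr rfl fun s _ => ?_
      rw [Pi.star_apply, Complex.star_def, Complex.mul_conj, Complex.normSq_eq_norm_sq]
    rw [trace_smul, h, smul_eq_mul, ← Complex.ofReal_mul, inv_mul_cancel₀ h0, Complex.ofReal_one]
  R i := controlledReflection (P.W i)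
  R_isHermitian i := controlledReflection_isHermitian _
  R_mul_self i := controlledReflection_mul_self (P.W_unitary i)

/-- Only the output check, chosen with probability 1/5, ever rejects the history state. -/
theorem rej_game_history (hr : 0 < r) :
    P.strategy.rej v.game P.history = (1 - P.acceptProb) / 5 := by
  have hzero : ∀ (b : Basis v.GameQubit P.d → Bool),
      (∀ s, P.history s ≠ 0 → b s = false) →
      (∑ s, if b s then ‖P.history s‖ ^ 2 else 0) = 0 := by
    intro b hb
    refine Finset.sum_eq_zero fun s _ => ?_
    by_cases h : P.history s = 0
    · simp [h]
    · simp [hb s h]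
  have hclock : P.strategy.rej v.clockCheck P.history = 0 := by
    rw [rej_clockCheck hr]
    have h1 : ∀ k : Fin (v.T - 1), (∑ s : Basis v.GameQubit P.d,
        if !clk ((k : ℕ) + 1) s && clk ((k : ℕ) + 2) s then ‖P.history s‖ ^ 2 else 0) = 0 := by
      intro k
      refine hzero (fun s => !clk ((k : ℕ) + 1) s && clk ((k : ℕ) + 2) s) fun s hs => ?_
      obtain ⟨n, hn, hat, -, -⟩ := exists_of_history_ne_zero hs
      rw [hat.clk_eq hn, hat.clk_eq hn]
      by_cases h : (k : ℕ) + 1 ≤ n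
      · simp [h]
      · have : ¬ (k : ℕ) + 2 ≤ n := by omega
        simp [this]
    have h2 : ∀ i : Fin r, (∑ s : Basis v.GameQubit P.d,
        if !(s.1 (.B i) == clk (v.L + 1) s) then ‖P.history s‖ ^ 2 else 0) = 0 := by
      intro i
      refine hzero (fun s => !(s.1 (.B i) == clk (v.L + 1) s)) fun s hs => ?_
      obtain ⟨n, hn, hat, hB, -⟩ := exists_of_history_ne_zero hs
      rw [hat.clk_eq hn, hB]
      simp
    rw [Finset.sum_eq_zero fun k _ => h1 k, Finset.sum_eq_zero fun i _ => h2 i]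
    simp
  have hstep : ∀ (k : Fin v.T) (g : Gate r v.qV v.qM), (k : ℕ) ≠ v.L →
      stepUnitary P.op k = g.op → P.strategy.rej (v.stepCheck ((k : ℕ) + 1) g) P.history = 0 := by
    intro k g hk hg
    rw [rej_stepCheck]
    refine mul_eq_zero_of_right _ (Finset.sum_eq_zero fun s _ => ?_)
    split_ifs with hs
    · have h := history_sub_gate_eq_zero k hk g hg hs
      exact (congrArg (fun x : ℂ => ‖x‖ ^ 2) h).trans (by simp)
    · rfl
  have hverifier : P.strategy.rej v.verifierPropagationCheck P.history = 0 := by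
    rw [rej_verifierPropagationCheck,
      Finset.sum_eq_zero fun k _ => hstep (fstTime k) (v.V₁ k) k.2.ne (stepUnitary_fst _ k),
      Finset.sum_eq_zero fun k _ => hstep (sndTime k) (v.V₂ k) (by simp only [sndTime]; omega)
        (stepUnitary_snd _ k)]
    simp
  have hprover : P.strategy.rej v.proverPropagationCheck P.history = 0 := by
    have hW : P.opᴴ *ᵥ run P.op P.init (v.L + 1) = run P.op P.init v.L := by
      rw [run, stepUnitary_mid, mulVec_mulVec, P.op_isometry, one_mulVec]
    have hWr : P.op *ᵥ run P.op P.init v.L = run P.op P.init (v.L + 1) := by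
      rw [run, stepUnitary_mid]
    have hU := actsAs_playersOp P.W true
    have hV := actsAs_playersOp P.W false
    simp only [if_true, Bool.false_eq_true, if_false, Bool.not_true, Bool.not_false] at hU hV
    rw [← proversOp_conjTranspose, ← P.op_eq] at hV
    rw [← P.op_eq] at hU
    rw [rej_proverPropagationCheck]
    refine mul_eq_zero_of_right _ (Finset.sum_eq_zero fun s _ => ?_)
    split_ifs with hs
    · have h := history_sub_step_eq_zero v.mid (by simpa [mid] using hU) (by simpa [mid] using hV)
        hWr hW hs
      exact (congrArg (fun x : ℂ => ‖x‖ ^ 2) h).trans (by simp)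
    · rfl
  have hstart : P.strategy.rej v.initializationCheck P.history = 0 := by
    rw [rej_initializationCheck, Finset.sum_eq_zero, zero_div]
    intro j _
    refine hzero (fun s => !clk 1 s && s.1 (.V j)) fun s hs => ?_
    obtain ⟨n, hn, hat, -, e⟩ := exists_of_history_ne_zero hs
    rw [hat.clk_eq hn]
    by_cases h1 : 1 ≤ n
    · simp [h1]
    · obtain rfl : n = 0 := by omega
      rw [e, run, Provers.init] at hs
      have hV := (ite_ne_right_iff.1 hs).1 j
      have hV' : s.1 (.V j) = false := hV
      simp [hV']
  have hout : P.strategy.rej v.outputCheck P.history = 1 - P.acceptProb := by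
    rw [rej_outputCheck]
    exact sum_history_output P
  rw [rej_game, hclock, hverifier, hprover, hstart, hout]
  ring

/-- The rejection probability is (1 - `P.acceptProb`)/5 divided by ‖history‖² ≥ 1, hence at most 1 -
`P.acceptProb`. -/
theorem acceptProb_le_strategy (hr : 0 < r) : P.acceptProb ≤ P.strategy.acceptProb := by
  have h := acceptProb_eq_of_pure (S := P.strategy) (φ := P.history)
    (c := (nrm P.history ^ 2)⁻¹) rfl
  rw [h, rej_game_history P hr]
  have h1 : (nrm P.history ^ 2)⁻¹ ≤ 1 := inv_le_one_of_one_le₀ (one_le_nrm_history P)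
  have h2 : 0 ≤ 1 - P.acceptProb := sub_nonneg.2 P.acceptProb_le_one
  have h3 : (nrm P.history ^ 2)⁻¹ * ((1 - P.acceptProb) / 5) ≤ 1 * ((1 - P.acceptProb) / 5) := by
    gcongr
  linarith

end Completeness

theorem gameValue_eq_one {r : ℕ} (hr : 0 < r) {v : Verifier r} (h : 1 ≤ v.MAP) :
    v.gameValue = 1 := by
  -- Were there no provers, MAP would be the supremum of the empty set, which is 0.
  have hne : (Set.range fun P : v.Provers => P.acceptProb).Nonempty := by
    by_contra h'
    rw [Set.not_nonempty_iff_eq_empty] at h'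
    rw [MAP, h', Real.sSup_empty] at h
    exact absurd h (by norm_num)
  have hle : ∀ S : v.Strategy, S.acceptProb ≤ 1 := Strategy.acceptProb_le_one hr
  have hbdd : BddAbove (Set.range fun S : v.Strategy => S.acceptProb) :=
    ⟨1, by rintro _ ⟨S, rfl⟩; exact hle S⟩
  obtain ⟨_, P, rfl⟩ := id hne
  refine le_antisymm (csSup_le ⟨_, P.strategy, rfl⟩ (by rintro _ ⟨S, rfl⟩; exact hle S))
    (h.trans (csSup_le hne ?_))
  rintro _ ⟨P, rfl⟩
  exact (acceptProb_le_strategy P hr).trans (le_csSup hbdd ⟨P.strategy, rfl⟩)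

end Verifier

end HonestGame

end

/-! ### The main theorem -/

open HonestGame in
theorem mainTheorem6 (r : ℕ → ℕ) (hr_pos : ∀ n, 0 < r n)
    (hr : PolyBounded fun n => (r n : ℝ)) (s : ℕ → ℝ) (hs : OneMinusInvPoly s)
    (p : ℕ → ℕ) (hp : PolyBounded fun n => (p n : ℝ)) :
    ∃ s' : ℕ → ℝ, OneMinusInvPoly s' ∧
      ∀ (A : Set (List Bool)) (S : ProofSystem r), S.SizeLE p →
        S.Recognizes A (fun _ => 1) s → ∀ x : List Bool,
          (x ∈ A →
            (S.verifier x).gameValue = 1 ∧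
            ((∃ P : (S.verifier x).Provers, P.acceptProb = 1) →
              ∃ G : (S.verifier x).Strategy, G.acceptProb = 1)) ∧
          (x ∉ A → ∀ G : (S.verifier x).Strategy, G.acceptProb ≤ s' x.length) := by
  have hγ : ∀ n, 0 < 1 - s n := fun n => sub_pos.2 (hs.1 n)
  -- The bound of `Strategy.acceptProb_le` with γ = 1 - s(n), which is at most 1 - MAP for x ∉ A.
  refine ⟨fun n => 1 - (80 * (p n + 1) * (2 * p n + 3) ^ 3 * (3 + 2 * (1 - s n)⁻¹))⁻¹,
    ⟨fun n => ?_, ?_⟩, fun A S hS hA x => ⟨fun hx => ⟨?_, ?_⟩, fun hx G => ?_⟩⟩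
  · have := hγ n
    rw [sub_lt_self_iff]
    positivity
  · obtain ⟨p', hp'⟩ := hp
    obtain ⟨q, hq⟩ := hs.2
    -- 1/(1 - s') is the displayed product itself, so polynomial bounds for p and 1/(1 - s) can be
    -- substituted into it.
    refine ⟨80 * (p' + 1) * (2 * p' + 3) ^ 3 * (3 + 2 * q), fun n => ?_⟩
    have h1 := hp' n
    have h2 := hq n
    have := hγ n
    simp only [sub_sub_cancel, inv_inv, Polynomial.eval_mul, Polynomial.eval_add,
      Polynomial.eval_pow, Polynomial.eval_ofNat, Polynomial.eval_one]
    push_cast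
    gcongr
  · exact Verifier.gameValue_eq_one (hr_pos _) ((hA x).1 hx)
  · rintro ⟨P, hP⟩
    exact ⟨P.strategy, le_antisymm (Verifier.Strategy.acceptProb_le_one (hr_pos _) _)
      (hP ▸ Verifier.acceptProb_le_strategy P (hr_pos _))⟩
  · obtain ⟨hV, -, hL⟩ := hS x
    exact G.acceptProb_le (hr_pos _) (hγ _) (sub_le_sub_left ((hA x).2 hx) 1) hV hL
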